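/- Conventions. In Set Cover the input is a ground set $[n]$ and a collection of $m>n$ subsets (given as a list) whose union is $[n]$, and the goal is to find a smallest sub-collection whose union is $[n]$; for a function $\Delta:\mathbb N\to\mathbb N$, $\Delta$-Set Cover is the restriction to instances in which every set has size at most $\Delta(n)$. Directed Hamiltonicity asks whether a given directed graph has a simple directed cycle through all its nodes or, in the other version, a simple directed path through all its nodes. Algorithms run on a random access machine; they are either all deterministic, or all randomized (always within the time bound, and correct with probability at least $2/3$ on every instance). $O^*(\cdot)$ hides a factor polynomial in the instance size ($n+m$ for Set Cover, $\tilde n$ for a graph on $\tilde n$ nodes). Theorem. There are absolute constants $C,K>0$ such that for every $\varepsilon>0$ there is $\delta=\delta(\varepsilon)>0$ with the following property, both for deterministic and for randomized algorithms. Suppose that for every $\Delta:\mathbb N\to\mathbb N$ with $\Delta(n)\le \frac{C}{\varepsilon}\log n$ for all $n$, some algorithm solves, in time $O^*(2^{(1-\varepsilon)n})$, those instances of $\Delta$-Set Cover in which all sets are of the same size and every optimal solution has size at most $K\varepsilon n/\log n$ and consists of pairwise disjoint sets (nothing is required of the algorithm on other instances). Then Directed Hamiltonicity on $\tilde n$ nodes,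 in the cycle and in the path version, can be solved in time $O^*(2^{(1-\delta)\tilde n})$. In particular, if Log-SeCoCo fails, i.e. there is $\varepsilon>0$ such that for every $\Delta(n)=O(\frac1\varepsilon\log n)$, $\Delta$-Set Cover can be solved in time $O^*(2^{(1-\varepsilon)n})$, then Directed Hamiltonicity on $\tilde n$ nodes can be solved in time $O^*(2^{(1-\delta)\tilde n})$ for some $\delta=\delta(\varepsilon)>0$. -/

import Mathlib

open MeasureTheory
open scoped ENNReal

/-!
## The machine model

A random access machine (RAM) in structured form.  The memory consists of arrays
`0, 1, 2, …` of natural numbers (a program mentions only finitely many of them; a register is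
a cell with a fixed index).  The arithmetic instructions are successor and predecessor, i.e. this
is the successor RAM, with comparisons.  Every executed instruction or test has unit cost.
Since a value can grow only by a constant in one step, every number in memory stays below
(largest input number + constant * time), so unit cost is honest: words have logarithmically
many bits, and the running time agrees with that on a logarithmic-cost RAM or on a RAM with
logarithmic word length up to factors polynomial in the logarithm of the running time, which are
hidden in `O*(·)`.

A randomized algorithm has in addition access to an infinite sequence `R` of random bits.
-/

namespace RAM

/-- A memory content: `s a i` is the number in cell `i` of array `a`. -/
abbrev Store : Type := ℕ → ℕ → ℕ

/-- Expressions. A program contains only finitely many expressions, so that the evaluation of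
each one takes a constant number of elementary operations. -/
inductive Expr : Type
  /-- a numerical constant -/
  | lit (k : ℕ)
  /-- the content of a cell of the given array; the index is computed (indirect addressing) -/
  | get (a : ℕ) (i : Expr)
  /-- the random bit with the given index -/
  | coin (i : Expr)
  | succ (e : Expr)
  | pred (e : Expr)
  /-- `1` if the first value is less than the second one, and `0` otherwise -/
  | lt (e f : Expr)
  /-- `1` if the two values are equal, and `0` otherwise -/
  | eq (e f : Expr)

/-- The value of an expression, for the random bits `R` and the memory content `s`. -/
def Expr.eval (R : ℕ → Bool) (s : Store) : Expr → ℕ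
  | .lit k => k
  | .get a i => s a (i.eval R s)
  | .coin i => (R (i.eval R s)).toNat
  | .succ e => e.eval R s + 1
  | .pred e => e.eval R s - 1
  | .lt e f => if e.eval R s < f.eval R s then 1 else 0
  | .eq e f => if e.eval R s = f.eval R s then 1 else 0

/-- Programs. -/
inductive Prog : Type
  /-- do nothing -/
  | nop
  /-- write the value of `e` into the cell of array `a` with index the value of `i` -/
  | assign (a : ℕ) (i e : Expr)
  /-- run `p`, then `q` -/
  | seq (p q : Prog)
  /-- run `p` if the value of `e` is not `0`, and `q` otherwise -/
  | branch (e : Expr) (p q : Prog)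
  /-- run `p` repeatedly, as long as the value of `e` is not `0` -/
  | loop (e : Expr) (p : Prog)

/-- The memory content after writing `v` into cell `i` of array `a`. -/
def Store.write (s : Store) (a i v : ℕ) : Store :=
  fun b j => if b = a ∧ j = i then v else s b j

/-- `Exec R p s s' t`: with the random bits `R`, the program `p`, started with memory
content `s`, halts with memory content `s'` after exactly `t` steps. -/
inductive Exec (R : ℕ → Bool) : Prog → Store → Store → ℕ → Prop
  | nop (s : Store) : Exec R .nop s s 1
  | assign (a : ℕ) (i e : Expr) (s : Store) :
      Exec R (.assign a i e) s (s.write a (i.eval R s) (e.eval R s)) 1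
  | seq {p q : Prog} {s s' s'' : Store} {t t' : ℕ} :
      Exec R p s s' t → Exec R q s' s'' t' → Exec R (.seq p q) s s'' (t + t')
  | branch_true {e : Expr} {p q : Prog} {s s' : Store} {t : ℕ} :
      e.eval R s ≠ 0 → Exec R p s s' t → Exec R (.branch e p q) s s' (t + 1)
  | branch_false {e : Expr} {p q : Prog} {s s' : Store} {t : ℕ} :
      e.eval R s = 0 → Exec R q s s' t → Exec R (.branch e p q) s s' (t + 1)
  | loop_true {e : Expr} {p : Prog} {s s' s'' : Store} {t t' : ℕ} :
      e.eval R s ≠ 0 → Exec R p s s' t → Exec R (.loop e p) s' s'' t' →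
      Exec R (.loop e p) s s'' (t + t' + 1)
  | loop_false {e : Expr} {p : Prog} {s : Store} :
      e.eval R s = 0 → Exec R (.loop e p) s s 1

/-- The distribution of an infinite sequence of independent fair coin flips. -/
noncomputable def coinMeasure : Measure (ℕ → Bool) :=
  Measure.infinitePi fun _ : ℕ => (PMF.uniformOfFintype Bool).toMeasure

end RAM

/-!
## Computational problems and `O*`
-/

/-- A computational problem: its instances, how they are presented in the memory, the parameter
`n` and the size of an instance, and which final memory contents are a correct answer. -/
structure Problem where
  /-- the instances -/
  Inst : Type
  /-- the initial memory content for an instance -/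
  input : Inst → RAM.Store
  /-- the parameter by which the exponential part of the running time is measured -/
  param : Inst → ℕ
  /-- the size of an instance -/
  size : Inst → ℕ
  /-- correctness of the final memory content -/
  correct : Inst → RAM.Store → Prop

/-- The two kinds of algorithms. -/
inductive AlgKind : Type
  | deterministic
  | randomized

/-- `P.SolvableInTime kind X γ`: some algorithm of the given kind solves the problem `P`,
restricted to the instances in `X`, in time `O*(2 ^ (γ * n))`, where `O*` hides a factor that is
polynomial in the size of the instance.  Nothing is required of the algorithm outside `X`.
A deterministic algorithm always has to be correct (whatever the content of the random bits,
which it can ignore); a randomized one obeys the time bound for all random bits and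
is correct with probability at least `2 / 3` on every instance in `X`. -/
def Problem.SolvableInTime (P : Problem) (kind : AlgKind) (X : Set P.Inst) (γ : ℝ) : Prop :=
  ∃ (p : RAM.Prog) (c : ℕ), ∀ x ∈ X,
    (∀ R : ℕ → Bool, ∃ (s : RAM.Store) (t : ℕ), RAM.Exec R p (P.input x) s t ∧
      (t : ℝ) ≤ (c : ℝ) * (P.size x : ℝ) ^ c * (2 : ℝ) ^ (γ * (P.param x : ℝ))) ∧
    match kind with
    | .deterministic =>
        ∀ R : ℕ → Bool, ∃ (s : RAM.Store) (t : ℕ), RAM.Exec R p (P.input x) s t ∧ P.correct x s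
    | .randomized =>
        (2 / 3 : ℝ≥0∞) ≤ RAM.coinMeasure
          {R | ∃ (s : RAM.Store) (t : ℕ), RAM.Exec R p (P.input x) s t ∧ P.correct x s}

/-!
## Set Cover
-/

/-- An instance of Set Cover: the ground set `Fin n` and a collection of `m` subsets of it. -/
structure SetCoverInst where
  /-- the number of elements -/
  n : ℕ
  /-- the number of sets -/
  m : ℕ
  /-- the sets -/
  S : Fin m → Finset (Fin n)

namespace SetCoverInst

variable (I : SetCoverInst)

/-- The union of the sub-collection `J` is the entire ground set. -/
def IsCover (J : Finset (Fin I.m)) : Prop :=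
  ∀ x : Fin I.n, ∃ j ∈ J, x ∈ I.S j

/-- An optimal solution: a smallest sub-collection whose union is the entire ground set. -/
def IsOptimal (J : Finset (Fin I.m)) : Prop :=
  I.IsCover J ∧ ∀ J' : Finset (Fin I.m), I.IsCover J' → J.card ≤ J'.card

/-- All sets have size at most `d`. -/
def SetsBoundedBy (d : ℕ) : Prop :=
  ∀ j : Fin I.m, (I.S j).card ≤ d

/-- All sets have the same size. -/
def AllSetsSameSize : Prop :=
  ∃ q : ℕ, ∀ j : Fin I.m, (I.S j).card = q

/-- The sets of the sub-collection `J` are pairwise disjoint. -/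
def ConsistsOfDisjointSets (J : Finset (Fin I.m)) : Prop :=
  ∀ i ∈ J, ∀ j ∈ J, i ≠ j → Disjoint (I.S i) (I.S j)

open Classical in
/-- The presentation in memory: `n` and `m` in cells `0` and `1` of array `0`, and the `m × n`
incidence matrix, row by row, in array `1`. -/
noncomputable def input : RAM.Store := fun a k =>
  if a = 0 then (if k = 0 then I.n else if k = 1 then I.m else 0)
  else if a = 1 then
    (if ∃ (j : Fin I.m) (x : Fin I.n), k = (j : ℕ) * I.n + (x : ℕ) ∧ x ∈ I.S j then 1 else 0)
  else 0

/-- The sub-collection that a memory content presents as the answer: set `j` is selected if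
cell `j` of array `2` is not `0`. -/
def answer (s : RAM.Store) : Finset (Fin I.m) :=
  Finset.univ.filter fun j : Fin I.m => s 2 j ≠ 0

end SetCoverInst

/-- Set Cover: find a smallest sub-collection whose union is the entire ground set. -/
noncomputable def setCover : Problem where
  Inst := SetCoverInst
  input := SetCoverInst.input
  param := fun I => I.n
  size := fun I => I.n + I.m + 1
  correct := fun I s => I.IsOptimal (I.answer s)

/-- The instances of `Δ`-Set Cover, for a function `Δ` of the number `n` of elements, in which
there are more sets than elements, a cover exists, all sets are of the same size, and every
optimal solution has size at most `κ * n / log n` and consists of disjoint sets. -/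
def restrictedDeltaSetCover (Δ : ℕ → ℕ) (κ : ℝ) : Set SetCoverInst :=
  {I | I.n < I.m ∧
    I.SetsBoundedBy (Δ I.n) ∧
    (∃ J, I.IsCover J) ∧
    I.AllSetsSameSize ∧
    ∀ J, I.IsOptimal J →
      (J.card : ℝ) * Real.log (I.n : ℝ) ≤ κ * (I.n : ℝ) ∧ I.ConsistsOfDisjointSets J}

/-!
## Directed Hamiltonicity
-/

/-- An instance of Directed Hamiltonicity: a directed graph on the nodes `Fin n`
(anti-parallel edges are allowed). -/
structure DigraphInst where
  /-- the number of nodes -/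
  n : ℕ
  /-- the directed graph -/
  G : Digraph (Fin n)

namespace DigraphInst

variable (D : DigraphInst)

/-- Some ordering of all nodes is a directed path. -/
def HasHamiltonianPath : Prop :=
  ∃ v : Equiv.Perm (Fin D.n), ∀ (i : ℕ) (h : i + 1 < D.n),
    D.G.Adj (v ⟨i, Nat.lt_of_succ_lt h⟩) (v ⟨i + 1, h⟩)

/-- Some cyclic ordering of all nodes is a directed cycle. -/
def HasHamiltonianCycle : Prop :=
  ∃ v : Equiv.Perm (Fin D.n), ∀ i : Fin D.n, D.G.Adj (v i) (v (finRotate D.n i))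

open Classical in
/-- The presentation in memory: `n` in cell `0` of array `0`, and the `n × n` adjacency matrix,
row by row, in array `1`. -/
noncomputable def input : RAM.Store := fun a k =>
  if a = 0 then (if k = 0 then D.n else 0)
  else if a = 1 then
    (if ∃ x y : Fin D.n, k = (x : ℕ) * D.n + (y : ℕ) ∧ D.G.Adj x y then 1 else 0)
  else 0

end DigraphInst

/-- The decision problem for a property of directed graphs: the answer is yes if
cell `0` of array `2` is not `0` in the end. -/
noncomputable def digraphProblem (Q : DigraphInst → Prop) : Problem where
  Inst := DigraphInst
  input := DigraphInst.input
  param := fun D => D.n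
  size := fun D => D.n + 1
  correct := fun D s => s 2 0 ≠ 0 ↔ Q D

/-- Directed Hamiltonicity, in the version for paths. -/
noncomputable def directedHamPath : Problem :=
  digraphProblem DigraphInst.HasHamiltonianPath

/-- Directed Hamiltonicity, in the version for cycles. -/
noncomputable def directedHamCycle : Problem :=
  digraphProblem DigraphInst.HasHamiltonianCycle

/-! ### Determinism of execution and elementary facts about memory contents -/

namespace RAM

/-! Both versions of the problem become the search for a Hamiltonian path on `N = k * l` numbers. A
forced tail `n, …, N - 1` pads the given graph; for cycles, the edges into node `0` are cut and
redirected to the tail (`hasHamiltonianPath_iff`, `hasHamiltonianCycle_iff`). A Hamiltonian path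
splits into `k` blocks of `l` consecutive nodes, where `l` is of order `log N / ε`. Guess the first
nodes of the blocks, and take as sets the node sets of all simple paths on `l` nodes that begin in a
guessed node and whose end has an edge to the next guessed node. All sets have size `l`, so every
cover has at least `k` sets, and a cover by `k` sets is a partition. Its blocks begin in differently
numbered guesses, so they can be strung together to a Hamiltonian path (`hamSeq_of_cover`). For a
right guess the blocks of the path form such a cover, and the instance satisfies the promise
(`blockInst_mem`).

Put `L = Nat.size n + b` and `l = a * L`, with `N < 2 ^ L` and `4 ≤ ε * a ≤ 8`. There are `N ^ k ≤ 2
^ (k * L) = 2 ^ (N / a)` guesses, while the Set Cover algorithm saves a factor `2 ^ (ε * N) ≥ 2 ^ (4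
* N / a)` on each. With fuel for a saving of only `3 * N / a` in the exponent, `2 * N / a` remains
after the guesses. Half of this absorbs the factors `2 ^ O(L ^ 2)` for listing the tuples and for
the polynomial in the size of the instance, so that `δ = 1 / a` works (`Scale.le_fuel`,
`exists_time_bound`).

For a wrong guess the promise may fail, and nothing is known about the behaviour of the algorithm.
Therefore it runs on a clock, and its answer is checked. The only possible error is to miss a
Hamiltonian path, and it suffices that the run for one right guess succeeds. This guess depends on
the graph and not on the random bits, so the success probability carries over without amplification
(`digraphProblem_solvable`). For `ε > 1` the hypothesis on Set Cover is contradictory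
(`not_solvable_of_one_lt`).

The rest is the implementation on the machine. Terms with bounded sums are compiled
(`Tm.exists_compileSpec`); `PolyRun` is a calculus of pre- and postconditions with time bounds that
are powers of a bound `M` for the numbers in memory; `clock_spec` and `clearLog_exec` allow an
arbitrary program to be run repeatedly in the same memory. -/

theorem Exec.det {R : ℕ → Bool} {p : Prog} {s s₁ s₂ : Store} {t₁ t₂ : ℕ}
    (h₁ : Exec R p s s₁ t₁) (h₂ : Exec R p s s₂ t₂) : s₁ = s₂ ∧ t₁ = t₂ := by
  induction h₁ generalizing s₂ t₂ with
  | nop s => cases h₂; exact ⟨rfl, rfl⟩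
  | assign a i e s => cases h₂; exact ⟨rfl, rfl⟩
  | seq _ _ ih₁ ih₂ =>
    cases h₂ with
    | seq h h' =>
      obtain ⟨rfl, rfl⟩ := ih₁ h
      obtain ⟨rfl, rfl⟩ := ih₂ h'
      exact ⟨rfl, rfl⟩
  | branch_true he _ ih =>
    cases h₂ with
    | branch_true _ h => obtain ⟨rfl, rfl⟩ := ih h; exact ⟨rfl, rfl⟩
    | branch_false h _ => exact absurd h he
  | branch_false he _ ih =>
    cases h₂ with
    | branch_false _ h => obtain ⟨rfl, rfl⟩ := ih h; exact ⟨rfl, rfl⟩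
    | branch_true h _ => exact absurd he h
  | loop_true he _ _ ih₁ ih₂ =>
    cases h₂ with
    | loop_true _ h h' =>
      obtain ⟨rfl, rfl⟩ := ih₁ h
      obtain ⟨rfl, rfl⟩ := ih₂ h'
      exact ⟨rfl, rfl⟩
    | loop_false h => exact absurd h he
  | loop_false he =>
    cases h₂ with
    | loop_true h _ _ => exact absurd he h
    | loop_false _ => exact ⟨rfl, rfl⟩

theorem Exec.of_eq {R : ℕ → Bool} {p : Prog} {s s₁ s₂ : Store} {t : ℕ} (h : s₁ = s₂)
    (h₁ : Exec R p s s₁ t) : Exec R p s s₂ t :=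
  h ▸ h₁

theorem Store.write_apply (s : Store) (a i v b j : ℕ) :
    s.write a i v b j = if b = a ∧ j = i then v else s b j := rfl

@[simp] theorem Store.write_same (s : Store) (a i v : ℕ) : s.write a i v a i = v := by
  simp [Store.write]

theorem Store.write_of_ne_array (s : Store) {a b : ℕ} (i v j : ℕ) (h : b ≠ a) :
    s.write a i v b j = s b j := by
  simp [Store.write, h]

theorem Store.write_of_ne_index (s : Store) (a : ℕ) {i j : ℕ} (v : ℕ) (b : ℕ) (h : j ≠ i) :
    s.write a i v b j = s b j := by
  simp [Store.write, h]

/-! ### Terms with bounded sums and their compilation -/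

/-- Terms that are evaluated by programs. A variable is named by the number of binders around
the binder that introduces it. -/
inductive Tm : Type
  | lit (k : ℕ)
  | var (q : ℕ)
  /-- the content of a cell -/
  | arr (a : ℕ) (t : Tm)
  /-- whether the content of a cell is not `0` -/
  | test (a : ℕ) (t : Tm)
  | pred (t : Tm)
  | lt (t u : Tm)
  | eq (t u : Tm)
  | ite (c t u : Tm)
  | add (t u : Tm)
  /-- the sum of the values of `f` for all values of the bound variable less than `b` -/
  | sum (b f : Tm)

namespace Tm

/-- The value of a term below `q` binders, for the values `ρ` of the bound variables. -/
def eval : Tm → ℕ → (ℕ → ℕ) → Store → ℕ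
  | lit k, _, _, _ => k
  | var i, _, ρ, _ => ρ i
  | arr a t, q, ρ, s => s a (t.eval q ρ s)
  | test a t, q, ρ, s => if s a (t.eval q ρ s) = 0 then 0 else 1
  | pred t, q, ρ, s => t.eval q ρ s - 1
  | lt t u, q, ρ, s => if t.eval q ρ s < u.eval q ρ s then 1 else 0
  | eq t u, q, ρ, s => if t.eval q ρ s = u.eval q ρ s then 1 else 0
  | ite c t u, q, ρ, s => if c.eval q ρ s = 0 then u.eval q ρ s else t.eval q ρ s
  | add t u, q, ρ, s => t.eval q ρ s + u.eval q ρ s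
  | sum b f, q, ρ, s =>
      ∑ j ∈ Finset.range (b.eval q ρ s), f.eval (q + 1) (Function.update ρ q j) s

/-- Well-formedness of a term below `q` binders: the variables are bound, the scratch
arrays `8` and `9` are not read, and numbers are read from the arrays `0, …, 5` only. -/
def WF : Tm → ℕ → Prop
  | lit _, _ => True
  | var i, q => i < q
  | arr a t, q => a < 6 ∧ t.WF q
  | test a t, q => (a ≠ 8 ∧ a ≠ 9) ∧ t.WF q
  | pred t, q => t.WF q
  | lt t u, q => t.WF q ∧ u.WF q
  | eq t u, q => t.WF q ∧ u.WF q
  | ite c t u, q => c.WF q ∧ t.WF q ∧ u.WF q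
  | add t u, q => t.WF q ∧ u.WF q
  | sum b f, q => b.WF q ∧ f.WF (q + 1)

end Tm

/-- Cell `i` of the evaluation stack. -/
abbrev stk (i : ℕ) : Expr := .get 9 (.lit i)

/-- Add cell `y` of the stack to cell `x`, and set it to `0`. -/
def transfer (x y : ℕ) : Prog :=
  .loop (stk y) (.seq (.assign 9 (.lit x) (.succ (stk x))) (.assign 9 (.lit y) (.pred (stk y))))

namespace Tm

/-- Evaluate a term and leave the value in cell `d` of the stack. The cells of the stack
from `d` on, and the bound variables from `q` on, are overwritten. -/
def compile : Tm → ℕ → ℕ → Prog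
  | lit k, _, d => .assign 9 (.lit d) (.lit k)
  | var i, _, d => .assign 9 (.lit d) (.get 8 (.lit i))
  | arr a t, q, d => .seq (t.compile q d) (.assign 9 (.lit d) (.get a (stk d)))
  | test a t, q, d =>
      .seq (t.compile q d) (.assign 9 (.lit d) (.lt (.lit 0) (.get a (stk d))))
  | pred t, q, d => .seq (t.compile q d) (.assign 9 (.lit d) (.pred (stk d)))
  | lt t u, q, d => .seq (t.compile q d) (.seq (u.compile q (d + 1))
      (.assign 9 (.lit d) (.lt (stk d) (stk (d + 1)))))
  | eq t u, q, d => .seq (t.compile q d) (.seq (u.compile q (d + 1))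
      (.assign 9 (.lit d) (.eq (stk d) (stk (d + 1)))))
  | ite c t u, q, d => .seq (c.compile q d) (.branch (stk d) (t.compile q d) (u.compile q d))
  | add t u, q, d => .seq (t.compile q d) (.seq (u.compile q (d + 1)) (transfer d (d + 1)))
  | sum b f, q, d => .seq (b.compile q (d + 1)) (.seq (.assign 9 (.lit d) (.lit 0))
      (.seq (.assign 8 (.lit q) (.lit 0))
        (.loop (.lt (.get 8 (.lit q)) (stk (d + 1)))
          (.seq (f.compile (q + 1) (d + 2)) (.seq (transfer d (d + 2))
            (.assign 8 (.lit q) (.succ (.get 8 (.lit q)))))))))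

end Tm

/-! ### Bounded memory contents, and equality outside the scratch arrays -/

/-- The numbers in the arrays `0, …, 5` are at most `M`. -/
def Bdd (M : ℕ) (s : Store) : Prop := ∀ a < 6, ∀ i, s a i ≤ M

theorem Bdd.mono {M M' : ℕ} {s : Store} (h : Bdd M s) (hM : M ≤ M') : Bdd M' s :=
  fun a ha i => (h a ha i).trans hM

theorem Bdd.write {M : ℕ} {s : Store} (h : Bdd M s) (a i : ℕ) {v : ℕ} (hv : a < 6 → v ≤ M) :
    Bdd M (s.write a i v) := by
  intro b hb j
  rw [Store.write_apply]
  split_ifs with hc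
  · exact hv (hc.1 ▸ hb)
  · exact h b hb j

/-- Equality except in the scratch arrays. -/
def Agree (s s' : Store) : Prop := ∀ a, a ≠ 8 → a ≠ 9 → ∀ i, s a i = s' a i

theorem Agree.refl (s : Store) : Agree s s := fun _ _ _ _ => rfl

theorem Agree.symm {s s' : Store} (h : Agree s s') : Agree s' s :=
  fun a h8 h9 i => (h a h8 h9 i).symm

theorem Agree.trans {s s' s'' : Store} (h : Agree s s') (h' : Agree s' s'') : Agree s s'' :=
  fun a h8 h9 i => (h a h8 h9 i).trans (h' a h8 h9 i)

theorem Agree.write {s s' : Store} (h : Agree s s') (a i v : ℕ) :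
    Agree (s.write a i v) (s'.write a i v) := by
  intro b h8 h9 j
  simp only [Store.write_apply]
  split_ifs
  · rfl
  · exact h b h8 h9 j

theorem Agree.bdd {M : ℕ} {s s' : Store} (h : Agree s s') (hb : Bdd M s) : Bdd M s' :=
  fun a ha i => by rw [← h a (by omega) (by omega)]; exact hb a ha i

namespace Tm

/-- A well-formed term never reads the scratch arrays. Hence its value is not affected by the
evaluation of other terms before it, which is what allows compiled terms to be composed. -/
theorem eval_congr {s s' : Store} (h : Agree s s') (t : Tm) : ∀ (q : ℕ) (ρ : ℕ → ℕ),
    t.WF q → t.eval q ρ s = t.eval q ρ s' := by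
  induction t with
  | lit k => intros; rfl
  | var i => intros; rfl
  | arr a t ih =>
    intro q ρ hw
    have h1 := hw.1
    simp only [eval, ih q ρ hw.2]
    exact h a (by omega) (by omega) _
  | test a t ih =>
    intro q ρ hw
    simp only [eval, ih q ρ hw.2, h a hw.1.1 hw.1.2]
  | pred t ih => intro q ρ hw; simp only [eval, ih q ρ hw]
  | lt t u iht ihu => intro q ρ hw; simp only [eval, iht q ρ hw.1, ihu q ρ hw.2]
  | eq t u iht ihu => intro q ρ hw; simp only [eval, iht q ρ hw.1, ihu q ρ hw.2]
  | ite c t u ihc iht ihu =>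
    intro q ρ hw; simp only [eval, ihc q ρ hw.1, iht q ρ hw.2.1, ihu q ρ hw.2.2]
  | add t u iht ihu => intro q ρ hw; simp only [eval, iht q ρ hw.1, ihu q ρ hw.2]
  | sum b f ihb ihf =>
    intro q ρ hw
    simp only [eval, ihb q ρ hw.1]
    exact Finset.sum_congr rfl fun j _ => ihf _ _ hw.2

theorem pow_add_pow_le {M : ℕ} (hM : 2 ≤ M) (a b : ℕ) : M ^ a + M ^ b ≤ M ^ (a + b + 1) := by
  have h1 : M ^ a ≤ M ^ (a + b) := Nat.pow_le_pow_right (by omega) (by omega)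
  have h2 : M ^ b ≤ M ^ (a + b) := Nat.pow_le_pow_right (by omega) (by omega)
  have h3 : M ^ (a + b) * 2 ≤ M ^ (a + b) * M := Nat.mul_le_mul_left _ hM
  rw [pow_succ]
  omega

/-- Values are polynomial in `M`, with an exponent that depends on the term alone; this controls the
time for transfers and loops. Below a sum, the bound variable can be as large as the bound of the
sum, so the induction hypothesis for `f` is used with `M ^ (e + 1)` in place of `M`. -/
theorem eval_le_pow (t : Tm) : ∃ e : ℕ, ∀ (q M : ℕ) (ρ : ℕ → ℕ) (s : Store), 2 ≤ M → Bdd M s →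
    (∀ i, ρ i ≤ M) → t.WF q → t.eval q ρ s ≤ M ^ (e + 1) := by
  have one_le : ∀ {M e : ℕ}, 2 ≤ M → 1 ≤ M ^ e := fun h => Nat.one_le_pow _ _ (by omega)
  induction t with
  | lit k =>
    refine ⟨k, fun q M ρ s hM _ _ _ => ?_⟩
    calc k ≤ k + 1 := by omega
      _ ≤ 2 ^ (k + 1) := Nat.lt_two_pow_self.le
      _ ≤ M ^ (k + 1) := Nat.pow_le_pow_left hM _
  | var i => exact ⟨0, fun q M ρ s _ _ hρ _ => by simpa [eval] using hρ i⟩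
  | arr a t _ => exact ⟨0, fun q M ρ s _ hb _ hw => by simpa [eval] using hb a hw.1 _⟩
  | test a t _ =>
    refine ⟨0, fun q M ρ s hM _ _ _ => ?_⟩
    have := one_le (e := 0 + 1) hM
    simp only [eval]; split_ifs <;> omega
  | pred t ih =>
    obtain ⟨e, he⟩ := ih
    exact ⟨e, fun q M ρ s hM hb hρ hw => (Nat.sub_le _ _).trans (he q M ρ s hM hb hρ hw)⟩
  | lt t u _ _ =>
    refine ⟨0, fun q M ρ s hM _ _ _ => ?_⟩
    have := one_le (e := 0 + 1) hM
    simp only [eval]; split_ifs <;> omega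
  | eq t u _ _ =>
    refine ⟨0, fun q M ρ s hM _ _ _ => ?_⟩
    have := one_le (e := 0 + 1) hM
    simp only [eval]; split_ifs <;> omega
  | ite c t u _ iht ihu =>
    obtain ⟨e, he⟩ := iht
    obtain ⟨e', he'⟩ := ihu
    refine ⟨e + e', fun q M ρ s hM hb hρ hw => ?_⟩
    simp only [eval]
    split_ifs
    · exact (he' q M ρ s hM hb hρ hw.2.2).trans (Nat.pow_le_pow_right (by omega) (by omega))
    · exact (he q M ρ s hM hb hρ hw.2.1).trans (Nat.pow_le_pow_right (by omega) (by omega))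
  | add t u iht ihu =>
    obtain ⟨e, he⟩ := iht
    obtain ⟨e', he'⟩ := ihu
    refine ⟨e + 1 + (e' + 1), fun q M ρ s hM hb hρ hw => ?_⟩
    exact (Nat.add_le_add (he q M ρ s hM hb hρ hw.1) (he' q M ρ s hM hb hρ hw.2)).trans
      (pow_add_pow_le hM _ _)
  | sum b f ihb ihf =>
    obtain ⟨e, he⟩ := ihb
    obtain ⟨e', he'⟩ := ihf
    refine ⟨(e + 1) * (e' + 2), fun q M ρ s hM hb hρ hw => ?_⟩
    have hbv := he q M ρ s hM hb hρ hw.1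
    have hMM : M ≤ M ^ (e + 1) := Nat.le_self_pow (by omega) _
    have hf : ∀ j ∈ Finset.range (b.eval q ρ s),
        f.eval (q + 1) (Function.update ρ q j) s ≤ (M ^ (e + 1)) ^ (e' + 1) := by
      intro j hj
      refine he' (q + 1) _ _ s (hM.trans hMM) (hb.mono hMM) (fun i => ?_) hw.2
      rw [Function.update_apply]
      split_ifs
      · exact (Finset.mem_range.1 hj).le.trans hbv
      · exact (hρ i).trans hMM
    calc (sum b f).eval q ρ s
        ≤ (Finset.range (b.eval q ρ s)).card • (M ^ (e + 1)) ^ (e' + 1) :=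
          Finset.sum_le_card_nsmul _ _ _ hf
      _ ≤ M ^ (e + 1) * (M ^ (e + 1)) ^ (e' + 1) := by
          rw [Finset.card_range, smul_eq_mul]; exact Nat.mul_le_mul_right _ hbv
      _ = M ^ ((e + 1) * (e' + 2)) := by rw [← pow_succ', ← pow_mul]
      _ ≤ _ := Nat.pow_le_pow_right (by omega) (by omega)

end Tm

/-! ### Correctness and running time of compiled terms -/

theorem transfer_exec (R : ℕ → Bool) {x y : ℕ} (hxy : x ≠ y) : ∀ (v : ℕ) (s : Store), s 9 y = v →
    Exec R (transfer x y) s ((s.write 9 x (s 9 x + v)).write 9 y 0) (3 * v + 1) := by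
  intro v
  induction v with
  | zero =>
    intro s hs
    have : (s.write 9 x (s 9 x + 0)).write 9 y 0 = s := by
      funext b j
      simp only [Store.write_apply]
      split_ifs with h1 h2
      · rw [h1.1, h1.2, hs]
      · rw [h2.1, h2.2, add_zero]
      · rfl
    rw [this]
    exact Exec.loop_false (by simpa [Expr.eval] using hs)
  | succ v ih =>
    intro s hs
    have h1 := Exec.assign (R := R) 9 (.lit x) (.succ (stk x)) s
    have h2 := Exec.assign (R := R) 9 (.lit y) (.pred (stk y))
      (s.write 9 x (s 9 x + 1))
    simp only [Expr.eval] at h1 h2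
    have hy : (s.write 9 x (s 9 x + 1)) 9 y = v + 1 := by
      rw [Store.write_of_ne_index _ _ _ _ hxy.symm, hs]
    rw [hy, Nat.add_sub_cancel] at h2
    have h3 := ih _ (Store.write_same (s.write 9 x (s 9 x + 1)) 9 y v)
    have h4 := Exec.loop_true (e := stk y) (by simp [Expr.eval, hs]) (Exec.seq h1 h2) h3
    have e1 : 1 + 1 + (3 * v + 1) + 1 = 3 * (v + 1) + 1 := by ring
    rw [e1] at h4
    refine Exec.of_eq ?_ h4
    funext b j
    simp only [Store.write_apply]
    by_cases hjy : b = 9 ∧ j = y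
    · rw [if_pos hjy, if_pos hjy]
    · rw [if_neg hjy, if_neg hjy, if_neg hjy]
      by_cases hjx : b = 9 ∧ j = x
      · simp only [if_pos hjx, hxy, and_false, if_false, and_self, if_true]
        omega
      · rw [if_neg hjx, if_neg hjx, if_neg hjx]

/-- Equality except for the bound variables from `q` on and the stack from `d` on. -/
def Keep (q d : ℕ) (s s' : Store) : Prop :=
  ∀ a i, (a = 8 → i < q) → (a = 9 → i < d) → s' a i = s a i

theorem Keep.trans {q d : ℕ} {s s' s'' : Store} (h : Keep q d s s') (h' : Keep q d s' s'') :
    Keep q d s s'' :=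
  fun a i h8 h9 => (h' a i h8 h9).trans (h a i h8 h9)

theorem Keep.weaken {q d q' d' : ℕ} {s s' : Store} (h : Keep q d s s') (hq : q' ≤ q)
    (hd : d' ≤ d) : Keep q' d' s s' :=
  fun a i h8 h9 => h a i (fun e => (h8 e).trans_le hq) (fun e => (h9 e).trans_le hd)

theorem Keep.write_stack {q d : ℕ} {s s' : Store} (h : Keep q d s s') {i : ℕ} (hi : d ≤ i)
    (v : ℕ) : Keep q d s (s'.write 9 i v) := by
  intro a j h8 h9
  rw [Store.write_apply, if_neg (fun hc => by have := h9 hc.1; omega)]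
  exact h a j h8 h9

theorem Keep.write_var {q d : ℕ} {s s' : Store} (h : Keep q d s s') {i : ℕ} (hi : q ≤ i)
    (v : ℕ) : Keep q d s (s'.write 8 i v) := by
  intro a j h8 h9
  rw [Store.write_apply, if_neg (fun hc => by have := h8 hc.1; omega)]
  exact h a j h8 h9

theorem Keep.agree {q d : ℕ} {s s' : Store} (h : Keep q d s s') : Agree s s' :=
  fun a h8 h9 i => (h a i (fun e => absurd e h8) (fun e => absurd e h9)).symm

namespace Tm

/-- The specification of a compiled term. -/
def CompileSpec (t : Tm) (q d κ : ℕ) : Prop :=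
  ∀ (R : ℕ → Bool) (M : ℕ) (s : Store) (ρ : ℕ → ℕ), 2 ≤ M → Bdd M s → (∀ i < q, s 8 i = ρ i) →
    (∀ i, ρ i ≤ M) → t.WF q →
    ∃ s' τ, Exec R (t.compile q d) s s' τ ∧ τ ≤ M ^ κ ∧ s' 9 d = t.eval q ρ s ∧ Keep q d s s'

theorem compileSpec_unary {t u : Tm} {q d κ : ℕ} {e : Expr}
    (hc : u.compile q d = .seq (t.compile q d) (.assign 9 (.lit d) e))
    (hw : u.WF q → t.WF q) (ht : t.CompileSpec q d κ)
    (he : ∀ (R : ℕ → Bool) (ρ : ℕ → ℕ) (s s' : Store), u.WF q → Agree s s' →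
      s' 9 d = t.eval q ρ s → e.eval R s' = u.eval q ρ s) :
    u.CompileSpec q d (κ + 1) := by
  intro R M s ρ hM hb h8 hρ hwf
  obtain ⟨s₁, τ, h1, h2, h3, h4⟩ := ht R M s ρ hM hb h8 hρ (hw hwf)
  have hv := he R ρ s s₁ hwf h4.agree h3
  refine ⟨_, _, hc ▸ Exec.seq h1 (.assign _ _ _ _), ?_, ?_, ?_⟩
  · have : M ^ κ * 2 ≤ M ^ (κ + 1) := by rw [pow_succ]; exact Nat.mul_le_mul_left _ hM
    have : 1 ≤ M ^ κ := Nat.one_le_pow _ _ (by omega)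
    omega
  · rw [hv]; exact Store.write_same _ _ _ _
  · exact h4.write_stack le_rfl _

theorem compileSpec_binary {t u v : Tm} {q d κ κ' : ℕ} {e : Expr}
    (hc : v.compile q d = .seq (t.compile q d) (.seq (u.compile q (d + 1))
      (.assign 9 (.lit d) e)))
    (hw : v.WF q → t.WF q ∧ u.WF q) (ht : t.CompileSpec q d κ) (hu : u.CompileSpec q (d + 1) κ')
    (he : ∀ (R : ℕ → Bool) (ρ : ℕ → ℕ) (s s' : Store),
      s' 9 d = t.eval q ρ s → s' 9 (d + 1) = u.eval q ρ s → e.eval R s' = v.eval q ρ s) :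
    v.CompileSpec q d (κ + κ' + 2) := by
  intro R M s ρ hM hb h8 hρ hwf
  obtain ⟨s₁, τ, h1, h2, h3, h4⟩ := ht R M s ρ hM hb h8 hρ (hw hwf).1
  obtain ⟨s₂, τ', h1', h2', h3', h4'⟩ := hu R M s₁ ρ hM (h4.agree.bdd hb)
    (fun i hi => by rw [h4 8 i (fun _ => hi) (by omega)]; exact h8 i hi) hρ (hw hwf).2
  have hd : s₂ 9 d = t.eval q ρ s := by rw [h4' 9 d (by omega) (by omega), h3]
  rw [← eval_congr h4.agree _ _ _ (hw hwf).2] at h3'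
  have hv := he R ρ s s₂ hd h3'
  refine ⟨_, _, hc ▸ Exec.seq h1 (Exec.seq h1' (.assign _ _ _ _)), ?_, ?_, ?_⟩
  · have h5 := pow_add_pow_le hM κ κ'
    have h6 : M ^ (κ + κ' + 1) * 2 ≤ M ^ (κ + κ' + 1 + 1) := by
      rw [pow_succ _ (κ + κ' + 1)]; exact Nat.mul_le_mul_left _ hM
    have : 1 ≤ M ^ (κ + κ' + 1) := Nat.one_le_pow _ _ (by omega)
    show _ ≤ M ^ (κ + κ' + 1 + 1)
    omega
  · rw [hv]; exact Store.write_same _ _ _ _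
  · exact (h4.trans (h4'.weaken le_rfl (by omega))).write_stack le_rfl _

/-- After `j` rounds, cell `d` contains the partial sum. The evaluation of `f` respects the
variables up to `q` and the stack below `d + 2`, hence the counter, the bound and the partial sum.
The bound `e` for the values of `f` pays for the transfers. -/
theorem compile_sum_loop {f : Tm} {q d κ e : ℕ} (hf : f.CompileSpec (q + 1) (d + 2) κ)
    {R : ℕ → Bool} {M n : ℕ} {s₀ : Store} {ρ : ℕ → ℕ} (hM : 2 ≤ M) (hb : Bdd M s₀)
    (hρ : ∀ i, ρ i ≤ M) (hn : n ≤ M) (hw : f.WF (q + 1))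
    (hV : ∀ j < n, f.eval (q + 1) (Function.update ρ q j) s₀ ≤ e) :
    ∀ (r j : ℕ) (s : Store), j + r = n → Agree s₀ s → (∀ i < q, s 8 i = ρ i) → s 8 q = j →
      s 9 (d + 1) = n →
      s 9 d = ∑ j ∈ Finset.range j, f.eval (q + 1) (Function.update ρ q j) s₀ →
      ∃ s' τ, Exec R (.loop (.lt (.get 8 (.lit q)) (stk (d + 1)))
          (.seq (f.compile (q + 1) (d + 2)) (.seq (transfer d (d + 2))
            (.assign 8 (.lit q) (.succ (.get 8 (.lit q))))))) s s' τ ∧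
        τ ≤ r * (M ^ κ + 3 * e + 3) + 1 ∧
        s' 9 d = ∑ j ∈ Finset.range n, f.eval (q + 1) (Function.update ρ q j) s₀ ∧
        Keep q d s s' := by
  intro r
  induction r with
  | zero =>
    intro j s hj _ _ hq hd1 hd
    refine ⟨s, 1, Exec.loop_false ?_, by omega, ?_, fun _ _ _ _ => rfl⟩
    · simp only [Expr.eval, hq, hd1]; rw [if_neg (by omega)]
    · rw [hd]; congr 2
  | succ r ih =>
    intro j s hj hA hvar hq hd1 hd
    obtain ⟨s₁, τ, h1, h2, h3, h4⟩ := hf R M s (Function.update ρ q j) hM (hA.bdd hb)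
      (fun i hi => by
        rw [Function.update_apply]
        split_ifs with h
        · rw [h, hq]
        · exact hvar i (by omega))
      (fun i => by
        rw [Function.update_apply]
        split_ifs with h
        · omega
        · exact hρ i) hw
    rw [← eval_congr hA _ _ _ hw] at h3
    have h5 := transfer_exec R (x := d) (y := d + 2) (by omega) _ _ h3
    set w := f.eval (q + 1) (Function.update ρ q j) s₀ with hwdef
    set s₂ := (s₁.write 9 d (s₁ 9 d + w)).write 9 (d + 2) 0 with hs₂
    have h6 := Exec.assign (R := R) 8 (.lit q) (.succ (.get 8 (.lit q))) s₂
    simp only [Expr.eval] at h6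
    have hK2 : Keep (q + 1) d s s₂ :=
      ((h4.weaken le_rfl (by omega)).write_stack le_rfl _).write_stack (by omega) _
    have hq2 : s₂ 8 q = j := by rw [hK2 8 q (by omega) (by omega), hq]
    rw [hq2] at h6
    have hKK : Keep q d s (s₂.write 8 q (j + 1)) := (hK2.weaken (by omega) le_rfl).write_var le_rfl _
    have hd2 : s₂ 9 (d + 1) = n := by
      rw [hs₂, Store.write_of_ne_index _ _ _ _ (by omega),
        Store.write_of_ne_index _ _ _ _ (by omega), h4 9 (d + 1) (by omega) (by omega), hd1]
    have hdd : s₂ 9 d = ∑ j ∈ Finset.range (j + 1), f.eval (q + 1) (Function.update ρ q j) s₀ := by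
      rw [hs₂, Store.write_of_ne_index _ _ _ _ (by omega), Store.write_same,
        h4 9 d (by omega) (by omega), hd, Finset.sum_range_succ]
    obtain ⟨s', τ', h7, h8, h9, h10⟩ := ih (j + 1) (s₂.write 8 q (j + 1)) (by omega)
      (hA.trans hKK.agree)
      (fun i hi => by rw [hKK 8 i (fun _ => hi) (by omega)]; exact hvar i hi)
      (Store.write_same _ _ _ _)
      (by rw [Store.write_of_ne_array _ _ _ _ (by omega)]; exact hd2)
      (by rw [Store.write_of_ne_array _ _ _ _ (by omega)]; exact hdd)
    refine ⟨s', _, Exec.loop_true ?_ (Exec.seq h1 (Exec.seq h5 h6)) h7, ?_, h9, hKK.trans h10⟩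
    · simp only [Expr.eval, hq, hd1]; rw [if_pos (by omega)]; exact one_ne_zero
    · have hwe : w ≤ e := hV j (by omega)
      have : (r + 1) * (M ^ κ + 3 * e + 3) = r * (M ^ κ + 3 * e + 3) + (M ^ κ + 3 * e + 3) := by ring
      omega

/-- A constant factor goes into the exponent since `c ≤ 2 ^ c ≤ M ^ c`. This is why all time bounds
can be pure powers of `M`, and why `2 ≤ M` is assumed throughout. -/
theorem le_pow_succ_of_le {M : ℕ} (hM : 2 ≤ M) {x κ : ℕ} (c : ℕ) (h : x ≤ c * M ^ κ) :
    x ≤ M ^ (κ + c) := by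
  have h1 : c ≤ M ^ c := (Nat.lt_two_pow_self.le).trans (Nat.pow_le_pow_left hM _)
  calc x ≤ c * M ^ κ := h
    _ ≤ M ^ c * M ^ κ := Nat.mul_le_mul_right _ h1
    _ = M ^ (κ + c) := by rw [← pow_add, add_comm]

theorem exists_compileSpec (t : Tm) : ∀ q d, ∃ κ, t.CompileSpec q d κ := by
  induction t with
  | lit k =>
    refine fun q d => ⟨0, fun R M s ρ hM hb h8 hρ hw =>
      ⟨_, 1, .assign _ _ _ _, le_rfl, Store.write_same _ _ _ _, ?_⟩⟩
    exact Keep.write_stack (fun _ _ _ _ => rfl) le_rfl _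
  | var i =>
    refine fun q d => ⟨0, fun R M s ρ hM hb h8 hρ hw =>
      ⟨_, 1, .assign _ _ _ _, le_rfl, ?_, ?_⟩⟩
    · exact (Store.write_same _ _ _ _).trans (h8 i hw)
    · exact Keep.write_stack (fun _ _ _ _ => rfl) le_rfl _
  | arr a t ih =>
    intro q d
    obtain ⟨κ, h⟩ := ih q d
    refine ⟨_, compileSpec_unary rfl (fun hw => hw.2) h fun R ρ s s' hw hA hs => ?_⟩
    have := hw.1
    simp only [Expr.eval, eval, hs]
    exact (hA a (by omega) (by omega) _).symm
  | test a t ih =>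
    intro q d
    obtain ⟨κ, h⟩ := ih q d
    refine ⟨_, compileSpec_unary rfl (fun hw => hw.2) h fun R ρ s s' hw hA hs => ?_⟩
    simp only [Expr.eval, eval, hs, hA a hw.1.1 hw.1.2]
    by_cases h0 : s' a (t.eval q ρ s) = 0
    · simp [h0]
    · simp [h0, Nat.pos_of_ne_zero h0]
  | pred t ih =>
    intro q d
    obtain ⟨κ, h⟩ := ih q d
    refine ⟨_, compileSpec_unary rfl id h fun R ρ s s' hw hA hs => ?_⟩
    simp only [Expr.eval, eval, hs]
  | lt t u iht ihu =>
    intro q d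
    obtain ⟨κ, h⟩ := iht q d
    obtain ⟨κ', h'⟩ := ihu q (d + 1)
    refine ⟨_, compileSpec_binary rfl id h h' fun R ρ s s' h1 h2 => ?_⟩
    simp only [Expr.eval, eval, h1, h2]
  | eq t u iht ihu =>
    intro q d
    obtain ⟨κ, h⟩ := iht q d
    obtain ⟨κ', h'⟩ := ihu q (d + 1)
    refine ⟨_, compileSpec_binary rfl id h h' fun R ρ s s' h1 h2 => ?_⟩
    simp only [Expr.eval, eval, h1, h2]
  | ite c t u ihc iht ihu =>
    intro q d
    obtain ⟨κ, h⟩ := ihc q d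
    obtain ⟨κ₁, h₁⟩ := iht q d
    obtain ⟨κ₂, h₂⟩ := ihu q d
    refine ⟨κ + (κ₁ + κ₂) + 3, fun R M s ρ hM hb h8 hρ hw => ?_⟩
    obtain ⟨s₁, τ, g1, g2, g3, g4⟩ := h R M s ρ hM hb h8 hρ hw.1
    have h8' : ∀ i < q, s₁ 8 i = ρ i := fun i hi => by
      rw [g4 8 i (fun _ => hi) (by omega)]; exact h8 i hi
    have hp : ∀ κ', κ' ≤ κ + (κ₁ + κ₂) → M ^ κ' ≤ M ^ (κ + (κ₁ + κ₂)) :=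
      fun κ' hκ => Nat.pow_le_pow_right (by omega) hκ
    have ha := hp κ (by omega)
    have hb1 := hp κ₁ (by omega)
    have hb2 := hp κ₂ (by omega)
    have hone := hp 0 (by omega)
    rw [pow_zero] at hone
    by_cases hc : c.eval q ρ s = 0
    · obtain ⟨s₂, τ', k1, k2, k3, k4⟩ := h₂ R M s₁ ρ hM (g4.agree.bdd hb) h8' hρ hw.2.2
      refine ⟨s₂, _, Exec.seq g1 (Exec.branch_false (by simpa [Expr.eval, g3] using hc) k1),
        le_pow_succ_of_le hM 3 (by omega), ?_, g4.trans k4⟩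
      rw [k3, ← eval_congr g4.agree _ _ _ hw.2.2]
      simp only [eval, hc, if_true]
    · obtain ⟨s₂, τ', k1, k2, k3, k4⟩ := h₁ R M s₁ ρ hM (g4.agree.bdd hb) h8' hρ hw.2.1
      refine ⟨s₂, _, Exec.seq g1 (Exec.branch_true (by simpa [Expr.eval, g3] using hc) k1),
        le_pow_succ_of_le hM 3 (by omega), ?_, g4.trans k4⟩
      rw [k3, ← eval_congr g4.agree _ _ _ hw.2.1]
      simp only [eval, hc, if_false]
  | add t u iht ihu =>
    intro q d
    obtain ⟨κ, h⟩ := iht q d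
    obtain ⟨κ', h'⟩ := ihu q (d + 1)
    obtain ⟨e, he⟩ := u.eval_le_pow
    refine ⟨κ + κ' + (e + 1) + 6, fun R M s ρ hM hb h8 hρ hw => ?_⟩
    obtain ⟨s₁, τ, g1, g2, g3, g4⟩ := h R M s ρ hM hb h8 hρ hw.1
    obtain ⟨s₂, τ', k1, k2, k3, k4⟩ := h' R M s₁ ρ hM (g4.agree.bdd hb)
      (fun i hi => by rw [g4 8 i (fun _ => hi) (by omega)]; exact h8 i hi) hρ hw.2
    rw [← eval_congr g4.agree _ _ _ hw.2] at k3
    refine ⟨_, _, Exec.seq g1 (Exec.seq k1 (transfer_exec R (by omega) _ _ k3)),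
      le_pow_succ_of_le hM 6 ?_, ?_, ?_⟩
    · have hp : ∀ κ'', κ'' ≤ κ + κ' + (e + 1) → M ^ κ'' ≤ M ^ (κ + κ' + (e + 1)) :=
        fun κ' hκ => Nat.pow_le_pow_right (by omega) hκ
      have ha := hp κ (by omega)
      have hb1 := hp κ' (by omega)
      have hb2 := hp (e + 1) (by omega)
      have hone := hp 0 (by omega)
      rw [pow_zero] at hone
      have := he q M ρ s hM hb hρ hw.2
      omega
    · rw [Store.write_of_ne_index _ _ _ _ (by omega), Store.write_same,
        k4 9 d (by omega) (by omega), g3]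
      rfl
    · exact ((g4.trans (k4.weaken le_rfl (by omega))).write_stack le_rfl _).write_stack
        (by omega) _
  | sum b f ihb ihf =>
    intro q d
    obtain ⟨κ, h⟩ := ihb q (d + 1)
    obtain ⟨κ', h'⟩ := ihf (q + 1) (d + 2)
    obtain ⟨e, he⟩ := b.eval_le_pow
    obtain ⟨e', he'⟩ := f.eval_le_pow
    refine ⟨κ + (e + 1) * (κ' + e' + 2) + 11, fun R M s ρ hM hb h8 hρ hw => ?_⟩
    obtain ⟨s₁, τ, g1, g2, g3, g4⟩ := h R M s ρ hM hb h8 hρ hw.1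
    have hMM : M ≤ M ^ (e + 1) := Nat.le_self_pow (by omega) _
    have hn := he q M ρ s hM hb hρ hw.1
    set n := b.eval q ρ s with hndef
    -- The bound variable may be as large as the value of `b`, so the specification of `f` is
    -- applied with `M'` in place of `M`.
    set M' := M ^ (e + 1) with hM'
    have hM'2 : 2 ≤ M' := hM.trans hMM
    have hV : ∀ j < n, f.eval (q + 1) (Function.update ρ q j) s ≤ M' ^ (e' + 1) := by
      intro j hj
      refine he' (q + 1) _ _ s hM'2 (hb.mono hMM) (fun i => ?_) hw.2
      rw [Function.update_apply]
      split_ifs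
      · omega
      · exact (hρ i).trans hMM
    have hK0 : Keep q d s ((s₁.write 9 d 0).write 8 q 0) :=
      ((g4.weaken le_rfl (by omega)).write_stack le_rfl _).write_var le_rfl _
    obtain ⟨s', τ', k1, k2, k3, k4⟩ := compile_sum_loop (R := R) h' hM'2 (hb.mono hMM)
      (fun i => (hρ i).trans hMM) hn hw.2 hV n 0 ((s₁.write 9 d 0).write 8 q 0) (by omega)
      hK0.agree
      (fun i hi => by rw [hK0 8 i (fun _ => hi) (by omega)]; exact h8 i hi)
      (Store.write_same _ _ _ _)
      (by rw [Store.write_of_ne_array _ _ _ _ (by omega),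
            Store.write_of_ne_index _ _ _ _ (by omega), g3])
      (by rw [Store.write_of_ne_array _ _ _ _ (by omega), Store.write_same]; simp)
    refine ⟨s', _, Exec.seq g1 (Exec.seq (.assign _ _ _ _) (Exec.seq (.assign _ _ _ _) k1)),
      ?_, k3, hK0.trans k4⟩
    refine le_pow_succ_of_le hM 11 ?_
    have hle : n * (M' ^ κ' + 3 * M' ^ (e' + 1) + 3) ≤ 7 * M ^ ((e + 1) * (κ' + e' + 2)) := by
      have hp : ∀ κ'', κ'' ≤ κ' + e' + 1 → M' ^ κ'' ≤ M' ^ (κ' + e' + 1) :=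
        fun κ' hκ => Nat.pow_le_pow_right (by omega) hκ
      have ha := hp κ' (by omega)
      have hb1 := hp (e' + 1) (by omega)
      have hone := hp 0 (by omega)
      rw [pow_zero] at hone
      calc n * (M' ^ κ' + 3 * M' ^ (e' + 1) + 3) ≤ M' * (7 * M' ^ (κ' + e' + 1)) :=
            Nat.mul_le_mul hn (by omega)
        _ = 7 * M' ^ (κ' + e' + 2) := by ring
        _ = _ := by rw [hM', ← pow_mul]
    have hp : ∀ κ'', κ'' ≤ κ + (e + 1) * (κ' + e' + 2) →
        M ^ κ'' ≤ M ^ (κ + (e + 1) * (κ' + e' + 2)) :=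
      fun κ' hκ => Nat.pow_le_pow_right (by omega) hκ
    have ha := hp κ (by omega)
    have hb1 := hp ((e + 1) * (κ' + e' + 2)) (by omega)
    have hone := hp 0 (by omega)
    rw [pow_zero] at hone
    omega

end Tm

/-! ### Statements -/

/-- From memory content `σ`, the program `p` reaches within `T` steps a memory content with
property `Q`, where the contents of the scratch arrays do not matter. -/
def Run (R : ℕ → Bool) (p : Prog) (σ : Store) (T : ℕ) (Q : Store → Prop) : Prop :=
  ∀ s, Agree s σ → ∃ s' σ' t, Exec R p s s' t ∧ Agree s' σ' ∧ t ≤ T ∧ Q σ'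

theorem Run.mono {R : ℕ → Bool} {p : Prog} {σ : Store} {T T' : ℕ} {Q Q' : Store → Prop}
    (h : Run R p σ T Q) (hT : T ≤ T') (hQ : ∀ σ', Q σ' → Q' σ') : Run R p σ T' Q' := by
  intro s hs
  obtain ⟨s', σ', t, h1, h2, h3, h4⟩ := h s hs
  exact ⟨s', σ', t, h1, h2, h3.trans hT, hQ _ h4⟩

theorem Run.seq {R : ℕ → Bool} {p q : Prog} {σ : Store} {T T' : ℕ} {Q Q' : Store → Prop}
    (h : Run R p σ T Q) (h' : ∀ σ', Q σ' → Run R q σ' T' Q') : Run R (.seq p q) σ (T + T') Q' := by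
  intro s hs
  obtain ⟨s', σ', t, h1, h2, h3, h4⟩ := h s hs
  obtain ⟨s'', σ'', t', k1, k2, k3, k4⟩ := h' σ' h4 s' h2
  exact ⟨s'', σ'', t + t', .seq h1 k1, k2, Nat.add_le_add h3 k3, k4⟩

theorem Run.of_exec {R : ℕ → Bool} {p : Prog} {σ : Store} {T : ℕ} {Q : Store → Prop}
    (h : ∀ s, Agree s σ → ∃ s' t, Exec R p s s' t ∧ t ≤ T ∧ Q s') : Run R p σ T Q := by
  intro s hs
  obtain ⟨s', t, h1, h2, h3⟩ := h s hs
  exact ⟨s', s', t, h1, .refl _, h2, h3⟩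

/-- The value of a closed term. -/
def Tm.ev (t : Tm) (σ : Store) : ℕ := t.eval 0 (fun _ => 0) σ

theorem Tm.CompileSpec.run {t : Tm} {κ : ℕ} (h : t.CompileSpec 0 0 κ) (hw : t.WF 0)
    (R : ℕ → Bool) {M : ℕ} (hM : 2 ≤ M) {σ s : Store} (hb : Bdd M σ) (hs : Agree s σ) :
    ∃ s' τ, Exec R (t.compile 0 0) s s' τ ∧ τ ≤ M ^ κ ∧ s' 9 0 = t.ev σ ∧ Agree s' σ := by
  obtain ⟨s', τ, h1, h2, h3, h4⟩ := h R M s (fun _ => 0) hM (hs.symm.bdd hb)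
    (fun i hi => absurd hi (by omega)) (fun _ => by omega) hw
  exact ⟨s', τ, h1, h2, h3.trans (Tm.eval_congr hs _ _ _ hw), h4.agree.symm.trans hs⟩

/-- Write the value of `u` into cell `t` of array `a`. -/
def set (a : ℕ) (t u : Tm) : Prog :=
  .seq (t.compile 0 0) (.seq (u.compile 0 1) (.assign a (stk 0) (stk 1)))

/-- Conditional statement. -/
def ifS (t : Tm) (p q : Prog) : Prog := .seq (t.compile 0 0) (.branch (stk 0) p q)

/-- While loop. -/
def whileS (t : Tm) (p : Prog) : Prog :=
  .seq (t.compile 0 0) (.loop (stk 0) (.seq p (t.compile 0 0)))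

/-- The guard is a term, so it is evaluated into cell `0` of the stack before the loop and again at
the end of each round. The invariant is indexed by the round, and it determines when the guard
fails. -/
theorem Run.while {R : ℕ → Bool} {t : Tm} {p : Prog} {κ M n T : ℕ} (hκ : t.CompileSpec 0 0 κ)
    (hw : t.WF 0) (hM : 2 ≤ M) (Inv : ℕ → Store → Prop) (hb : ∀ j σ, Inv j σ → Bdd M σ)
    (hg : ∀ j ≤ n, ∀ σ, Inv j σ → (t.ev σ ≠ 0 ↔ j < n))
    (hp : ∀ j < n, ∀ σ, Inv j σ → Run R p σ T (Inv (j + 1))) {σ : Store} (h0 : Inv 0 σ) :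
    Run R (whileS t p) σ ((n + 1) * (T + M ^ κ + 1)) (Inv n) := by
  have key : ∀ r j s σ, j + r = n → Inv j σ → Agree s σ → s 9 0 = t.ev σ →
      ∃ s' σ' τ, Exec R (.loop (stk 0) (.seq p (t.compile 0 0))) s s' τ ∧ Agree s' σ' ∧
        τ ≤ r * (T + M ^ κ + 1) + 1 ∧ Inv n σ' := by
    intro r
    induction r with
    | zero =>
      intro j s σ hj hI hA hs
      refine ⟨s, σ, 1, .loop_false ?_, hA, by omega, (by omega : j = n) ▸ hI⟩
      have h : ¬ (t.ev σ ≠ 0) := fun h => by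
        have := (hg j (by omega) σ hI).1 h
        omega
      simpa [Expr.eval, hs] using h
    | succ r ih =>
      intro j s σ hj hI hA hs
      obtain ⟨s₁, σ₁, τ₁, h1, h2, h3, h4⟩ := hp j (by omega) σ hI s hA
      obtain ⟨s₂, τ₂, k1, k2, k3, k4⟩ := hκ.run hw R hM (hb _ _ h4) h2
      obtain ⟨s₃, σ₃, τ₃, l1, l2, l3, l4⟩ := ih (j + 1) s₂ σ₁ (by omega) h4 k4 k3
      refine ⟨s₃, σ₃, _, .loop_true ?_ (.seq h1 k1) l1, l2, ?_, l4⟩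
      · have := (hg j (by omega) σ hI).2 (by omega)
        simpa [Expr.eval, hs] using this
      · have : (r + 1) * (T + M ^ κ + 1) = r * (T + M ^ κ + 1) + (T + M ^ κ + 1) := by ring
        omega
  intro s hs
  obtain ⟨s₂, τ₂, k1, k2, k3, k4⟩ := hκ.run hw R hM (hb _ _ h0) hs
  obtain ⟨s₃, σ₃, τ₃, l1, l2, l3, l4⟩ := key n 0 s₂ σ (by omega) h0 k4 k3
  refine ⟨s₃, σ₃, _, .seq k1 l1, l2, ?_, l4⟩
  have : (n + 1) * (T + M ^ κ + 1) = n * (T + M ^ κ + 1) + (T + M ^ κ + 1) := by ring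
  omega

/-! ### Polynomial time -/

/-- For all `i` and all initial memory contents with property `Pre i`, the program `p`
reaches a memory content with property `Post i` in time polynomial in `M i`. -/
def PolyRun {ι : Type*} (M : ι → ℕ) (p : Prog) (Pre Post : ι → Store → Prop) : Prop :=
  ∃ κ, ∀ R i σ, 2 ≤ M i → Pre i σ → Run R p σ (M i ^ κ) (Post i)

section PolyRun

variable {ι : Type*} {M : ι → ℕ} {p q : Prog} {Pre Mid Post : ι → Store → Prop}

theorem PolyRun.mono {Pre' Post' : ι → Store → Prop} (h : PolyRun M p Pre Post)
    (h1 : ∀ i σ, Pre' i σ → Pre i σ) (h2 : ∀ i σ, Post i σ → Post' i σ) :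
    PolyRun M p Pre' Post' := by
  obtain ⟨κ, h⟩ := h
  exact ⟨κ, fun R i σ hM hp => (h R i σ hM (h1 i σ hp)).mono le_rfl (h2 i)⟩

theorem PolyRun.seq (h : PolyRun M p Pre Mid) (h' : PolyRun M q Mid Post) :
    PolyRun M (.seq p q) Pre Post := by
  obtain ⟨κ, h⟩ := h
  obtain ⟨κ', h'⟩ := h'
  exact ⟨κ + κ' + 1, fun R i σ hM hp => ((h R i σ hM hp).seq fun σ' hσ => h' R i σ' hM hσ).mono
    (Tm.pow_add_pow_le hM _ _) fun _ h => h⟩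

theorem PolyRun.pure {C : ι → Prop} (h : PolyRun M p (fun i σ => C i ∧ Pre i σ) Post) :
    PolyRun M p (fun i σ => C i ∧ Pre i σ) (fun i σ => C i ∧ Post i σ) := by
  obtain ⟨κ, h⟩ := h
  exact ⟨κ, fun R i σ hM hp => (h R i σ hM hp).mono le_rfl fun _ h => ⟨hp.1, h⟩⟩

theorem PolyRun.nop (h : ∀ i σ, Pre i σ → Post i σ) : PolyRun M .nop Pre Post :=
  ⟨0, fun _ i σ _ hp s hs => ⟨s, σ, 1, .nop s, hs, le_rfl, h i σ hp⟩⟩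

theorem PolyRun.set {a : ℕ} {t u : Tm} (hb : ∀ i σ, Pre i σ → Bdd (M i) σ)
    (h : ∀ i σ, Pre i σ → Post i (σ.write a (t.ev σ) (u.ev σ)))
    (ht : t.WF 0 := by simp [Tm.WF]) (hu : u.WF 0 := by simp [Tm.WF]) :
    PolyRun M (set a t u) Pre Post := by
  obtain ⟨κ, hκ⟩ := t.exists_compileSpec 0 0
  obtain ⟨κ', hκ'⟩ := u.exists_compileSpec 0 1
  refine ⟨κ + κ' + 3, fun R i σ hM hp s hs => ?_⟩
  obtain ⟨s₁, τ₁, h1, h2, h3, h4⟩ := hκ.run ht R hM (hb i σ hp) hs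
  obtain ⟨s₂, τ₂, k1, k2, k3, k4⟩ := hκ' R (M i) s₁ (fun _ => 0) hM (h4.symm.bdd (hb i σ hp))
    (fun i hi => absurd hi (by omega)) (fun _ => by omega) hu
  rw [Tm.eval_congr h4 _ _ _ hu] at k3
  -- As `u` is compiled at depth `1`, the index in cell `0` of the stack survives its evaluation.
  have k5 := k4 9 0 (by omega) (by omega)
  refine ⟨_, _, _, .seq h1 (.seq k1 (.assign _ _ _ _)), (k4.agree.symm.trans h4).write _ _ _, ?_, ?_⟩
  · refine Tm.le_pow_succ_of_le hM 3 ?_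
    have hp : ∀ κ'', κ'' ≤ κ + κ' → M i ^ κ'' ≤ M i ^ (κ + κ') :=
      fun κ' hκ => Nat.pow_le_pow_right (by omega) hκ
    have ha := hp κ (by omega)
    have hb1 := hp κ' (by omega)
    have hone := hp 0 (by omega)
    rw [pow_zero] at hone
    omega
  · simp only [Expr.eval, k3, k5, h3]
    exact h i σ hp

theorem PolyRun.ifS {t : Tm} (hb : ∀ i σ, Pre i σ → Bdd (M i) σ)
    (h : PolyRun M p (fun i σ => Pre i σ ∧ t.ev σ ≠ 0) Post)
    (h' : PolyRun M q (fun i σ => Pre i σ ∧ t.ev σ = 0) Post)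
    (ht : t.WF 0 := by simp [Tm.WF]) :
    PolyRun M (ifS t p q) Pre Post := by
  obtain ⟨κ, hκ⟩ := t.exists_compileSpec 0 0
  obtain ⟨κ₁, h⟩ := h
  obtain ⟨κ₂, h'⟩ := h'
  refine ⟨κ + κ₁ + κ₂ + 3, fun R i σ hM hpre s hs => ?_⟩
  obtain ⟨s₁, τ₁, h1, h2, h3, h4⟩ := hκ.run ht R hM (hb i σ hpre) hs
  have hp : ∀ κ'', κ'' ≤ κ + κ₁ + κ₂ → M i ^ κ'' ≤ M i ^ (κ + κ₁ + κ₂) :=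
    fun κ' hκ => Nat.pow_le_pow_right (by omega) hκ
  have ha := hp κ (by omega)
  have hb1 := hp κ₁ (by omega)
  have hb2 := hp κ₂ (by omega)
  have hone := hp 0 (by omega)
  rw [pow_zero] at hone
  by_cases hc : t.ev σ = 0
  · obtain ⟨s₂, σ₂, τ₂, k1, k2, k3, k4⟩ := h' R i σ hM ⟨hpre, hc⟩ s₁ h4
    exact ⟨s₂, σ₂, _, .seq h1 (.branch_false (by simpa [Expr.eval, h3] using hc) k1), k2,
      Tm.le_pow_succ_of_le hM 3 (by omega), k4⟩
  · obtain ⟨s₂, σ₂, τ₂, k1, k2, k3, k4⟩ := h R i σ hM ⟨hpre, hc⟩ s₁ h4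
    exact ⟨s₂, σ₂, _, .seq h1 (.branch_true (by simpa [Expr.eval, h3] using hc) k1), k2,
      Tm.le_pow_succ_of_le hM 3 (by omega), k4⟩

/-- Pairing the index with the number of the round makes the exponent for the body uniform over all
rounds. There are at most `M i` of them, which costs two further powers of `M i`. -/
theorem PolyRun.while {t : Tm} (Inv : ι → ℕ → Store → Prop) (n : ι → ℕ)
    (hb : ∀ i j σ, Inv i j σ → Bdd (M i) σ)
    (hg : ∀ i, ∀ j ≤ n i, ∀ σ, Inv i j σ → n i ≤ M i ∧ (t.ev σ ≠ 0 ↔ j < n i))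
    (h : PolyRun (fun x : ι × ℕ => M x.1) p (fun x σ => x.2 < n x.1 ∧ Inv x.1 x.2 σ)
      (fun x σ => Inv x.1 (x.2 + 1) σ))
    (ht : t.WF 0 := by simp [Tm.WF]) :
    PolyRun M (whileS t p) (fun i σ => Inv i 0 σ) (fun i σ => Inv i (n i) σ) := by
  obtain ⟨κ, hκ⟩ := t.exists_compileSpec 0 0
  obtain ⟨κ₁, h⟩ := h
  refine ⟨κ + κ₁ + 2 + 3, fun R i σ hM hpre => ?_⟩
  refine (Run.while hκ ht hM (Inv i) (hb i) (fun j hj σ hI => (hg i j hj σ hI).2)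
    (T := M i ^ κ₁)
    (fun j hj σ hI => h R (i, j) σ hM ⟨hj, hI⟩) hpre).mono ?_ fun _ h => h
  have hn := (hg i 0 (by omega) σ hpre).1
  refine Tm.le_pow_succ_of_le hM 3 ?_
  have hp : ∀ κ'', κ'' ≤ κ + κ₁ → M i ^ κ'' ≤ M i ^ (κ + κ₁) :=
    fun κ' hκ => Nat.pow_le_pow_right (by omega) hκ
  have ha := hp κ (by omega)
  have hb1 := hp κ₁ (by omega)
  have hone := hp 0 (by omega)
  rw [pow_zero] at hone
  have h2 : n i + 1 ≤ M i ^ 2 := by nlinarith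
  calc (n i + 1) * (M i ^ κ₁ + M i ^ κ + 1) ≤ M i ^ 2 * (3 * M i ^ (κ + κ₁)) :=
        Nat.mul_le_mul h2 (by omega)
    _ = 3 * M i ^ (κ + κ₁ + 2) := by ring

end PolyRun

/-- Register `r`. -/
abbrev Tm.reg (r : ℕ) : Tm := .arr 0 (.lit r)

/-- For loop with the counter in register `r`. -/
def forS (r : ℕ) (b : Tm) (p : Prog) : Prog :=
  .seq (set 0 (.lit r) (.lit 0)) (whileS (.lt (.reg r) b)
    (.seq p (set 0 (.lit r) (.add (.reg r) (.lit 1)))))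

/-- The counter is an ordinary register, so the invariant must tolerate any admissible value in it
(`hr`); the actual value of the counter is tracked outside the invariant. The bound `b` is evaluated
anew in every round, and the invariant keeps its value fixed. -/
theorem PolyRun.for {ι : Type*} {M : ι → ℕ} {p : Prog} {r : ℕ} {b : Tm}
    (Inv : ι → ℕ → Store → Prop) (n : ι → ℕ)
    (hb : ∀ i j σ, Inv i j σ → Bdd (M i) σ ∧ b.ev σ = n i ∧ n i ≤ M i)
    (hr : ∀ i j σ v, v ≤ M i → Inv i j σ → Inv i j (σ.write 0 r v))
    (h : PolyRun (fun x : ι × ℕ => M x.1) p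
      (fun x σ => x.2 < n x.1 ∧ Inv x.1 x.2 σ ∧ σ 0 r = x.2)
      (fun x σ => Inv x.1 (x.2 + 1) σ ∧ σ 0 r = x.2))
    (ht : b.WF 0 := by simp [Tm.WF]) :
    PolyRun M (forS r b p) (fun i σ => Inv i 0 σ) (fun i σ => Inv i (n i) σ) := by
  refine PolyRun.seq (Mid := fun i σ => (0 ≤ n i ∧ Inv i 0 σ) ∧ σ 0 r = 0)
    (.set (fun i σ h => (hb i 0 σ h).1) (fun i σ h => ⟨⟨Nat.zero_le _, hr _ _ _ _ (by simp [Tm.ev, Tm.eval]) h⟩, ?_⟩)) ?_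
  · exact Store.write_same _ _ _ _
  refine (PolyRun.while (M := M) (fun i j σ => (j ≤ n i ∧ Inv i j σ) ∧ σ 0 r = j) n
    (fun i j σ h => (hb i j σ h.1.2).1) ?_ ?_ (by simp [Tm.WF, ht])).mono (fun _ _ h => h)
    (fun _ _ h => h.1.2)
  · intro i j hj σ hI
    have := hb i j σ hI.1.2
    refine ⟨this.2.2, ?_⟩
    have h2 := this.2.1
    simp only [Tm.ev] at h2
    simp [Tm.ev, Tm.eval, hI.2, h2]
  · refine PolyRun.seq (Mid := fun x σ => x.2 < n x.1 ∧ Inv x.1 (x.2 + 1) σ ∧ σ 0 r = x.2)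
      (h.pure.mono (fun i σ hi => ⟨hi.1, hi.2.1.2, hi.2.2⟩) fun i σ hi => hi)
      (.set (fun i σ hi => (hb _ _ _ hi.2.1).1) fun x σ hi => ?_)
    have := (hb _ _ _ hi.2.1).2.2
    have hlt := hi.1
    simp only [Tm.ev, Tm.eval, hi.2.2]
    exact ⟨⟨by omega, hr _ _ _ _ (by omega) hi.2.1⟩, Store.write_same _ _ _ _⟩

/-! ### Derived terms -/

namespace Tm

/-- Multiplication; `u` is read below an additional binder. -/
def mul (t u : Tm) : Tm := .sum t u

/-- Negation. -/
def not (t : Tm) : Tm := .ite t (.lit 0) (.lit 1)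

/-- Conjunction. -/
def and (t u : Tm) : Tm := .ite t u (.lit 0)

/-- Disjunction. -/
def or (t u : Tm) : Tm := .ite t (.lit 1) u

/-- Bounded universal quantification. -/
def all (b f : Tm) : Tm := not (.sum b (not f))

/-- Bounded existential quantification. -/
def ex (b f : Tm) : Tm := .sum b f

variable (t u : Tm) (q : ℕ) (ρ : ℕ → ℕ) (s : Store)

@[simp] theorem WF_not : (not t).WF q ↔ t.WF q := by simp [not, WF]
@[simp] theorem WF_and : (and t u).WF q ↔ t.WF q ∧ u.WF q := by simp [and, WF]
@[simp] theorem WF_or : (or t u).WF q ↔ t.WF q ∧ u.WF q := by simp [or, WF]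
@[simp] theorem WF_all : (all t u).WF q ↔ t.WF q ∧ u.WF (q + 1) := by simp [all, WF]
@[simp] theorem WF_ex : (ex t u).WF q ↔ t.WF q ∧ u.WF (q + 1) := by simp [ex, WF]
@[simp] theorem WF_mul : (mul t u).WF q ↔ t.WF q ∧ u.WF (q + 1) := by simp [mul, WF]

/-- The truth value of a term. -/
def Tr : Prop := t.eval q ρ s ≠ 0

@[simp] theorem tr_not : (not t).Tr q ρ s ↔ ¬ t.Tr q ρ s := by
  simp only [Tr, not, eval]; split_ifs <;> simp_all

@[simp] theorem tr_and : (and t u).Tr q ρ s ↔ t.Tr q ρ s ∧ u.Tr q ρ s := by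
  simp only [Tr, and, eval]; split_ifs <;> simp_all

@[simp] theorem tr_or : (or t u).Tr q ρ s ↔ t.Tr q ρ s ∨ u.Tr q ρ s := by
  simp only [Tr, or, eval]; split_ifs <;> simp_all

@[simp] theorem tr_ex : (ex t u).Tr q ρ s ↔
    ∃ j < t.eval q ρ s, u.Tr (q + 1) (Function.update ρ q j) s := by
  simp [Tr, ex, eval]

@[simp] theorem tr_all : (all t u).Tr q ρ s ↔
    ∀ j < t.eval q ρ s, u.Tr (q + 1) (Function.update ρ q j) s := by
  rw [all, tr_not]
  have := tr_ex t (not u) q ρ s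
  rw [ex] at this
  rw [this]
  simp

@[simp] theorem tr_lt : (lt t u).Tr q ρ s ↔ t.eval q ρ s < u.eval q ρ s := by
  simp [Tr, eval]

@[simp] theorem tr_eq : (eq t u).Tr q ρ s ↔ t.eval q ρ s = u.eval q ρ s := by
  simp [Tr, eval]

@[simp] theorem tr_test (a : ℕ) : (test a t).Tr q ρ s ↔ s a (t.eval q ρ s) ≠ 0 := by
  simp [Tr, eval]

@[simp] theorem tr_ite (c : Tm) : (ite c t u).Tr q ρ s ↔
    (c.Tr q ρ s ∧ t.Tr q ρ s) ∨ (¬ c.Tr q ρ s ∧ u.Tr q ρ s) := by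
  simp only [Tr, eval]; split_ifs <;> simp_all

theorem ev_ne_zero : t.ev s ≠ 0 ↔ t.Tr 0 (fun _ => 0) s := Iff.rfl

theorem ev_eq_zero : t.ev s = 0 ↔ ¬ t.Tr 0 (fun _ => 0) s := by simp [Tr, ev]

/-- Truth values as terms. -/
def bool : Tm := .ite t (.lit 1) (.lit 0)

@[simp] theorem WF_bool : (bool t).WF q ↔ t.WF q := by simp [bool, WF]

open Classical in
@[simp] theorem eval_bool : (bool t).eval q ρ s = if t.Tr q ρ s then 1 else 0 := by
  simp only [bool, eval, Tr]
  split_ifs <;> simp_all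

end Tm

/-! ### Running a program on a clock

The arrays of the given program are moved to `20, 21, …`. Every iteration of a loop
consumes a unit of fuel from cell `0` of array `10`, and the indices of all written cells are
logged in array `11`; cell `0` of array `12` is the length of the log. -/

/-- Shift the arrays of an expression by `20`. -/
def Expr.shift : Expr → Expr
  | .lit k => .lit k
  | .get a i => .get (a + 20) i.shift
  | .coin i => .coin i.shift
  | .succ e => .succ e.shift
  | .pred e => .pred e.shift
  | .lt e f => .lt e.shift f.shift
  | .eq e f => .eq e.shift f.shift

/-- The arrays `20, 21, …` of a memory content. -/
def Store.high (s : Store) : Store := fun a => s (a + 20)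

/-- Only the arrays are shifted. The indices of random bits stay, so that the shifted program sees
the same bits as the original one. -/
theorem Expr.eval_shift (R : ℕ → Bool) (s : Store) (e : Expr) :
    e.shift.eval R s = e.eval R s.high := by
  induction e with
  | lit k => rfl
  | get a i ih => simp only [Expr.shift, Expr.eval, ih]; rfl
  | coin i ih => simp only [Expr.shift, Expr.eval, ih]
  | succ e ih => simp only [Expr.shift, Expr.eval, ih]
  | pred e ih => simp only [Expr.shift, Expr.eval, ih]
  | lt e f ihe ihf => simp only [Expr.shift, Expr.eval, ihe, ihf]
  | eq e f ihe ihf => simp only [Expr.shift, Expr.eval, ihe, ihf]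

/-- The content of the tank. -/
abbrev fuel : Expr := .get 10 (.lit 0)

/-- The length of the log. -/
abbrev top : Expr := .get 12 (.lit 0)

/-- The shifted program on a clock. -/
def Prog.clock : Prog → Prog
  | .nop => .nop
  | .assign a i e => .seq (.assign 11 top i.shift) (.seq (.assign 12 (.lit 0) (.succ top))
      (.assign (a + 20) i.shift e.shift))
  | .seq p q => .seq p.clock q.clock
  | .branch e p q => .branch e.shift p.clock q.clock
  | .loop e p => .loop (.lt (.eq e.shift (.lit 0)) (.lt (.lit 0) fuel))
      (.seq (.assign 10 (.lit 0) (.pred fuel)) p.clock)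

/-- A strict upper bound for the arrays to which a program writes. -/
def Prog.width : Prog → ℕ
  | .nop => 0
  | .assign a _ _ => a + 1
  | .seq p q => max p.width q.width
  | .branch _ p q => max p.width q.width
  | .loop _ p => p.width

/-- The changes that a clocked program makes. -/
structure ClockFrame (A : ℕ) (s s' : Store) : Prop where
  low : ∀ a < 20, a ≠ 10 → a ≠ 11 → a ≠ 12 → ∀ i, s' a i = s a i
  fuel : s' 10 0 ≤ s 10 0
  top : s 12 0 ≤ s' 12 0
  log : ∀ l < s 12 0, s' 11 l = s 11 l
  high : ∀ a i, 20 ≤ a → s' a i ≠ s a i → a < A + 20 ∧ ∃ l < s' 12 0, s' 11 l = i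

theorem ClockFrame.refl (A : ℕ) (s : Store) : ClockFrame A s s :=
  ⟨fun _ _ _ _ _ _ => rfl, le_rfl, le_rfl, fun _ _ => rfl, fun _ _ _ h => absurd rfl h⟩

/-- The log is only appended to, so a cell that was changed in the first part is still found in the
final log. -/
theorem ClockFrame.trans {A : ℕ} {s s' s'' : Store} (h : ClockFrame A s s')
    (h' : ClockFrame A s' s'') : ClockFrame A s s'' where
  low a ha h10 h11 h12 i := (h'.low a ha h10 h11 h12 i).trans (h.low a ha h10 h11 h12 i)
  fuel := h'.fuel.trans h.fuel
  top := h.top.trans h'.top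
  log l hl := (h'.log l (hl.trans_le h.top)).trans (h.log l hl)
  high a i ha hne := by
    by_cases hc : s'' a i = s' a i
    · obtain ⟨h1, l, hl, hi⟩ := h.high a i ha (hc ▸ hne)
      exact ⟨h1, l, hl.trans_le h'.top, (h'.log l hl).trans hi⟩
    · exact h'.high a i ha hc

theorem ClockFrame.weaken {A A' : ℕ} {s s' : Store} (h : ClockFrame A s s') (hA : A ≤ A') :
    ClockFrame A' s s' :=
  { h with high := fun a i ha hne => ⟨by have := (h.high a i ha hne).1; omega,
      (h.high a i ha hne).2⟩ }

theorem Store.high_write_low (s : Store) {a : ℕ} (i v : ℕ) (ha : a < 20) :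
    (s.write a i v).high = s.high := by
  funext b j
  exact Store.write_of_ne_array _ _ _ _ (by omega)

theorem Store.high_write (s : Store) (a i v : ℕ) :
    (s.write (a + 20) i v).high = s.high.write a i v := by
  funext b j
  simp only [Store.high, Store.write, add_left_inj]

/-- The effect of a clocked assignment. -/
def clockedWrite (s : Store) (a i v : ℕ) : Store :=
  ((s.write 11 (s 12 0) i).write 12 0 (s 12 0 + 1)).write (a + 20) i v

theorem clock_assign_exec (R : ℕ → Bool) (a : ℕ) (i e : Expr) (s : Store) :
    Exec R (Prog.assign a i e).clock s
      (clockedWrite s a (i.eval R s.high) (e.eval R s.high)) 3 := by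
  have h1 := Exec.assign (R := R) 11 top i.shift s
  have h2 := Exec.assign (R := R) 12 (.lit 0) (.succ top) (s.write 11 (s 12 0) (i.eval R s.high))
  have h3 := Exec.assign (R := R) (a + 20) i.shift e.shift
    ((s.write 11 (s 12 0) (i.eval R s.high)).write 12 0 (s 12 0 + 1))
  simp only [Expr.eval, Expr.eval_shift] at h1 h2
  rw [Store.write_of_ne_array _ _ _ _ (by omega)] at h2
  rw [Expr.eval_shift, Expr.eval_shift, Store.high_write_low _ _ _ (by omega),
    Store.high_write_low _ _ _ (by omega)] at h3
  exact Exec.seq h1 (Exec.seq h2 h3)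

theorem clockedWrite_high (s : Store) (a i v : ℕ) :
    (clockedWrite s a i v).high = s.high.write a i v := by
  rw [clockedWrite, Store.high_write, Store.high_write_low _ _ _ (by omega),
    Store.high_write_low _ _ _ (by omega)]

theorem clockedWrite_fuel (s : Store) (a i v : ℕ) : clockedWrite s a i v 10 0 = s 10 0 := by
  rw [clockedWrite, Store.write_of_ne_array _ _ _ _ (by omega),
    Store.write_of_ne_array _ _ _ _ (by omega), Store.write_of_ne_array _ _ _ _ (by omega)]

theorem clockedWrite_top (s : Store) (a i v : ℕ) : clockedWrite s a i v 12 0 = s 12 0 + 1 := by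
  rw [clockedWrite, Store.write_of_ne_array _ _ _ _ (by omega), Store.write_same]

theorem clockedWrite_log (s : Store) (a i v l : ℕ) :
    clockedWrite s a i v 11 l = if l = s 12 0 then i else s 11 l := by
  rw [clockedWrite, Store.write_of_ne_array _ _ _ _ (by omega),
    Store.write_of_ne_array _ _ _ _ (by omega)]
  simp [Store.write]

theorem clockedWrite_frame (s : Store) (a i v : ℕ) :
    ClockFrame (a + 1) s (clockedWrite s a i v) where
  low b hb h10 h11 h12 j := by
    rw [clockedWrite, Store.write_of_ne_array _ _ _ _ (by omega),
      Store.write_of_ne_array _ _ _ _ (by omega), Store.write_of_ne_array _ _ _ _ (by omega)]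
  fuel := (clockedWrite_fuel s a i v).le
  top := by rw [clockedWrite_top]; omega
  log l hl := by rw [clockedWrite_log, if_neg (by omega)]
  high b j hb hne := by
    have h : b = a + 20 ∧ j = i := by
      by_contra hc
      apply hne
      rw [clockedWrite, Store.write_apply, if_neg hc, Store.write_of_ne_array _ _ _ _ (by omega),
        Store.write_of_ne_array _ _ _ _ (by omega)]
    refine ⟨by omega, s 12 0, ?_, ?_⟩
    · rw [clockedWrite_top]; omega
    · rw [clockedWrite_log, if_pos rfl, h.2]

theorem burn_frame (A : ℕ) (s : Store) : ClockFrame A s (s.write 10 0 (s 10 0 - 1)) where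
  low b hb h10 h11 h12 j := Store.write_of_ne_array _ _ _ _ h10
  fuel := by rw [Store.write_same]; omega
  top := by rw [Store.write_of_ne_array _ _ _ _ (by omega)]
  log l hl := by rw [Store.write_of_ne_array _ _ _ _ (by omega)]
  high b j hb hne := absurd (Store.write_of_ne_array _ _ _ _ (by omega)) hne

/-- Expressions have no conjunction; a comparison of truth values replaces it, as `[e = 0] < [0 <
fuel]` holds only for the values `0` and `1`. -/
theorem eval_guard (R : ℕ → Bool) (s : Store) (e : Expr) :
    (Expr.lt (.eq e.shift (.lit 0)) (.lt (.lit 0) fuel)).eval R s ≠ 0 ↔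
      e.eval R s.high ≠ 0 ∧ s 10 0 ≠ 0 := by
  simp only [Expr.eval, Expr.eval_shift]
  by_cases h1 : e.eval R s.high = 0 <;> by_cases h2 : s 10 0 = 0 <;>
    simp [h1, h2, Nat.pos_of_ne_zero]

/-- Only loops can take long, and every round burns a unit of fuel, while the other work is bounded
by a constant that depends on the program. The remaining fuel occurs in the inequality as a
potential, so that it telescopes when programs are composed. Nothing is assumed about the original
program or its input. -/
theorem clock_halts (p : Prog) : ∃ K, ∀ R s, ∃ s' t, Exec R p.clock s s' t ∧
    t + K * s' 10 0 ≤ K * (s 10 0 + 1) ∧ s' 12 0 ≤ s 12 0 + t ∧ ClockFrame p.width s s' := by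
  induction p with
  | nop => exact ⟨1, fun R s => ⟨s, 1, .nop s, by omega, by omega, .refl _ _⟩⟩
  | assign a i e =>
    refine ⟨3, fun R s => ⟨_, 3, clock_assign_exec R a i e s, ?_, ?_, clockedWrite_frame _ _ _ _⟩⟩
    · rw [clockedWrite_fuel]; omega
    · rw [clockedWrite_top]; omega
  | seq p q ihp ihq =>
    obtain ⟨K, hK⟩ := ihp
    obtain ⟨K', hK'⟩ := ihq
    refine ⟨K + K', fun R s => ?_⟩
    obtain ⟨s₁, t₁, h1, h2, h3, h4⟩ := hK R s
    obtain ⟨s₂, t₂, k1, k2, k3, k4⟩ := hK' R s₁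
    refine ⟨s₂, _, .seq h1 k1, ?_, by omega,
      (h4.weaken (le_max_left _ _)).trans (k4.weaken (le_max_right _ _))⟩
    have e1 := h4.fuel
    have e2 := k4.fuel
    have e3 := Nat.mul_le_mul_left K e2
    have e4 := Nat.mul_le_mul_left K' e1
    have e5 : (K + K') * (s 10 0 + 1) = K * (s 10 0 + 1) + (K' * s 10 0 + K') := by ring
    have e6 : K' * (s₁ 10 0 + 1) = K' * s₁ 10 0 + K' := by ring
    rw [e5, add_mul]
    omega
  | branch e p q ihp ihq =>
    obtain ⟨K, hK⟩ := ihp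
    obtain ⟨K', hK'⟩ := ihq
    refine ⟨K + K' + 1, fun R s => ?_⟩
    have e5 : (K + K' + 1) * (s 10 0 + 1) =
      K * (s 10 0 + 1) + (K' * s 10 0 + K') + (s 10 0 + 1) := by ring
    by_cases hc : e.eval R s.high = 0
    · obtain ⟨s₁, t₁, h1, h2, h3, h4⟩ := hK' R s
      refine ⟨s₁, _, .branch_false (by rwa [Expr.eval_shift]) h1, ?_, by omega,
        h4.weaken (le_max_right _ _)⟩
      have e1 := h4.fuel
      have e3 := Nat.mul_le_mul_left K e1
      have e6 : K' * (s 10 0 + 1) = K' * s 10 0 + K' := by ring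
      have e7 : K * (s 10 0 + 1) = K * s 10 0 + K := by ring
      rw [e5, add_mul, add_mul]
      omega
    · obtain ⟨s₁, t₁, h1, h2, h3, h4⟩ := hK R s
      refine ⟨s₁, _, .branch_true (by rwa [Expr.eval_shift]) h1, ?_, by omega,
        h4.weaken (le_max_left _ _)⟩
      have e1 := h4.fuel
      have e3 := Nat.mul_le_mul_left K' e1
      rw [e5, add_mul, add_mul]
      omega
  | loop e p ih =>
    obtain ⟨K, hK⟩ := ih
    refine ⟨K + 3, fun R => ?_⟩
    have key : ∀ f s, s 10 0 = f → ∃ s' t, Exec R (Prog.loop e p).clock s s' t ∧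
        t + (K + 3) * s' 10 0 ≤ (K + 3) * (s 10 0 + 1) ∧ s' 12 0 ≤ s 12 0 + t ∧
        ClockFrame (Prog.loop e p).width s s' := by
      intro f
      -- Strong induction is needed since loops inside the body burn fuel, too.
      induction f using Nat.strong_induction_on with
      | _ f ihf =>
        intro s hs
        by_cases hg : e.eval R s.high ≠ 0 ∧ s 10 0 ≠ 0
        · obtain ⟨s₁, t₁, h1, h2, h3, h4⟩ := hK R (s.write 10 0 (s 10 0 - 1))
          rw [Store.write_same] at h2
          rw [Store.write_of_ne_array _ _ _ _ (by omega)] at h3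
          have e1 := h4.fuel
          rw [Store.write_same] at e1
          obtain ⟨s₂, t₂, k1, k2, k3, k4⟩ := ihf (s₁ 10 0) (by omega) s₁ rfl
          refine ⟨s₂, _, .loop_true ((eval_guard R s e).2 hg) (.seq (.assign _ _ _ _) h1) k1,
            ?_, by omega, ((burn_frame _ s).trans h4).trans k4⟩
          obtain ⟨g, hg'⟩ : ∃ g, s 10 0 = g + 1 := ⟨s 10 0 - 1, by omega⟩
          rw [hg', Nat.add_sub_cancel] at h2 e1
          rw [hg']
          have e3 : (K + 3) * (s₁ 10 0 + 1) = K * s₁ 10 0 + 3 * s₁ 10 0 + K + 3 := by ring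
          have e4 : (K + 3) * (g + 1 + 1) = K * (g + 1) + K + 3 * g + 6 := by ring
          omega
        · refine ⟨s, 1, .loop_false ?_, ?_, by omega, .refl _ _⟩
          · by_contra h
            exact hg ((eval_guard R s e).1 h)
          · rw [mul_add]; omega
    exact fun s => key _ s rfl

/-- Each unit of fuel is burnt in a round that also costs a step of the original run. Hence, with at
least `t` units at the start, the tank is not empty when a guard that holds is tested. -/
theorem clock_simulates {R : ℕ → Bool} {p : Prog} {s s' : Store} {t : ℕ} (h : Exec R p s s' t) :
    ∀ σ : Store, σ.high = s → t ≤ σ 10 0 →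
      ∃ σ' t', Exec R p.clock σ σ' t' ∧ σ'.high = s' ∧ σ 10 0 ≤ σ' 10 0 + t := by
  induction h with
  | nop s => exact fun σ h1 h2 => ⟨σ, 1, .nop σ, h1, by omega⟩
  | assign a i e s =>
    intro σ h1 h2
    refine ⟨_, 3, clock_assign_exec R a i e σ, ?_, ?_⟩
    · rw [clockedWrite_high, h1]
    · rw [clockedWrite_fuel]; omega
  | seq _ _ ih₁ ih₂ =>
    intro σ h1 h2
    obtain ⟨σ₁, t₁, k1, k2, k3⟩ := ih₁ σ h1 (by omega)
    obtain ⟨σ₂, t₂, l1, l2, l3⟩ := ih₂ σ₁ k2 (by omega)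
    exact ⟨σ₂, _, .seq k1 l1, l2, by omega⟩
  | branch_true he _ ih =>
    intro σ h1 h2
    obtain ⟨σ₁, t₁, k1, k2, k3⟩ := ih σ h1 (by omega)
    exact ⟨σ₁, _, .branch_true (by rwa [Expr.eval_shift, h1]) k1, k2, by omega⟩
  | branch_false he _ ih =>
    intro σ h1 h2
    obtain ⟨σ₁, t₁, k1, k2, k3⟩ := ih σ h1 (by omega)
    exact ⟨σ₁, _, .branch_false (by rwa [Expr.eval_shift, h1]) k1, k2, by omega⟩
  | loop_true he _ _ ih₁ ih₂ =>
    intro σ h1 h2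
    obtain ⟨σ₁, t₁, k1, k2, k3⟩ := ih₁ (σ.write 10 0 (σ 10 0 - 1))
      (by rw [Store.high_write_low _ _ _ (by omega), h1]) (by rw [Store.write_same]; omega)
    rw [Store.write_same] at k3
    obtain ⟨σ₂, t₂, l1, l2, l3⟩ := ih₂ σ₁ k2 (by omega)
    exact ⟨σ₂, _, .loop_true ((eval_guard R σ _).2 ⟨by rwa [h1], by omega⟩)
      (.seq (.assign _ _ _ _) k1) l1, l2, by omega⟩
  | loop_false he =>
    intro σ h1 h2
    refine ⟨σ, 1, .loop_false ?_, h1, by omega⟩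
    by_contra h
    exact ((eval_guard R σ _).1 h).1 (by rwa [h1])

/-- The run with bounded time and the run that simulates the program coincide by determinism. -/
theorem clock_spec (p : Prog) : ∃ K, ∀ R s, ∃ s' t, Exec R p.clock s s' t ∧
    t ≤ K * (s 10 0 + 1) ∧ s' 12 0 ≤ s 12 0 + t ∧ ClockFrame p.width s s' ∧
    ∀ r τ, Exec R p s.high r τ → τ ≤ s 10 0 → s'.high = r := by
  obtain ⟨K, hK⟩ := clock_halts p
  refine ⟨K, fun R s => ?_⟩
  obtain ⟨s', t, h1, h2, h3, h4⟩ := hK R s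
  refine ⟨s', t, h1, by omega, h3, h4, fun r τ hr hτ => ?_⟩
  obtain ⟨σ', t', k1, k2, -⟩ := clock_simulates hr s rfl hτ
  rw [(h1.det k1).1, k2]

/-! ### Cleaning up -/

/-- Set the cells with the given index of the arrays `20, …, 19 + A` to `0`. -/
def clearAt (e : Expr) : ℕ → Prog
  | 0 => .nop
  | A + 1 => .seq (clearAt e A) (.assign (A + 20) e (.lit 0))

/-- The effect of `clearAt`. -/
def Store.clear (s : Store) (i A : ℕ) : Store :=
  fun a j => if 20 ≤ a ∧ a < A + 20 ∧ j = i then 0 else s a j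

theorem Store.clear_low (s : Store) (i A : ℕ) {a : ℕ} (ha : a < 20) (j : ℕ) :
    s.clear i A a j = s a j := by
  rw [Store.clear, if_neg (by omega)]

/-- The hypothesis `he` asks that the clearing does not change the index while it is in use; this is
so whenever `e` reads only arrays below `20`. -/
theorem clearAt_exec {R : ℕ → Bool} {e : Expr} {s : Store} {i : ℕ}
    (he : ∀ A, e.eval R (s.clear i A) = i) : ∀ A, Exec R (clearAt e A) s (s.clear i A) (A + 1) := by
  intro A
  induction A with
  | zero =>
    refine Exec.of_eq ?_ (.nop s)
    funext a j
    rw [Store.clear, if_neg (by omega)]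
  | succ A ih =>
    refine Exec.of_eq ?_ (Exec.seq ih (.assign _ _ _ _))
    funext a j
    simp only [he, Expr.eval, Store.write_apply, Store.clear]
    split_ifs <;> first | rfl | omega

/-- Clear all logged cells. -/
def clearLog (A : ℕ) : Prog :=
  .loop top (.seq (.assign 12 (.lit 0) (.pred top)) (clearAt (.get 11 top) A))

/-- The log records indices but not arrays, so a logged index is cleared in all arrays that the
program can write. The time is proportional to the length of the log, hence bounded in terms of the
time of the run that produced it. -/
theorem clearLog_exec (R : ℕ → Bool) (A : ℕ) : ∀ (n : ℕ) (s : Store), s 12 0 = n →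
    ∃ s', Exec R (clearLog A) s s' (n * (A + 3) + 1) ∧ s' 12 0 = 0 ∧
      (∀ a < 20, a ≠ 12 → ∀ i, s' a i = s a i) ∧
      (∀ a i, 20 ≤ a → s' a i = s a i ∨ s' a i = 0) ∧
      (∀ a i, 20 ≤ a → a < A + 20 → (∃ l < n, s 11 l = i) → s' a i = 0) := by
  intro n
  induction n with
  | zero =>
    intro s hs
    refine ⟨s, ?_, hs, fun _ _ _ _ => rfl, fun _ _ _ => .inl rfl, ?_⟩
    · rw [zero_mul]; exact .loop_false (by simpa [Expr.eval] using hs)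
    · rintro a i - - ⟨l, hl, -⟩
      omega
  | succ n ih =>
    intro s hs
    have h1 := Exec.assign (R := R) 12 (.lit 0) (.pred top) s
    simp only [Expr.eval, hs, Nat.add_sub_cancel] at h1
    set s₁ := s.write 12 0 n with hs₁
    have hs11 : ∀ l, s₁ 11 l = s 11 l := fun l => Store.write_of_ne_array _ _ _ _ (by omega)
    have hs12 : s₁ 12 0 = n := Store.write_same _ _ _ _
    have h2 := clearAt_exec (R := R) (e := .get 11 top) (s := s₁) (i := s 11 n) (fun A => by
      simp only [Expr.eval]
      rw [Store.clear_low _ _ _ (by omega), Store.clear_low _ _ _ (by omega), hs12, hs11]) A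
    set s₂ := s₁.clear (s 11 n) A with hs₂
    obtain ⟨s₃, k1, k2, k3, k4, k5⟩ := ih s₂ (by
      rw [hs₂, Store.clear_low _ _ _ (by omega), hs12])
    have hhigh : ∀ a i, 20 ≤ a → s₂ a i = s a i ∨ s₂ a i = 0 := by
      intro a i ha
      rw [hs₂, Store.clear, hs₁, Store.write_of_ne_array _ _ _ _ (by omega)]
      split_ifs <;> simp
    refine ⟨s₃, ?_, k2, ?_, ?_, ?_⟩
    · have := Exec.loop_true (e := top) (by simp [Expr.eval, hs]) (Exec.seq h1 h2) k1
      have e1 : 1 + (A + 1) + (n * (A + 3) + 1) + 1 = (n + 1) * (A + 3) + 1 := by ring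
      rwa [e1] at this
    · intro a ha h12 i
      rw [k3 a ha h12, hs₂, Store.clear_low _ _ _ ha, hs₁, Store.write_of_ne_array _ _ _ _ h12]
    · intro a i ha
      rcases k4 a i ha with h | h
      · rw [h]; exact hhigh a i ha
      · exact .inr h
    · rintro a i ha haA ⟨l, hl, hli⟩
      rcases Nat.lt_succ_iff_lt_or_eq.1 hl with hl | rfl
      · refine k5 a i ha haA ⟨l, hl, ?_⟩
        rw [hs₂, Store.clear_low _ _ _ (by omega), hs11, hli]
      · rcases k4 a i ha with h | h
        · rw [h, hs₂, Store.clear, if_pos ⟨ha, haA, hli.symm⟩]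
        · exact h

theorem PolyRun.of_exec {ι : Type*} {M : ι → ℕ} {p : Prog} {Pre Post : ι → Store → Prop} (c : ℕ)
    (h : ∀ R i σ s, Pre i σ → Agree s σ → ∃ s', Exec R p s s' c ∧ Post i s') :
    PolyRun M p Pre Post := by
  refine ⟨c, fun R i σ hM hp => Run.of_exec fun s hs => ?_⟩
  obtain ⟨s', h1, h2⟩ := h R i σ s hp hs
  exact ⟨s', c, h1, (Nat.lt_two_pow_self.le).trans (Nat.pow_le_pow_left hM _), h2⟩

end RAM

/-! ### Hamiltonian paths with a forced tail -/

theorem exists_lt_eq_of_injective {N : ℕ} {x : ℕ → ℕ} (hx : ∀ i < N, x i < N)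
    (hinj : ∀ i < N, ∀ j < N, x i = x j → i = j) {y : ℕ} (hy : y < N) : ∃ i < N, x i = y := by
  have h := Finset.surjOn_of_injOn_of_card_le (s := Finset.range N) (t := Finset.range N) x
    (fun i hi => by simpa using hx i (by simpa using hi))
    (fun i hi j hj h => hinj i (by simpa using hi) j (by simpa using hj) h) le_rfl
  obtain ⟨i, hi, h⟩ := h (show y ∈ (Finset.range N : Set ℕ) by simpa using hy)
  exact ⟨i, by simpa using hi, h⟩

/-- The relation `E` on the numbers less than `N` has a Hamiltonian path. -/
def HamSeq (E : ℕ → ℕ → Prop) (N : ℕ) : Prop :=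
  ∃ x : ℕ → ℕ, (∀ i < N, x i < N) ∧ (∀ i < N, ∀ j < N, x i = x j → i = j) ∧
    ∀ i, i + 1 < N → E (x i) (x (i + 1))

/-- The relation `A` on the numbers less than `n`, extended by a path `n, n + 1, …` that
is entered from the numbers with property `F`. -/
def padded (n : ℕ) (A : ℕ → ℕ → Prop) (F : ℕ → Prop) (u v : ℕ) : Prop :=
  (u < n ∧ ((v < n ∧ A u v) ∨ (¬ v < n ∧ v = n ∧ F u))) ∨ (¬ u < n ∧ v = u + 1)

/-- From `j ≥ n` the only way is to `j + 1`, so every Hamiltonian path ends with `n, n + 1, …, N -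
1`. Its first `n` positions are a Hamiltonian path of `A`, and the step into the tail says that this
path ends in a node with property `F`. -/
theorem hamSeq_padded_iff {n N : ℕ} (h1 : 1 ≤ n) (hN : n < N) (A : ℕ → ℕ → Prop) (F : ℕ → Prop) :
    HamSeq (padded n A F) N ↔ ∃ x : ℕ → ℕ, (∀ i < n, x i < n) ∧
      (∀ i < n, ∀ j < n, x i = x j → i = j) ∧ (∀ i, i + 1 < n → A (x i) (x (i + 1))) ∧
      F (x (n - 1)) := by
  constructor
  · rintro ⟨x, hx, hinj, hE⟩
    -- Downward induction on `j`: the number `N - 1` has no successor and hence is last; a smaller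
    -- `j ≥ n` is not last and is followed by `j + 1`, whose position is known.
    have tail : ∀ d j, N ≤ j + d + 1 → n ≤ j → j < N → x j = j := by
      intro d
      induction d with
      | zero =>
        intro j hj hnj hjN
        obtain ⟨i, hi, hxi⟩ := exists_lt_eq_of_injective hx hinj hjN
        by_cases hi' : i + 1 < N
        · have h := hE i hi'
          have h' := hx (i + 1) hi'
          rw [hxi] at h
          rcases h with h | h <;> omega
        · rwa [show i = j by omega] at hxi
      | succ d ih =>
        intro j hj hnj hjN
        by_cases hlast : j + 1 < N
        · have hsucc := ih (j + 1) (by omega) (by omega) hlast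
          obtain ⟨i, hi, hxi⟩ := exists_lt_eq_of_injective hx hinj hjN
          by_cases hi' : i + 1 < N
          · have h := hE i hi'
            rw [hxi] at h
            have h' : x (i + 1) = x (j + 1) := by
              rcases h with h | h <;> omega
            have := hinj _ hi' _ hlast h'
            rwa [show i = j by omega] at hxi
          · have := ih i (by omega) (by omega) hi
            omega
        · exact ih j (by omega) hnj hjN
    have htail : ∀ j, n ≤ j → j < N → x j = j := fun j h1 h2 => tail N j (by omega) h1 h2
    have hlt : ∀ i < n, x i < n := by
      intro i hi
      by_contra hc
      have h := hx i (by omega)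
      have := hinj _ h i (by omega) (htail _ (by omega) h)
      omega
    refine ⟨x, hlt, fun i hi j hj => hinj i (by omega) j (by omega), fun i hi => ?_, ?_⟩
    · have h := hE i (by omega)
      have h2 := hlt i (by omega)
      have h3 := hlt (i + 1) hi
      rcases h with ⟨-, h | h⟩ | h
      · exact h.2
      · omega
      · omega
    · have h := hE (n - 1) (by omega)
      rw [show n - 1 + 1 = n by omega, htail n le_rfl hN] at h
      have h2 := hlt (n - 1) (by omega)
      rcases h with ⟨-, h | h⟩ | h
      · omega
      · exact h.2.2
      · omega
  · rintro ⟨x, hx, hinj, hA, hF⟩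
    refine ⟨fun i => if i < n then x i else i, fun i hi => ?_, fun i hi j hj h => ?_, fun i hi => ?_⟩
    · show (if i < n then x i else i) < N
      split_ifs with h
      · exact (hx i h).trans hN
      · exact hi
    · dsimp only at h
      split_ifs at h with h1 h2 h2
      · exact hinj i h1 j h2 h
      · have := hx i h1; omega
      · have := hx j h2; omega
      · exact h
    · dsimp only
      split_ifs with h1 h2 h2
      · exact .inl ⟨hx i h1, .inl ⟨hx _ h2, hA i h2⟩⟩
      · rw [show n - 1 = i by omega] at hF
        exact .inl ⟨hx i h1, .inr ⟨h2, by omega, hF⟩⟩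
      · omega
      · exact .inr ⟨h1, rfl⟩

/-! ### From directed graphs to padded relations -/

namespace DigraphInst

variable (D : DigraphInst)

/-- Adjacency as a relation on numbers. -/
def adj (u v : ℕ) : Prop := ∃ (hu : u < D.n) (hv : v < D.n), D.G.Adj ⟨u, hu⟩ ⟨v, hv⟩

theorem adj_coe (u v : Fin D.n) : D.adj u v ↔ D.G.Adj u v :=
  ⟨fun ⟨_, _, h⟩ => h, fun h => ⟨u.2, v.2, h⟩⟩

theorem exists_perm {n : ℕ} {x : ℕ → ℕ} (hx : ∀ i < n, x i < n)
    (hinj : ∀ i < n, ∀ j < n, x i = x j → i = j) :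
    ∃ v : Equiv.Perm (Fin n), ∀ i : Fin n, (v i : ℕ) = x i := by
  have hb : Function.Injective (fun i : Fin n => (⟨x i, hx i i.2⟩ : Fin n)) := fun i j h =>
    Fin.ext (hinj i i.2 j j.2 (Fin.ext_iff.1 h))
  exact ⟨Equiv.ofBijective _ (Finite.injective_iff_bijective.1 hb), fun i => rfl⟩

theorem hasHamiltonianPath_iff {N : ℕ} (h1 : 1 ≤ D.n) (hN : D.n < N) :
    D.HasHamiltonianPath ↔ HamSeq (padded D.n D.adj (fun _ => True)) N := by
  rw [hamSeq_padded_iff h1 hN]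
  constructor
  · rintro ⟨v, hv⟩
    refine ⟨fun i => if h : i < D.n then v ⟨i, h⟩ else 0, fun i hi => ?_, fun i hi j hj h => ?_,
      fun i hi => ?_, trivial⟩
    · simp only [hi, dif_pos]; exact Fin.is_lt _
    · simp only [hi, hj, dif_pos] at h
      exact Fin.ext_iff.1 (v.injective (Fin.ext h))
    · simp only [hi, Nat.lt_of_succ_lt hi, dif_pos]
      exact (D.adj_coe _ _).2 (hv i hi)
  · rintro ⟨x, hx, hinj, hA, -⟩
    obtain ⟨v, hv⟩ := exists_perm hx hinj
    refine ⟨v, fun i h => ?_⟩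
    rw [← adj_coe, hv, hv]
    exact hA i h

/-- Read the cycle from node `0` on. Conversely, without edges into `0` a Hamiltonian path has to
start there, and the condition for entering the tail closes the cycle. For a single node both sides
ask for a loop. -/
theorem hasHamiltonianCycle_iff {N : ℕ} (h1 : 1 ≤ D.n) (hN : D.n < N) :
    D.HasHamiltonianCycle ↔
      HamSeq (padded D.n (fun u v => v ≠ 0 ∧ D.adj u v) (fun u => D.adj u 0)) N := by
  rw [hamSeq_padded_iff h1 hN]
  obtain ⟨n, G⟩ := D
  obtain ⟨m, rfl⟩ : ∃ m, n = m + 1 := ⟨n - 1, by simp only at h1; omega⟩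
  simp only
  have hrot : ∀ i : Fin (m + 1), finRotate (m + 1) i = i + 1 := fun i => finRotate_apply i
  constructor
  · rintro ⟨v, hv⟩
    -- The position of node `0` on the cycle, where the path `x` starts.
    let c := v.symm 0
    have hmod : ∀ i, (c.val + i) % (m + 1) < m + 1 := fun i => Nat.mod_lt _ (by omega)
    let x : ℕ → ℕ := fun i => v ⟨(c.val + i) % (m + 1), hmod i⟩
    have hinj : ∀ i < m + 1, ∀ j < m + 1, x i = x j → i = j := by
      intro i hi j hj h
      have h2 := Fin.ext_iff.1 (v.injective (Fin.ext h))
      simp only at h2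
      have h3 : i ≡ j [MOD m + 1] := Nat.ModEq.add_left_cancel' c.val h2
      exact h3.eq_of_lt_of_lt hi hj
    have hx0 : x 0 = 0 := by
      have : (⟨(c.val + 0) % (m + 1), hmod 0⟩ : Fin (m + 1)) = c :=
        Fin.ext (by simp [Nat.mod_eq_of_lt c.2])
      simp only [x, this, c, Equiv.apply_symm_apply]
      rfl
    have hstep : ∀ i, G.Adj (v ⟨(c.val + i) % (m + 1), hmod i⟩)
        (v ⟨(c.val + (i + 1)) % (m + 1), hmod (i + 1)⟩) := by
      intro i
      have h := hv ⟨(c.val + i) % (m + 1), hmod i⟩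
      rw [hrot] at h
      convert h using 2
      apply Fin.ext
      rw [Fin.val_add, Fin.val_one']
      simp [← add_assoc]
    refine ⟨x, fun i _ => Fin.is_lt _, hinj, fun i hi => ⟨fun h0 => ?_, ?_⟩, ?_⟩
    · have := hinj (i + 1) hi 0 (by omega) (h0.trans hx0.symm)
      omega
    · exact (adj_coe ⟨m + 1, G⟩ _ _).2 (hstep i)
    · have h := hstep m
      have e : (⟨(c.val + (m + 1)) % (m + 1), hmod (m + 1)⟩ : Fin (m + 1)) =
          ⟨(c.val + 0) % (m + 1), hmod 0⟩ := Fin.ext (by simp)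
      rw [e] at h
      have h' := (adj_coe ⟨m + 1, G⟩ _ _).2 h
      change adj ⟨m + 1, G⟩ (x m) (x 0) at h'
      rw [hx0] at h'
      exact h'
  · rintro ⟨x, hx, hinj, hA, hF⟩
    obtain ⟨v, hv⟩ := exists_perm hx hinj
    have hx0 : x 0 = 0 := by
      obtain ⟨i, hi, hxi⟩ := exists_lt_eq_of_injective hx hinj (y := 0) (by omega)
      rcases i with _ | i
      · exact hxi
      · exact absurd hxi (hA i hi).1
    refine ⟨v, fun i => ?_⟩
    refine (adj_coe ⟨m + 1, G⟩ _ _).1 ?_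
    rw [hv, hv, hrot]
    by_cases hi : (i : ℕ) + 1 < m + 1
    · have : ((i + 1 : Fin (m + 1)) : ℕ) = i + 1 := by
        rw [Fin.val_add, Fin.val_one', Nat.add_mod_mod, Nat.mod_eq_of_lt hi]
      rw [this]
      exact (hA i hi).2
    · have h2 : (i : ℕ) < m + 1 := i.2
      have : ((i + 1 : Fin (m + 1)) : ℕ) = 0 := by
        rw [Fin.val_add, Fin.val_one', Nat.add_mod_mod, show (i : ℕ) + 1 = m + 1 by omega,
          Nat.mod_self]
      rw [this, hx0]
      rw [show (i : ℕ) = m + 1 - 1 by omega]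
      exact hF

end DigraphInst

/-! ### Digits -/

/-- The digit with index `i` of `t` in base `N`. -/
def dig (N t i : ℕ) : ℕ := t / N ^ i % N

theorem dig_lt {N : ℕ} (hN : 0 < N) (t i : ℕ) : dig N t i < N := Nat.mod_lt _ hN

/-- Besides building numbers digit by digit, this shows that the leading digits of the code of a
block are free. -/
theorem dig_add_mul {N : ℕ} (hN : 0 < N) (t c : ℕ) {i K : ℕ} (hi : i < K) :
    dig N (t + c * N ^ K) i = dig N t i := by
  obtain ⟨d, rfl⟩ : ∃ d, K = i + (d + 1) := ⟨K - i - 1, by omega⟩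
  have e : t + c * N ^ (i + (d + 1)) = t + N ^ i * (c * N ^ d * N) := by ring
  rw [dig, dig, e, Nat.add_mul_div_left _ _ (by positivity), Nat.add_mul_mod_self_right]

theorem exists_dig {N : ℕ} (hN : 0 < N) (w : ℕ → ℕ) : ∀ K, (∀ i < K, w i < N) →
    ∃ t < N ^ K, ∀ i < K, dig N t i = w i := by
  intro K
  induction K with
  | zero => exact fun _ => ⟨0, by simp, by simp⟩
  | succ K ih =>
    intro hw
    obtain ⟨t, ht, hd⟩ := ih fun i hi => hw i (by omega)
    have hK := hw K (by omega)
    refine ⟨t + w K * N ^ K, ?_, fun i hi => ?_⟩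
    · calc t + w K * N ^ K < N ^ K + w K * N ^ K := by omega
        _ = (w K + 1) * N ^ K := by ring
        _ ≤ N * N ^ K := Nat.mul_le_mul_right _ hK
        _ = N ^ (K + 1) := by ring
    · rcases Nat.lt_succ_iff_lt_or_eq.1 hi with hi | rfl
      · rw [dig_add_mul hN _ _ hi, hd i hi]
      · rw [dig, Nat.add_mul_div_right _ _ (by positivity), Nat.div_eq_of_lt ht, zero_add,
          Nat.mod_eq_of_lt hK]

theorem dig_zero (N i : ℕ) : dig N 0 i = 0 := by simp [dig]

/-- When `1` is added to `t`, a carry reaches digit `i` exactly if `N ^ i` divides `t + 1`;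
`pow_succ_dvd_succ` tells when the carry is passed on. -/
theorem dig_succ {N : ℕ} (hN : 2 ≤ N) (t i : ℕ) : dig N (t + 1) i =
    if N ^ i ∣ t + 1 then (if dig N t i + 1 = N then 0 else dig N t i + 1) else dig N t i := by
  rw [dig, dig, Nat.succ_div]
  split_ifs with h1 h2
  · rw [Nat.add_mod, Nat.mod_eq_of_lt (show 1 < N by omega), h2, Nat.mod_self]
  · have := Nat.mod_lt (t / N ^ i) (show 0 < N by omega)
    rw [Nat.add_mod, Nat.mod_eq_of_lt (show 1 < N by omega), Nat.mod_eq_of_lt (by omega)]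
  · rw [add_zero]

theorem pow_succ_dvd_succ {N : ℕ} (hN : 2 ≤ N) (t i : ℕ) :
    N ^ (i + 1) ∣ t + 1 ↔ N ^ i ∣ t + 1 ∧ dig N t i + 1 = N := by
  constructor
  · intro h
    have h1 : N ^ i ∣ t + 1 := (pow_dvd_pow N (by omega)).trans h
    refine ⟨h1, ?_⟩
    by_contra hc
    have h2 := dig_succ hN t i
    rw [if_pos h1, if_neg hc] at h2
    obtain ⟨c, hc'⟩ := h
    rw [dig, hc', pow_succ, mul_assoc, Nat.mul_div_cancel_left _ (by positivity),
      Nat.mul_mod_right] at h2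
    omega
  · rintro ⟨h1, h2⟩
    have h3 := dig_succ hN t i
    rw [if_pos h1, if_pos h2] at h3
    obtain ⟨c, hc⟩ := h1
    rw [dig, hc, Nat.mul_div_cancel_left _ (by positivity)] at h3
    rw [hc, pow_succ]
    exact Nat.mul_dvd_mul_left _ (Nat.dvd_of_mod_eq_zero h3)

/-! ### Covering by paths between guessed nodes -/

/-- The tuple `w 0, …, w (l - 1)` is a path that starts in one of the nodes
`g 0, …, g (k - 1)` and can be continued to the next one of these nodes. -/
structure IsBlock (E : ℕ → ℕ → Prop) (l k : ℕ) (g w : ℕ → ℕ) : Prop where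
  chain : ∀ i, i < l → i + 1 < l → E (w i) (w (i + 1))
  inj : ∀ i < l, ∀ j < l, w i = w j → i = j
  start : ∃ i < k, w 0 = g i ∧ (i + 1 < k → E (w (l - 1)) (g (i + 1)))

/-- The nodes `g 0, …, g (k - 1)` divide some Hamiltonian path into blocks of length `l`. -/
def BlockStarts (E : ℕ → ℕ → Prop) (l k : ℕ) (g : ℕ → ℕ) : Prop :=
  ∃ x : ℕ → ℕ, (∀ i < k * l, x i < k * l) ∧
    (∀ i < k * l, ∀ j < k * l, x i = x j → i = j) ∧
    (∀ i, i + 1 < k * l → E (x i) (x (i + 1))) ∧ ∀ i < k, g i = x (i * l)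

theorem block_index_lt {l k i r : ℕ} (hi : i < k) (hr : r < l) : i * l + r < k * l :=
  calc i * l + r < i * l + l := by omega
    _ = (i + 1) * l := by ring
    _ ≤ k * l := Nat.mul_le_mul_right _ hi

theorem BlockStarts.exists_blocks {E : ℕ → ℕ → Prop} {l k : ℕ} {g : ℕ → ℕ} (hl : 0 < l)
    (h : BlockStarts E l k g) : ∃ W : ℕ → ℕ → ℕ,
      (∀ i < k, IsBlock E l k g (W i) ∧ ∀ r < l, W i r < k * l) ∧
      ∀ y < k * l, ∃ i < k, ∃ r < l, W i r = y := by
  obtain ⟨x, hx, hinj, hE, hg⟩ := h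
  refine ⟨fun i r => x (i * l + r), fun i hi => ⟨⟨fun r h1 h2 => ?_, fun r hr r' hr' h => ?_,
    i, hi, (hg i hi).symm, fun hi' => ?_⟩, fun r hr => hx _ (block_index_lt hi hr)⟩, fun y hy => ?_⟩
  · exact hE _ (block_index_lt hi h2)
  · have := hinj _ (block_index_lt hi hr) _ (block_index_lt hi hr') h
    omega
  · have e : i * l + (l - 1) + 1 = (i + 1) * l := by
      rw [add_assoc, Nat.sub_add_cancel hl]; ring
    have hlt : (i + 1) * l < k * l := Nat.mul_lt_mul_of_pos_right hi' hl
    have := hE (i * l + (l - 1)) (by omega)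
    rwa [e, ← hg (i + 1) hi'] at this
  · obtain ⟨j, hj, hxj⟩ := exists_lt_eq_of_injective hx hinj hy
    refine ⟨j / l, Nat.div_lt_of_lt_mul (by rwa [mul_comm]), j % l, Nat.mod_lt _ hl, ?_⟩
    simp only
    rw [Nat.div_add_mod', hxj]

/-- The `k` blocks have `k * l` places for `k * l` nodes, so they are disjoint. In particular their
first nodes differ, so each guess number belongs to exactly one block, and the blocks in this order
form a path. -/
theorem hamSeq_of_cover {ι : Type*} {E : ℕ → ℕ → Prop} {l k : ℕ} {g : ℕ → ℕ} (hl : 0 < l)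
    (J : Finset ι) (W : ι → ℕ → ℕ) (hV : ∀ j ∈ J, IsBlock E l k g (W j))
    (hlt : ∀ j ∈ J, ∀ r < l, W j r < k * l) (hJ : J.card = k)
    (hcov : ∀ y < k * l, ∃ j ∈ J, ∃ r < l, W j r = y) : HamSeq E (k * l) := by
  have hinj : Set.InjOn (fun p : ι × ℕ => W p.1 p.2) (J ×ˢ Finset.range l : Finset (ι × ℕ)) := by
    -- A surjection between finite sets of the same cardinality is injective.
    refine Finset.injOn_of_surjOn_of_card_le (t := Finset.range (k * l)) _ ?_ ?_ ?_
    · rintro ⟨j, r⟩ h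
      simp only [Finset.coe_product, Set.mem_prod, Finset.mem_coe, Finset.mem_range] at h
      simpa using hlt j h.1 r h.2
    · intro y hy
      obtain ⟨j, hj, r, hr, h⟩ := hcov y (by simpa using hy)
      exact ⟨(j, r), by simp [hj, hr], h⟩
    · simp [hJ]
  have hinj' : ∀ j ∈ J, ∀ r < l, ∀ j' ∈ J, ∀ r' < l, W j r = W j' r' → j = j' ∧ r = r' := by
    intro j hj r hr j' hj' r' hr' h
    have := @hinj (j, r) (by simp [hj, hr]) (j', r') (by simp [hj', hr']) h
    exact Prod.ext_iff.1 this
  choose! s hs using fun j hj => (hV j hj).start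
  -- The guessed nodes need not be distinct. Still, blocks with the same guess number share their
  -- first node, so they are equal.
  have hsinj : Set.InjOn s J := by
    intro j hj j' hj' h
    exact (hinj' j hj 0 hl j' hj' 0 hl (by rw [(hs j hj).2.1, (hs j' hj').2.1, h])).1
  have hsurj : ∀ i < k, ∃ j ∈ J, s j = i := by
    have := Finset.surjOn_of_injOn_of_card_le (s := J) (t := Finset.range k) s
      (fun j hj => by simpa using (hs j hj).1) hsinj (by simp [hJ])
    intro i hi
    obtain ⟨j, hj, h⟩ := this (show i ∈ (Finset.range k : Set ℕ) by simpa using hi)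
    exact ⟨j, hj, h⟩
  rcases Nat.eq_zero_or_pos k with rfl | hk
  · exact ⟨id, by simp, by simp, by simp⟩
  have : Nonempty ι := let ⟨j, _⟩ := hsurj 0 hk; ⟨j⟩
  choose! b hb using hsurj
  have hdiv : ∀ p < k * l, p / l < k := fun p hp => Nat.div_lt_of_lt_mul (by rwa [mul_comm])
  have hmod : ∀ p, p % l < l := fun p => Nat.mod_lt _ hl
  refine ⟨fun p => W (b (p / l)) (p % l), fun p hp => hlt _ (hb _ (hdiv p hp)).1 _ (hmod p),
    fun p hp p' hp' h => ?_, fun p hp => ?_⟩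
  · obtain ⟨h1, h2⟩ := hinj' _ (hb _ (hdiv p hp)).1 _ (hmod p) _ (hb _ (hdiv p' hp')).1 _ (hmod p') h
    have h3 : p / l = p' / l := by
      rw [← (hb _ (hdiv p hp)).2, ← (hb _ (hdiv p' hp')).2, h1]
    rw [← Nat.div_add_mod' p l, ← Nat.div_add_mod' p' l, h2, h3]
  · have hp0 := hb _ (hdiv p (by omega))
    have hpm := hmod p
    have hdm := Nat.div_add_mod' p l
    by_cases hc : p % l + 1 < l
    · have e : p + 1 = p % l + 1 + p / l * l := by omega
      have e1 : (p + 1) / l = p / l := by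
        rw [e, Nat.add_mul_div_right _ _ hl, Nat.div_eq_of_lt hc, zero_add]
      have e2 : (p + 1) % l = p % l + 1 := by
        conv_lhs => rw [e, Nat.add_mul_mod_self_right, Nat.mod_eq_of_lt hc]
      simp only [e1, e2]
      exact (hV _ hp0.1).chain _ (hmod p) hc
    · have e : p + 1 = (p / l + 1) * l := by rw [add_mul]; omega
      have e1 : (p + 1) / l = p / l + 1 := by rw [e, Nat.mul_div_cancel _ hl]
      have e2 : (p + 1) % l = 0 := by rw [e, Nat.mul_mod_left]
      have hlt' := hdiv _ hp
      rw [e1] at hlt'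
      have hp1 := hb _ hlt'
      have hE := (hs _ hp0.1).2.2
      rw [hp0.2] at hE
      have h0 := (hs _ hp1.1).2.1
      rw [hp1.2] at h0
      simp only [e1, e2, h0, show p % l = l - 1 by omega]
      exact hE hlt'

/-! ### The instance of Set Cover for guessed nodes -/

open Classical in
/-- The codes less than `T` of blocks. The two leading digits of a code do not matter. -/
noncomputable def blockCodes (E : ℕ → ℕ → Prop) (N l k : ℕ) (g : ℕ → ℕ) (T : ℕ) : List ℕ :=
  (List.range T).filter fun t => IsBlock E l k g (dig N t)

/-- `x` is a node of the block with code `t`. -/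
def InBlock (N l t x : ℕ) : Prop := ∃ i < l, dig N t i = x

/-- `x` is a node of the block number `j` in the list. -/
def InRow (N l : ℕ) (L : List ℕ) (j x : ℕ) : Prop := j < L.length ∧ InBlock N l (L.getD j 0) x

open Classical in
/-- The instance of Set Cover for a list of codes of blocks. -/
noncomputable def blockInst (N l : ℕ) (L : List ℕ) : SetCoverInst where
  n := N
  m := L.length
  S := fun j => Finset.univ.filter fun x : Fin N => InRow N l L j x

theorem mem_blockInst {N l : ℕ} {L : List ℕ} {j : Fin L.length} {x : Fin N} :
    x ∈ (blockInst N l L).S j ↔ InRow N l L j x := by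
  classical
  exact Finset.mem_filter.trans (and_iff_right (Finset.mem_univ _))

theorem blockCodes_length_le (E : ℕ → ℕ → Prop) (N l k : ℕ) (g : ℕ → ℕ) (T : ℕ) :
    (blockCodes E N l k g T).length ≤ T := by
  classical
  exact (List.length_filter_le _ _).trans (by simp)

theorem mem_blockCodes {E : ℕ → ℕ → Prop} {N l k : ℕ} {g : ℕ → ℕ} {T t : ℕ} :
    t ∈ blockCodes E N l k g T ↔ t < T ∧ IsBlock E l k g (dig N t) := by
  classical
  simp [blockCodes]

theorem blockCodes_isBlock {E : ℕ → ℕ → Prop} {N l k : ℕ} {g : ℕ → ℕ} {T j : ℕ}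
    (hj : j < (blockCodes E N l k g T).length) :
    IsBlock E l k g (dig N ((blockCodes E N l k g T).getD j 0)) := by
  rw [List.getD_eq_getElem _ _ hj]
  exact (mem_blockCodes.1 (List.getElem_mem hj)).2

theorem blockInst_input {N l : ℕ} (hN : 0 < N) (L : List ℕ) (a i : ℕ) :
    (blockInst N l L).input a i = if a = 0 then (if i = 0 then N else if i = 1 then L.length else 0)
      else if a = 1 then (open Classical in if InRow N l L (i / N) (i % N) then 1 else 0) else 0 := by
  classical
  have key : (∃ (j : Fin L.length) (x : Fin N), i = (j : ℕ) * N + (x : ℕ) ∧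
      x ∈ (blockInst N l L).S j) ↔ InRow N l L (i / N) (i % N) := by
    constructor
    · rintro ⟨j, x, rfl, hx⟩
      rw [mem_blockInst] at hx
      rwa [Nat.mul_add_mod', Nat.mod_eq_of_lt x.2, mul_comm, Nat.mul_add_div hN,
        Nat.div_eq_of_lt x.2, add_zero]
    · intro h
      exact ⟨⟨i / N, h.1⟩, ⟨i % N, Nat.mod_lt _ hN⟩, (Nat.div_add_mod' i N).symm,
        mem_blockInst.2 h⟩
  rw [SetCoverInst.input]
  by_cases ha : a = 0
  · rw [if_pos ha, if_pos ha]; rfl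
  · rw [if_neg ha, if_neg ha]
    by_cases ha1 : a = 1
    · rw [if_pos ha1, if_pos ha1]
      exact if_congr key rfl rfl
    · rw [if_neg ha1, if_neg ha1]

theorem card_block {E : ℕ → ℕ → Prop} {N l k : ℕ} (hN : 0 < N) {g : ℕ → ℕ} {T : ℕ}
    (j : Fin (blockCodes E N l k g T).length) :
    ((blockInst N l (blockCodes E N l k g T)).S j).card = l := by
  classical
  have hb := blockCodes_isBlock j.2
  have h : ((blockInst N l (blockCodes E N l k g T)).S j).card = (Finset.range l).card := by
    symm
    refine Finset.card_bij (fun i _ => (⟨dig N ((blockCodes E N l k g T).getD j 0) i,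
      dig_lt hN _ _⟩ : Fin N)) ?_ ?_ ?_
    · intro i hi
      exact mem_blockInst.2 ⟨j.2, i, Finset.mem_range.1 hi, rfl⟩
    · intro i hi i' hi' h
      exact hb.inj i (Finset.mem_range.1 hi) i' (Finset.mem_range.1 hi') (Fin.ext_iff.1 h)
    · intro x hx
      obtain ⟨-, i, hi, hix⟩ := mem_blockInst.1 hx
      exact ⟨i, Finset.mem_range.2 hi, Fin.ext hix⟩
  rw [h, Finset.card_range]

/-! ### Counting arguments for covers by sets of bounded size -/

namespace SetCoverInst

theorem card_le_of_isCover {I : SetCoverInst} {l : ℕ} (hS : ∀ j, (I.S j).card ≤ l)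
    {J : Finset (Fin I.m)} (hJ : I.IsCover J) : I.n ≤ J.card * l := by
  classical
  have h1 : (Finset.univ : Finset (Fin I.n)) ⊆ J.biUnion I.S := fun x _ => by
    obtain ⟨j, hj, hx⟩ := hJ x
    exact Finset.mem_biUnion.2 ⟨j, hj, hx⟩
  have h2 := Finset.card_le_card h1
  rw [Finset.card_univ, Fintype.card_fin] at h2
  exact h2.trans (Finset.card_biUnion_le_card_mul _ _ _ fun j _ => hS j)

/-- If two of the sets shared `x`, then `x` could be removed from one of them, and the remaining
sets would cover `k * l` elements with a total size of at most `k * l - 1`. -/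
theorem disjoint_of_isCover {I : SetCoverInst} {l k : ℕ} (hS : ∀ j, (I.S j).card ≤ l)
    (hn : I.n = k * l) {J : Finset (Fin I.m)} (hJ : I.IsCover J) (hk : J.card = k) :
    I.ConsistsOfDisjointSets J := by
  classical
  intro i hi j hj hij
  rw [Finset.disjoint_left]
  intro x hxi hxj
  have h1 : (Finset.univ : Finset (Fin I.n)) ⊆ (I.S i).erase x ∪ (J.erase i).biUnion I.S := by
    intro y _
    obtain ⟨j', hj', hy⟩ := hJ y
    by_cases hy' : y = x
    · exact Finset.mem_union_right _ (Finset.mem_biUnion.2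
        ⟨j, Finset.mem_erase.2 ⟨hij.symm, hj⟩, hy' ▸ hxj⟩)
    · by_cases hc : j' = i
      · exact Finset.mem_union_left _ (Finset.mem_erase.2 ⟨hy', hc ▸ hy⟩)
      · exact Finset.mem_union_right _ (Finset.mem_biUnion.2
          ⟨j', Finset.mem_erase.2 ⟨hc, hj'⟩, hy⟩)
  have h2 := (Finset.card_le_card h1).trans (Finset.card_union_le _ _)
  have h3 : ((J.erase i).biUnion I.S).card ≤ (J.erase i).card * l :=
    Finset.card_biUnion_le_card_mul _ _ _ fun j _ => hS j
  rw [Finset.card_univ, Fintype.card_fin, Finset.card_erase_of_mem hxi] at h2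
  rw [Finset.card_erase_of_mem hi, hk] at h3
  have h4 := hS i
  have h5 : 0 < (I.S i).card := Finset.card_pos.2 ⟨x, hxi⟩
  have h6 : 0 < k := hk ▸ Finset.card_pos.2 ⟨i, hi⟩
  have h7 : k * l = (k - 1) * l + l := by
    obtain ⟨k', rfl⟩ : ∃ k', k = k' + 1 := ⟨k - 1, by omega⟩
    rw [Nat.add_sub_cancel]; ring
  omega

end SetCoverInst

/-- The blocks of the Hamiltonian path itself, represented by their codes with leading digits `0`.
An inequality is enough here, as `card_le_of_isCover` provides the converse. -/
theorem exists_small_cover {E : ℕ → ℕ → Prop} {l k : ℕ} (hl : 0 < l) (hk : 0 < k) {g : ℕ → ℕ}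
    (h : BlockStarts E l k g) :
    ∃ J, (blockInst (k * l) l (blockCodes E (k * l) l k g ((k * l) ^ (l + 2)))).IsCover J ∧
      J.card ≤ k := by
  classical
  obtain ⟨W, hW, hcov⟩ := h.exists_blocks hl
  have hN : 0 < k * l := Nat.mul_pos hk hl
  set L := blockCodes E (k * l) l k g ((k * l) ^ (l + 2)) with hL
  have hidx : ∀ i : Fin k, ∃ j : Fin L.length, ∀ r < l, dig (k * l) (L.getD j 0) r = W i r := by
    intro i
    obtain ⟨t, ht, hd⟩ := exists_dig hN (W i) l (hW i i.2).2
    have hb : IsBlock E l k g (dig (k * l) t) := by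
      have hV := (hW i i.2).1
      refine ⟨fun r h1 h2 => ?_, fun r hr r' hr' hh => ?_, ?_⟩
      · rw [hd r h1, hd _ h2]; exact hV.chain r h1 h2
      · rw [hd r hr, hd r' hr'] at hh; exact hV.inj r hr r' hr' hh
      · rw [hd 0 hl, hd (l - 1) (by omega)]; exact hV.start
    have hmem : t ∈ L := mem_blockCodes.2
      ⟨ht.trans_le (Nat.pow_le_pow_right hN (by omega)), hb⟩
    obtain ⟨j, hj, hjt⟩ := List.getElem_of_mem hmem
    refine ⟨⟨j, hj⟩, fun r hr => ?_⟩
    rw [List.getD_eq_getElem _ _ hj, hjt, hd r hr]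
  choose b hb using hidx
  refine ⟨Finset.univ.image b, fun x => ?_, Finset.card_image_le.trans (by simp)⟩
  obtain ⟨i, hi, r, hr, hy⟩ := hcov x x.2
  exact ⟨b ⟨i, hi⟩, Finset.mem_image_of_mem _ (Finset.mem_univ _),
    mem_blockInst.2 ⟨(b ⟨i, hi⟩).2, r, hr, (hb ⟨i, hi⟩ r hr).trans hy⟩⟩

/-- This is the purpose of the two additional digits of the codes: Set Cover instances need more
sets than elements, and the first block of the path occurs with all `N ^ 2 > N` values of the two
leading digits. -/
theorem lt_length_blockCodes {E : ℕ → ℕ → Prop} {l k : ℕ} (hl : 0 < l) (hk : 0 < k)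
    (hN2 : 2 ≤ k * l) {g : ℕ → ℕ} (h : BlockStarts E l k g) :
    k * l < (blockCodes E (k * l) l k g ((k * l) ^ (l + 2))).length := by
  classical
  obtain ⟨W, hW, -⟩ := h.exists_blocks hl
  set N := k * l with hN
  obtain ⟨t, ht, hd⟩ := exists_dig (show 0 < N by omega) (W 0) l (hW 0 hk).2
  have hV := (hW 0 hk).1
  have hb : ∀ c, IsBlock E l k g (dig N (t + c * N ^ l)) := by
    intro c
    have hd' : ∀ r < l, dig N (t + c * N ^ l) r = W 0 r := fun r hr => by
      rw [dig_add_mul (by omega) _ _ hr, hd r hr]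
    refine ⟨fun r h1 h2 => ?_, fun r hr r' hr' hh => ?_, ?_⟩
    · rw [hd' r h1, hd' _ h2]; exact hV.chain r h1 h2
    · rw [hd' r hr, hd' r' hr'] at hh; exact hV.inj r hr r' hr' hh
    · rw [hd' 0 hl, hd' (l - 1) (by omega)]; exact hV.start
  have hpos : 0 < N ^ l := by positivity
  have hsub : (Finset.range (N ^ 2)).image (fun c => t + c * N ^ l) ⊆
      (blockCodes E N l k g (N ^ (l + 2))).toFinset := by
    intro y hy
    obtain ⟨c, hc, rfl⟩ := Finset.mem_image.1 hy
    rw [List.mem_toFinset, mem_blockCodes]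
    refine ⟨?_, hb c⟩
    calc t + c * N ^ l < N ^ l + c * N ^ l := by omega
      _ = (c + 1) * N ^ l := by ring
      _ ≤ N ^ 2 * N ^ l := Nat.mul_le_mul_right _ (Finset.mem_range.1 hc)
      _ = N ^ (l + 2) := by ring
  have h1 := Finset.card_le_card hsub
  rw [Finset.card_image_of_injective _ (fun c c' hc => by
    have := Nat.add_left_cancel hc
    exact Nat.eq_of_mul_eq_mul_right hpos this), Finset.card_range] at h1
  have h2 := (blockCodes E N l k g (N ^ (l + 2))).toFinset_card_le
  nlinarith

theorem blockInst_optimal {E : ℕ → ℕ → Prop} {l k : ℕ} (hl : 0 < l) (hk : 0 < k) {g : ℕ → ℕ}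
    (h : BlockStarts E l k g)
    {J : Finset (Fin (blockInst (k * l) l (blockCodes E (k * l) l k g ((k * l) ^ (l + 2)))).m)}
    (hJ : (blockInst (k * l) l (blockCodes E (k * l) l k g ((k * l) ^ (l + 2)))).IsOptimal J) :
    J.card = k := by
  obtain ⟨J₀, h1, h2⟩ := exists_small_cover hl hk h
  have h3 := hJ.2 J₀ h1
  have h4 : k * l ≤ J.card * l := SetCoverInst.card_le_of_isCover
    (fun j => (card_block (Nat.mul_pos hk hl) j).le) hJ.1
  have h5 := Nat.le_of_mul_le_mul_right h4 hl
  omega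

/-- Only right guesses are shown to satisfy the promise. The bound for the size of an optimal
solution reduces to `hκ`, because this size is exactly `k`. -/
theorem blockInst_mem {E : ℕ → ℕ → Prop} {l k : ℕ} (hl : 0 < l) (hk : 0 < k)
    (hN2 : 2 ≤ k * l) {g : ℕ → ℕ} (h : BlockStarts E l k g) {Δ : ℕ → ℕ} {κ : ℝ}
    (hΔ : l ≤ Δ (k * l)) (hκ : (k : ℝ) * Real.log ((k * l : ℕ) : ℝ) ≤ κ * ((k * l : ℕ) : ℝ)) :
    blockInst (k * l) l (blockCodes E (k * l) l k g ((k * l) ^ (l + 2))) ∈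
      restrictedDeltaSetCover Δ κ := by
  have hc := fun j => card_block (E := E) (T := (k * l) ^ (l + 2)) (g := g) (l := l) (k := k)
    (Nat.mul_pos hk hl) j
  obtain ⟨J₀, h1, h2⟩ := exists_small_cover hl hk h
  refine ⟨lt_length_blockCodes hl hk hN2 h, fun j => (hc j).le.trans hΔ, ⟨J₀, h1⟩, ⟨l, hc⟩,
    fun J hJ => ?_⟩
  have hJk := blockInst_optimal hl hk h hJ
  exact ⟨by rw [hJk]; exact hκ, SetCoverInst.disjoint_of_isCover (fun j => (hc j).le) rfl hJ.1 hJk⟩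

/-- A cover by `k` blocks yields a Hamiltonian path. -/
theorem hamSeq_of_blockInst_cover {E : ℕ → ℕ → Prop} {l k : ℕ} (hl : 0 < l) (hk : 0 < k)
    {g : ℕ → ℕ} {T : ℕ} {J : Finset (Fin (blockCodes E (k * l) l k g T).length)}
    (hJ : (blockInst (k * l) l (blockCodes E (k * l) l k g T)).IsCover J) (hJk : J.card = k) :
    HamSeq E (k * l) := by
  refine hamSeq_of_cover (g := g) hl J
    (fun j => dig (k * l) ((blockCodes E (k * l) l k g T).getD j 0))
    (fun j _ => blockCodes_isBlock j.2) (fun j _ r _ => dig_lt (Nat.mul_pos hk hl) _ _) hJk ?_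
  intro y hy
  obtain ⟨j, hj, hx⟩ := hJ ⟨y, hy⟩
  obtain ⟨-, r, hr, h⟩ := mem_blockInst.1 hx
  exact ⟨j, hj, r, hr, h⟩

theorem exists_blockStarts {E : ℕ → ℕ → Prop} {l k : ℕ} (hl : 0 < l) (hk : 0 < k)
    (h : HamSeq E (k * l)) : ∃ t < (k * l) ^ k, BlockStarts E l k (dig (k * l) t) := by
  obtain ⟨x, hx, hinj, hE⟩ := h
  obtain ⟨t, ht, hd⟩ := exists_dig (Nat.mul_pos hk hl) (fun i => x (i * l)) k
    fun i hi => hx _ (block_index_lt hi hl)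
  exact ⟨t, ht, x, hx, hinj, hE, hd⟩

namespace RAM

/-! ### Parameters of the main loop -/

/-- The parameters of the search for a Hamiltonian path: the length and the number of the
blocks, the number of nodes, the logarithm of the fuel, a bound for the numbers in memory, and the
edge relation. -/
structure Par where
  l : ℕ
  k : ℕ
  N : ℕ
  e : ℕ
  M : ℕ
  E : ℕ → ℕ → Prop

/-- The relations between the parameters. -/
structure Par.OK (P : Par) : Prop where
  l_pos : 0 < P.l
  k_pos : 0 < P.k
  N_eq : P.N = P.k * P.l
  two_le : 2 ≤ P.N
  pow_le : P.N ^ (P.l + 3) + 2 ≤ P.M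
  l_le : P.l + 2 ≤ P.M
  k_le : P.k ≤ P.M
  e_le : P.e ≤ P.M

theorem Par.OK.pow_le' {P : Par} (h : P.OK) : P.N ^ (P.l + 2) * P.N + 2 ≤ P.M := by
  rw [← pow_succ]; exact h.pow_le

theorem Par.OK.N_le {P : Par} (h : P.OK) : P.N ≤ P.M := by
  have h1 := h.pow_le'
  have h2 := h.two_le
  have : 1 * P.N ≤ P.N ^ (P.l + 2) * P.N := Nat.mul_le_mul_right _ (Nat.one_le_pow _ _ (by omega))
  omega

theorem Par.OK.codes_le {P : Par} (h : P.OK) : P.N ^ (P.l + 2) ≤ P.M := by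
  have h1 := h.pow_le'
  have h2 := h.two_le
  have : P.N ^ (P.l + 2) * 1 ≤ P.N ^ (P.l + 2) * P.N := Nat.mul_le_mul_left _ (by omega)
  omega

/-- The part of the memory that does not change in the main loop. -/
structure Env (P : Par) (σ : Store) : Prop where
  ok : P.OK
  bdd : Bdd P.M σ
  l : σ 0 2 = P.l
  k : σ 0 3 = P.k
  N : σ 0 4 = P.N
  e : σ 0 5 = P.e
  mat : ∀ u < P.N, ∀ v < P.N, (σ 3 (u * P.N + v) ≠ 0 ↔ P.E u v)

theorem Env.congr {P : Par} {σ σ' : Store} (h : Env P σ) (hb : Bdd P.M σ')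
    (h0 : ∀ i < 6, σ' 0 i = σ 0 i) (h3 : ∀ i, σ' 3 i = σ 3 i) : Env P σ' where
  ok := h.ok
  bdd := hb
  l := by rw [h0 2 (by omega), h.l]
  k := by rw [h0 3 (by omega), h.k]
  N := by rw [h0 4 (by omega), h.N]
  e := by rw [h0 5 (by omega), h.e]
  mat u hu v hv := by rw [h3]; exact h.mat u hu v hv

/-! ### Counting in base `N` -/

/-- Increment the number with the given number of digits in array `a`. In the end, register `8`
tells whether there was an overflow. -/
def increment (a : ℕ) (K : Tm) : Prog :=
  .seq (set 0 (.lit 8) (.lit 1)) (forS 9 K (ifS (.reg 8)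
    (ifS (.eq (.add (.arr a (.reg 9)) (.lit 1)) (.reg 4)) (set a (.reg 9) (.lit 0))
      (.seq (set a (.reg 9) (.add (.arr a (.reg 9)) (.lit 1))) (set 0 (.lit 8) (.lit 0))))
    .nop))

/-- The situation in which a number is incremented. -/
structure IncSetup where
  σ₀ : Store
  M : ℕ
  N : ℕ
  K : ℕ
  t : ℕ

/-- The requirements for incrementing a number. -/
structure IncSetup.OK (I : IncSetup) (a : ℕ) (K : Tm) : Prop where
  bdd : Bdd I.M I.σ₀
  two_le : 2 ≤ I.N
  N_le : I.N ≤ I.M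
  K_le : I.K ≤ I.M
  N : I.σ₀ 0 4 = I.N
  K : ∀ σ : Store, (∀ j < 6, σ 0 j = I.σ₀ 0 j) → K.ev σ = I.K
  digits : ∀ j < I.K, I.σ₀ a j = dig I.N I.t j

/-- The invariant of the loop over the digits. -/
structure IncSetup.Inv (I : IncSetup) (a : ℕ) (K : Tm) (j : ℕ) (σ : Store) : Prop where
  ok : I.OK a K
  bdd : Bdd I.M σ
  frame : ∀ b i, b ≠ a → (b = 0 → i ≠ 8 ∧ i ≠ 9) → σ b i = I.σ₀ b i
  done : ∀ i < j, σ a i = dig I.N (I.t + 1) i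
  todo : ∀ i, j ≤ i → σ a i = I.σ₀ a i
  carry : σ 0 8 = open Classical in if I.N ^ j ∣ I.t + 1 then 1 else 0

/-- Register `8` is the carry into digit `j`. After `K` digits it is set exactly if `N ^ K` divides
`t + 1`, that is at an overflow, and it then ends the loop in which the increment is used. -/
theorem increment_polyRun {a : ℕ} (ha : 0 < a) (ha6 : a < 6) {K : Tm} (hK : K.WF 0) :
    PolyRun IncSetup.M (increment a K) (fun I σ => I.OK a K ∧ σ = I.σ₀)
      (fun I σ => I.Inv a K I.K σ) := by
  classical
  refine PolyRun.seq (Mid := fun I σ => I.Inv a K 0 σ) (.set (fun I σ h => h.2 ▸ h.1.bdd) ?_) ?_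
  · rintro I _ ⟨h, rfl⟩
    refine ⟨h, h.bdd.write _ _ fun _ => ?_, fun b i hb hi => ?_, by simp, fun i _ => ?_, ?_⟩
    · have := h.two_le
      have := h.N_le
      simp only [Tm.ev, Tm.eval]; omega
    · simp only [Tm.ev, Tm.eval, Store.write_apply]
      rw [if_neg (fun hc => (hi hc.1).1 hc.2)]
    · exact Store.write_of_ne_array _ _ _ _ (by omega)
    · simp [Tm.ev, Tm.eval]
  refine PolyRun.for (fun I j σ => IncSetup.Inv I a K j σ) IncSetup.K
    (fun I j σ h => ⟨h.bdd, h.ok.K σ fun i hi => h.frame 0 i (by omega) (by omega), h.ok.K_le⟩)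
    (fun I j σ v hv h => ⟨h.ok, h.bdd.write _ _ fun _ => hv, fun b i hb hi => ?_, fun i hi => ?_,
      fun i hi => ?_, ?_⟩) ?_ hK
  · rw [Store.write_apply, if_neg (fun hc => (hi hc.1).2 hc.2), h.frame b i hb hi]
  · rw [Store.write_of_ne_array _ _ _ _ (by omega), h.done i hi]
  · rw [Store.write_of_ne_array _ _ _ _ (by omega), h.todo i hi]
  · rw [Store.write_of_ne_index _ _ _ _ (by omega), h.carry]
  refine PolyRun.ifS (fun x σ h => h.2.1.bdd) ?_ (.nop ?_)
  · refine PolyRun.ifS (fun x σ h => h.1.2.1.bdd) (.set (fun x σ h => h.1.1.2.1.bdd) ?_)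
      (.seq (Mid := fun x σ => (x.2 < x.1.K ∧ σ 0 9 = x.2 ∧ Bdd x.1.M σ) ∧
        IncSetup.Inv x.1 a K (x.2 + 1) (σ.write 0 8 0))
        (.set (fun x σ h => h.1.1.2.1.bdd) ?_ (by simp [Tm.WF]) (by simp [Tm.WF, ha6]))
        (.set (fun x σ h => h.1.2.2) ?_)) ?_
    · rintro ⟨I, j⟩ σ ⟨⟨⟨hj, h, h9⟩, hc⟩, hd⟩
      simp only [Tm.ev, Tm.eval, h9] at hj h hc hd ⊢
      rw [ne_eq, ite_eq_right_iff, Classical.not_imp, h.todo j le_rfl, h.ok.digits j hj,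
        h.frame 0 4 (by omega) (by omega), h.ok.N] at hd
      have hcarry := h.carry
      have hdvd : I.N ^ j ∣ I.t + 1 := by
        by_contra hn
        rw [if_neg hn] at hcarry
        exact hc hcarry
      refine ⟨⟨h.ok, h.bdd.write _ _ fun _ => Nat.zero_le _, fun b i hb hi => ?_, fun i hi => ?_,
        fun i hi => ?_, ?_⟩, ?_⟩
      · rw [Store.write_of_ne_array _ _ _ _ hb, h.frame b i hb hi]
      · rcases Nat.lt_succ_iff_lt_or_eq.1 hi with hi | rfl
        · rw [Store.write_of_ne_index _ _ _ _ (by omega), h.done i hi]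
        · rw [Store.write_same, dig_succ h.ok.two_le, if_pos hdvd, if_pos hd.1]
      · rw [Store.write_of_ne_index _ _ _ _ (by omega), h.todo i (by omega)]
      · rw [Store.write_of_ne_array _ _ _ _ (by omega), hcarry, if_pos hdvd,
          if_pos ((pow_succ_dvd_succ h.ok.two_le _ _).2 ⟨hdvd, hd.1⟩)]
      · rw [Store.write_of_ne_array _ _ _ _ (by omega), h9]
    · rintro ⟨I, j⟩ σ ⟨⟨⟨hj, h, h9⟩, hc⟩, hd⟩
      simp only [Tm.ev, Tm.eval, h9] at hj h hc hd ⊢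
      rw [ite_eq_right_iff, h.todo j le_rfl, h.ok.digits j hj,
        h.frame 0 4 (by omega) (by omega), h.ok.N] at hd
      rw [h.todo j le_rfl, h.ok.digits j hj]
      have hd' : ¬ dig I.N I.t j + 1 = I.N := fun hh => by simpa using hd hh
      have hcarry := h.carry
      have hdvd : I.N ^ j ∣ I.t + 1 := by
        by_contra hn
        rw [if_neg hn] at hcarry
        exact hc hcarry
      have hle : dig I.N I.t j + 1 ≤ I.M := by
        have := dig_lt (N := I.N) (by have := h.ok.two_le; omega) I.t j
        have := h.ok.N_le
        omega
      refine ⟨⟨hj, ?_, h.bdd.write _ _ fun _ => hle⟩,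
        ⟨h.ok, (h.bdd.write _ _ fun _ => hle).write _ _ fun _ => Nat.zero_le _,
          fun b i hb hi => ?_, fun i hi => ?_, fun i hi => ?_, ?_⟩⟩
      · rw [Store.write_of_ne_array _ _ _ _ (by omega), h9]
      · rw [Store.write_apply, if_neg (fun hc => (hi hc.1).1 hc.2),
          Store.write_of_ne_array _ _ _ _ hb, h.frame b i hb hi]
      · rw [Store.write_of_ne_array _ _ _ _ (by omega)]
        rcases Nat.lt_succ_iff_lt_or_eq.1 hi with hi | rfl
        · rw [Store.write_of_ne_index _ _ _ _ (by omega), h.done i hi]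
        · rw [Store.write_same, dig_succ h.ok.two_le, if_pos hdvd, if_neg hd']
      · rw [Store.write_of_ne_array _ _ _ _ (by omega),
          Store.write_of_ne_index _ _ _ _ (by omega), h.todo i (by omega)]
      · rw [Store.write_same,
          if_neg (fun hh => hd' ((pow_succ_dvd_succ h.ok.two_le _ _).1 hh).2)]
    · rintro ⟨I, j⟩ σ ⟨⟨hj, h9, hb⟩, h⟩
      simp only [Tm.ev, Tm.eval]
      exact ⟨h, by rw [Store.write_of_ne_index _ _ _ _ (by omega), h9]⟩
    · simp [Tm.WF, ha6]
  · rintro ⟨I, j⟩ σ ⟨⟨hj, h, h9⟩, hc⟩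
    simp only [Tm.ev, Tm.eval] at hj h hc ⊢
    have hdvd : ¬ I.N ^ j ∣ I.t + 1 := by
      intro hn
      have hcarry := h.carry
      rw [if_pos hn] at hcarry
      omega
    refine ⟨⟨h.ok, h.bdd, h.frame, fun i hi => ?_, fun i hi => h.todo i (by omega), ?_⟩, h9⟩
    · rcases Nat.lt_succ_iff_lt_or_eq.1 hi with hi | rfl
      · exact h.done i hi
      · rw [h.todo i le_rfl, h.ok.digits i hj, dig_succ h.ok.two_le, if_neg hdvd]
    · rw [hc, if_neg (fun hh => hdvd ((pow_dvd_pow _ (by omega)).trans hh))]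

/-! ### Listing the blocks -/

/-- The edge relation as a term. -/
def edgeTm (t u : Tm) : Tm := .test 3 (.add (.mul t (.reg 4)) u)

/-- Whether the tuple in array `5` is a block for the nodes in array `4`. -/
def blockTm : Tm :=
  .and (.all (.reg 2) (.or (.not (.lt (.add (.var 0) (.lit 1)) (.reg 2)))
    (edgeTm (.arr 5 (.var 0)) (.arr 5 (.add (.var 0) (.lit 1))))))
  (.and (.all (.reg 2) (.all (.reg 2) (.or (.not (.eq (.arr 5 (.var 0)) (.arr 5 (.var 1))))
    (.eq (.var 0) (.var 1)))))
  (.ex (.reg 3) (.and (.eq (.arr 5 (.lit 0)) (.arr 4 (.var 0)))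
    (.or (.not (.lt (.add (.var 0) (.lit 1)) (.reg 3)))
      (edgeTm (.arr 5 (.pred (.reg 2))) (.arr 4 (.add (.var 0) (.lit 1))))))))

theorem blockTm_wf : blockTm.WF 0 := by simp [blockTm, edgeTm, Tm.WF]

theorem edgeTm_tr (t u : Tm) (q : ℕ) (ρ : ℕ → ℕ) (σ : Store) : (edgeTm t u).Tr q ρ σ ↔
    σ 3 (t.eval q ρ σ * σ 0 4 + u.eval q ρ σ) ≠ 0 := by
  simp [edgeTm, Tm.mul, Tm.eval]

theorem blockTm_tr {P : Par} {σ : Store} (h : Env P σ) {g w : ℕ → ℕ}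
    (hg : ∀ i < P.k, σ 4 i = g i ∧ g i < P.N) (hw : ∀ i < P.l, σ 5 i = w i ∧ w i < P.N) :
    blockTm.Tr 0 (fun _ => 0) σ ↔ IsBlock P.E P.l P.k g w := by
  have hl := h.ok.l_pos
  have hE : ∀ u v, u < P.N → v < P.N → (σ 3 (u * P.N + v) = 0 ↔ ¬ P.E u v) := fun u v hu hv =>
    not_iff_not.1 (by rw [not_not]; exact h.mat u hu v hv)
  simp only [blockTm, Tm.tr_and, Tm.tr_all, Tm.tr_ex, Tm.tr_or, Tm.tr_not, Tm.tr_lt, Tm.tr_eq,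
    edgeTm_tr, Tm.eval, h.l, h.k, h.N, Function.update_self, zero_add, ne_eq,
    Function.update_of_ne (show (0 : ℕ) ≠ 1 by omega)]
  constructor
  · rintro ⟨h1, h2, i, hi, h3, h4⟩
    refine ⟨fun j hj hj' => ?_, fun j hj j' hj' he => ?_, i, hi, ?_, fun hi' => ?_⟩
    · have := (h1 j hj).resolve_left (not_not.2 hj')
      rw [(hw j hj).1, (hw _ hj').1, hE _ _ (hw j hj).2 (hw _ hj').2, not_not] at this
      exact this
    · have := h2 j hj j' hj'
      rw [(hw j hj).1, (hw j' hj').1] at this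
      exact this.resolve_left (not_not.2 he)
    · rw [← (hw 0 hl).1, ← (hg i hi).1, h3]
    · have := h4.resolve_left (not_not.2 hi')
      rw [(hw _ (show P.l - 1 < P.l by omega)).1, (hg _ hi').1,
        hE _ _ (hw _ (by omega)).2 (hg _ hi').2, not_not] at this
      exact this
  · intro hb
    obtain ⟨i, hi, h3, h4⟩ := hb.start
    refine ⟨fun j hj => ?_, fun j hj j' hj' => ?_, i, hi, ?_, ?_⟩
    · by_cases hj' : j + 1 < P.l
      · right
        rw [(hw j hj).1, (hw _ hj').1, hE _ _ (hw j hj).2 (hw _ hj').2, not_not]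
        exact hb.chain j hj hj'
      · exact .inl hj'
    · rw [(hw j hj).1, (hw j' hj').1]
      by_cases he : w j = w j'
      · exact .inr (hb.inj j hj j' hj' he)
      · exact .inl he
    · rw [(hw 0 hl).1, (hg i hi).1, h3]
    · by_cases hi' : i + 1 < P.k
      · right
        rw [(hw _ (show P.l - 1 < P.l by omega)).1, (hg _ hi').1,
          hE _ _ (hw _ (by omega)).2 (hg _ hi').2, not_not]
        exact h4 hi'
      · exact .inl hi'

/-- The entry for node `x` in the row of the current tuple. -/
def rowTm : Tm := .bool (.ex (.reg 2) (.eq (.arr 5 (.var 0)) (.reg 13)))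

/-- The position in the incidence matrix of the current entry. -/
def posTm : Tm := .add (.mul (.reg 6) (.reg 4)) (.reg 13)

/-- Append the current tuple to the incidence matrix. -/
def appendRow : Prog :=
  .seq (forS 13 (.reg 4) (.seq (set 6 posTm rowTm) (set 21 posTm rowTm)))
    (set 0 (.lit 6) (.add (.reg 6) (.lit 1)))

/-- Write the incidence matrix of the blocks. -/
def build : Prog :=
  .seq (set 0 (.lit 6) (.lit 0)) (.seq (set 0 (.lit 8) (.lit 0))
    (whileS (.eq (.reg 8) (.lit 0))
      (.seq (ifS blockTm appendRow .nop) (increment 5 (.add (.reg 2) (.lit 2))))))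

/-- The situation in which the blocks are listed. -/
structure Build where
  P : Par
  σ₀ : Store
  g : ℕ

/-- The requirements for listing the blocks. -/
structure Build.OK (B : Build) : Prop where
  env : Env B.P B.σ₀
  g : ∀ i < B.P.k, B.σ₀ 4 i = dig B.P.N B.g i
  w : ∀ i < B.P.l + 2, B.σ₀ 5 i = 0
  empty : ∀ i, B.σ₀ 21 i = 0

/-- The blocks with codes less than `T`. -/
noncomputable abbrev Build.codes (B : Build) (T : ℕ) : List ℕ :=
  blockCodes B.P.E B.P.N B.P.l B.P.k (dig B.P.N B.g) T

/-- What does not change while the blocks are listed. -/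
structure Build.Frame (B : Build) (σ : Store) : Prop where
  ok : B.OK
  bdd : Bdd B.P.M σ
  frame : ∀ b i, b ≠ 5 → b ≠ 6 → b ≠ 21 → (b = 0 → i < 6) → σ b i = B.σ₀ b i

open Classical in
/-- The first `c` entries of the incidence matrix have been written. -/
def Rows (N l : ℕ) (L : List ℕ) (c : ℕ) (σ : Store) : Prop :=
  (∀ i, σ 21 i = if i < c ∧ InRow N l L (i / N) (i % N) then 1 else 0) ∧
    ∀ i < c, σ 6 i = if InRow N l L (i / N) (i % N) then 1 else 0

/-- The invariant of the loop over the codes of tuples. -/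
structure Build.Inv (B : Build) (T : ℕ) (σ : Store) : Prop extends B.Frame σ where
  le : T ≤ B.P.N ^ (B.P.l + 2)
  w : ∀ i < B.P.l + 2, σ 5 i = dig B.P.N T i
  m : σ 0 6 = (B.codes T).length
  rows : Rows B.P.N B.P.l (B.codes T) ((B.codes T).length * B.P.N) σ
  carry : σ 0 8 = if T = B.P.N ^ (B.P.l + 2) then 1 else 0

/-- The situation after the current tuple has been treated. -/
structure Build.Mid (B : Build) (T : ℕ) (σ : Store) : Prop extends B.Frame σ where
  lt : T < B.P.N ^ (B.P.l + 2)
  w : ∀ i < B.P.l + 2, σ 5 i = dig B.P.N T i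
  m : σ 0 6 = (B.codes (T + 1)).length
  rows : Rows B.P.N B.P.l (B.codes (T + 1)) ((B.codes (T + 1)).length * B.P.N) σ

/-- The invariant of the loop that writes a row. -/
structure Build.RowInv (B : Build) (T : ℕ) (c : ℕ) (σ : Store) : Prop extends B.Frame σ where
  lt : T < B.P.N ^ (B.P.l + 2)
  w : ∀ i < B.P.l + 2, σ 5 i = dig B.P.N T i
  m : σ 0 6 = (B.codes T).length
  codes : B.codes (T + 1) = B.codes T ++ [T]
  rows : Rows B.P.N B.P.l (B.codes T ++ [T]) ((B.codes T).length * B.P.N + c) σ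

theorem Build.Frame.env {B : Build} {σ : Store} (h : B.Frame σ) : Env B.P σ :=
  h.ok.env.congr h.bdd (fun i hi => h.frame 0 i (by omega) (by omega) (by omega) fun _ => hi)
    fun i => h.frame 3 i (by omega) (by omega) (by omega) (by omega)

theorem Build.Frame.write {B : Build} {σ : Store} (h : B.Frame σ) (a i : ℕ) {v : ℕ}
    (hv : a < 6 → v ≤ B.P.M) (ha : (a = 0 ∧ 6 ≤ i) ∨ a = 6 ∨ a = 21) :
    B.Frame (σ.write a i v) where
  ok := h.ok
  bdd := h.bdd.write _ _ hv
  frame b j h5 h6 h21 h0 := by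
    rw [Store.write_apply, if_neg (by omega), h.frame b j h5 h6 h21 h0]

theorem Build.codes_length_le (B : Build) (T : ℕ) : (B.codes T).length ≤ T :=
  blockCodes_length_le _ _ _ _ _ _

theorem blockCodes_succ_of_isBlock {E : ℕ → ℕ → Prop} {N l k : ℕ} {g : ℕ → ℕ} {T : ℕ}
    (h : IsBlock E l k g (dig N T)) :
    blockCodes E N l k g (T + 1) = blockCodes E N l k g T ++ [T] := by
  classical
  simp [blockCodes, List.range_succ, h]

theorem blockCodes_succ_of_not_isBlock {E : ℕ → ℕ → Prop} {N l k : ℕ} {g : ℕ → ℕ} {T : ℕ}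
    (h : ¬ IsBlock E l k g (dig N T)) :
    blockCodes E N l k g (T + 1) = blockCodes E N l k g T := by
  classical
  simp [blockCodes, List.range_succ, h]

theorem inRow_append_of_lt {N l : ℕ} {L : List ℕ} {T j x : ℕ} (hj : j < L.length) :
    InRow N l (L ++ [T]) j x ↔ InRow N l L j x := by
  simp [InRow, hj, List.getElem_append_left, Nat.lt_succ_of_lt hj]

theorem inRow_append_length {N l : ℕ} {L : List ℕ} {T x : ℕ} :
    InRow N l (L ++ [T]) L.length x ↔ InBlock N l T x := by
  simp [InRow]

theorem Rows.append {N l : ℕ} {L : List ℕ} {σ : Store} (T : ℕ)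
    (h : Rows N l L (L.length * N) σ) : Rows N l (L ++ [T]) (L.length * N + 0) σ := by
  classical
  have key : ∀ i, i < L.length * N → (InRow N l (L ++ [T]) (i / N) (i % N) ↔
      InRow N l L (i / N) (i % N)) := fun i hi =>
    inRow_append_of_lt (Nat.div_lt_of_lt_mul (by rwa [mul_comm]))
  rw [add_zero]
  constructor
  · intro i
    rw [h.1 i]
    exact if_congr (and_congr_right fun hi => (key i hi).symm) rfl rfl
  · intro i hi
    rw [h.2 i hi]
    exact if_congr (key i hi).symm rfl rfl

theorem Rows.congr {N l : ℕ} {L : List ℕ} {c : ℕ} {σ σ' : Store} (h : Rows N l L c σ)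
    (h6 : ∀ i, σ' 6 i = σ 6 i) (h21 : ∀ i, σ' 21 i = σ 21 i) : Rows N l L c σ' :=
  ⟨fun i => (h21 i).trans (h.1 i), fun i hi => (h6 i).trans (h.2 i hi)⟩

theorem posTm_eval (q : ℕ) (ρ : ℕ → ℕ) (σ : Store) :
    posTm.eval q ρ σ = σ 0 6 * σ 0 4 + σ 0 13 := by
  simp [posTm, Tm.mul, Tm.eval]

/-- The matrix is written twice, since the given program may overwrite its input in array `21`; the
copy in array `6` serves to check the answer. Array `21` is prescribed at all cells because the
input must be exact, array `6` only as far as it has been written, so that remnants from earlier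
guesses do no harm. -/
theorem appendRow_polyRun : PolyRun (fun x : Build × ℕ => x.1.P.M) appendRow
    (fun x σ => x.1.Inv x.2 σ ∧ x.2 < x.1.P.N ^ (x.1.P.l + 2) ∧
      IsBlock x.1.P.E x.1.P.l x.1.P.k (dig x.1.P.N x.1.g) (dig x.1.P.N x.2))
    (fun x σ => x.1.Mid x.2 σ) := by
  classical
  refine PolyRun.seq (Mid := fun x σ => x.1.RowInv x.2 x.1.P.N σ)
    ((PolyRun.for (fun x c σ => Build.RowInv x.1 x.2 c σ) (fun x => x.1.P.N) ?_ ?_ ?_).mono ?_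
      fun _ _ h => h) (.set (fun x σ h => h.bdd) ?_)
  · exact fun x c σ h => ⟨h.bdd, h.env.N, h.env.ok.N_le⟩
  · intro x c σ v hv h
    exact ⟨h.toFrame.write _ _ (fun _ => hv) (by omega), h.lt,
      fun i hi => (Store.write_of_ne_array _ _ _ _ (by omega)).trans (h.w i hi),
      (Store.write_of_ne_index _ _ _ _ (by omega)).trans h.m, h.codes,
      h.rows.congr (fun i => Store.write_of_ne_array _ _ _ _ (by omega))
        fun i => Store.write_of_ne_array _ _ _ _ (by omega)⟩
  · have hrow : ∀ (B : Build) (T c : ℕ) (σ : Store), B.RowInv T c σ → σ 0 13 = c →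
        rowTm.ev σ = if InBlock B.P.N B.P.l T c then 1 else 0 := by
      intro B T c σ h hc
      rw [rowTm, Tm.ev, Tm.eval_bool]
      refine if_congr ?_ rfl rfl
      simp only [Tm.tr_ex, Tm.tr_eq, Tm.eval, h.env.l, Function.update_self, hc, InBlock]
      exact exists_congr fun i => and_congr_right fun hi => by rw [h.w i (by omega)]
    refine PolyRun.seq (Mid := fun x σ => (x.2 < x.1.1.P.N ∧ x.1.1.RowInv x.1.2 x.2 σ ∧
        σ 0 13 = x.2) ∧ σ 6 ((x.1.1.codes x.1.2).length * x.1.1.P.N + x.2) =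
        if InBlock x.1.1.P.N x.1.1.P.l x.1.2 x.2 then 1 else 0)
      (.set (fun x σ h => h.2.1.bdd) ?_ (by simp [Tm.WF, posTm]) (by simp [Tm.WF, rowTm]))
      (.set (fun x σ h => h.1.2.1.bdd) ?_ (by simp [Tm.WF, posTm]) (by simp [Tm.WF, rowTm]))
    · rintro ⟨⟨B, T⟩, c⟩ σ ⟨hc, h, h13⟩
      have hr := hrow B T c σ h h13
      dsimp only at hc h h13 ⊢
      rw [hr, Tm.ev, posTm_eval]
      rw [h.m, h.env.N, h13]
      refine ⟨⟨hc, ⟨h.toFrame.write _ _ (fun hh => absurd hh (by omega)) (by omega), h.lt,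
        fun i hi => ?_, ?_, h.codes, ⟨fun i => ?_, fun i hi => ?_⟩⟩, ?_⟩, Store.write_same _ _ _ _⟩
      · rw [Store.write_of_ne_array _ _ _ _ (by omega), h.w i hi]
      · rw [Store.write_of_ne_array _ _ _ _ (by omega), h.m]
      · rw [Store.write_of_ne_array _ _ _ _ (by omega), h.rows.1]
      · rw [Store.write_of_ne_index _ _ _ _ (by omega), h.rows.2 i hi]
      · rw [Store.write_of_ne_array _ _ _ _ (by omega), h13]
    · rintro ⟨⟨B, T⟩, c⟩ σ ⟨⟨hc, h, h13⟩, h6⟩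
      have hr := hrow B T c σ h h13
      dsimp only at hc h h13 h6 ⊢
      rw [hr, Tm.ev, posTm_eval]
      rw [h.m, h.env.N, h13]
      have hN : 0 < B.P.N := by have := h.env.ok.two_le; omega
      have hbit : InRow B.P.N B.P.l (B.codes T ++ [T])
          (((B.codes T).length * B.P.N + c) / B.P.N) (((B.codes T).length * B.P.N + c) % B.P.N) ↔
          InBlock B.P.N B.P.l T c := by
        rw [Nat.mul_add_mod', Nat.mod_eq_of_lt hc, mul_comm, Nat.mul_add_div hN,
          Nat.div_eq_of_lt hc, add_zero]
        exact inRow_append_length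
      refine ⟨⟨h.toFrame.write _ _ (fun hh => absurd hh (by omega)) (by omega), h.lt,
        fun i hi => ?_, ?_, h.codes, ⟨fun i => ?_, fun i hi => ?_⟩⟩, ?_⟩
      · rw [Store.write_of_ne_array _ _ _ _ (by omega), h.w i hi]
      · rw [Store.write_of_ne_array _ _ _ _ (by omega), h.m]
      · by_cases hi : i = (B.codes T).length * B.P.N + c
        · rw [hi, Store.write_same]
          exact if_congr (by rw [hbit, and_iff_right (by omega)]) rfl rfl
        · rw [Store.write_of_ne_index _ _ _ _ hi, h.rows.1]
          exact if_congr (and_congr_left fun _ => by omega) rfl rfl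
      · rw [Store.write_of_ne_array _ _ _ _ (by omega)]
        by_cases hi' : i = (B.codes T).length * B.P.N + c
        · rw [hi', h6]
          exact if_congr hbit.symm rfl rfl
        · exact h.rows.2 i (by omega)
      · rw [Store.write_of_ne_array _ _ _ _ (by omega), h13]
  · rintro ⟨B, T⟩ σ ⟨h, hT, hb⟩
    exact ⟨h.toFrame, hT, h.w, h.m, blockCodes_succ_of_isBlock hb, h.rows.append T⟩
  · rintro ⟨B, T⟩ σ h
    have hlen : (B.codes (T + 1)).length = (B.codes T).length + 1 := by
      rw [h.codes, List.length_append, List.length_singleton]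
    simp only [Tm.ev, Tm.eval, h.m] at h ⊢
    refine ⟨h.toFrame.write _ _ (fun _ => ?_) (by omega), h.lt, fun i hi => ?_, ?_, ?_⟩
    · rw [← hlen]
      exact (B.codes_length_le _).trans ((Nat.succ_le_of_lt h.lt).trans h.env.ok.codes_le)
    · rw [Store.write_of_ne_array _ _ _ _ (by omega), h.w i hi]
    · rw [Store.write_same, hlen]
    · rw [hlen, h.codes, add_mul, one_mul]
      exact h.rows.congr (fun i => Store.write_of_ne_array _ _ _ _ (by omega))
        fun i => Store.write_of_ne_array _ _ _ _ (by omega)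

/-- The tuple in array `5` runs through the codes in increasing order, which is the order of
`blockCodes`, so each round appends at most one row. There are `N ^ (l + 2)` rounds; this is
polynomial in `M` because `M` is chosen to exceed `N ^ (l + 3)`. -/
theorem build_polyRun : PolyRun (fun B : Build => B.P.M) build (fun B σ => B.OK ∧ σ = B.σ₀)
    (fun B σ => B.Inv (B.P.N ^ (B.P.l + 2)) σ) := by
  classical
  have hframe : ∀ {B : Build}, B.OK → B.Frame B.σ₀ := fun h =>
    ⟨h, h.env.bdd, fun _ _ _ _ _ _ => rfl⟩
  refine PolyRun.seq (Mid := fun B σ => B.OK ∧ σ = B.σ₀.write 0 6 0)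
    (.set (fun B σ h => h.2 ▸ h.1.env.bdd) ?_)
    (.seq (Mid := fun B σ => B.Inv 0 σ) (.set (fun B σ h => ?_) ?_) ?_)
  · rintro B _ ⟨h, rfl⟩
    exact ⟨h, rfl⟩
  · rw [h.2]
    exact h.1.env.bdd.write _ _ fun _ => Nat.zero_le _
  · rintro B _ ⟨h, rfl⟩
    have hN := h.env.ok.two_le
    have hcodes : B.codes 0 = [] := rfl
    refine ⟨((hframe h).write _ _ (fun _ => Nat.zero_le _) (by omega)).write _ _
      (fun _ => Nat.zero_le _) (Or.inl ⟨rfl, ?_⟩), Nat.zero_le _, fun i hi => ?_, ?_,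
      ⟨fun i => ?_, fun i hi => ?_⟩, ?_⟩
    · simp [Tm.ev, Tm.eval]
    · simp [Tm.ev, Tm.eval, Store.write_apply, h.w i hi, dig_zero]
    · simp [Tm.ev, Tm.eval, Store.write_apply, hcodes]
    · simp [Tm.ev, Tm.eval, Store.write_apply, hcodes, h.empty]
    · rw [hcodes] at hi; simp at hi
    · have : (0 : ℕ) ≠ B.P.N ^ (B.P.l + 2) := by positivity
      simp [Tm.ev, Tm.eval, this]
  refine PolyRun.while (fun B T σ => Build.Inv B T σ) (fun B => B.P.N ^ (B.P.l + 2))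
    (fun B T σ h => h.bdd) ?_ ?_
  · intro B T hT σ h
    refine ⟨h.env.ok.codes_le, ?_⟩
    simp only [Tm.ev, Tm.eval, h.carry]
    split_ifs with h1 h2 h2
    · simp at h2
    · simp [h1]
    · simp only [ne_eq, one_ne_zero, not_false_eq_true, true_iff]; omega
    · simp at h2
  refine PolyRun.seq (Mid := fun x σ => x.1.Mid x.2 σ)
    (.ifS (fun x σ h => h.2.bdd) ?_ (.nop ?_) blockTm_wf) ?_
  · refine appendRow_polyRun.mono ?_ fun _ _ h => h
    rintro ⟨B, T⟩ σ ⟨⟨hT, h⟩, hb⟩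
    dsimp only at hT h
    refine ⟨h, hT, ?_⟩
    have hN : 0 < B.P.N := by have := h.env.ok.two_le; omega
    refine (blockTm_tr h.env (g := dig B.P.N B.g) (w := dig B.P.N T)
      (fun i hi => ⟨?_, dig_lt hN _ _⟩) fun i hi => ⟨h.w i (by omega), dig_lt hN _ _⟩).1 hb
    rw [h.frame 4 i (by omega) (by omega) (by omega) (by omega), h.ok.g i hi]
  · rintro ⟨B, T⟩ σ ⟨⟨hT, h⟩, hb⟩
    dsimp only at hT h
    have hN : 0 < B.P.N := by have := h.env.ok.two_le; omega
    rw [Tm.ev_eq_zero, blockTm_tr h.env (g := dig B.P.N B.g) (w := dig B.P.N T)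
      (fun i hi => ⟨?_, dig_lt hN _ _⟩)
      fun i hi => ⟨h.w i (by omega), dig_lt hN _ _⟩] at hb
    · have hcodes : B.codes (T + 1) = B.codes T := blockCodes_succ_of_not_isBlock hb
      exact ⟨h.toFrame, hT, h.w, by rw [hcodes]; exact h.m, by rw [hcodes]; exact h.rows⟩
    · rw [h.frame 4 i (by omega) (by omega) (by omega) (by omega), h.ok.g i hi]
  · obtain ⟨κ, hκ⟩ := increment_polyRun (a := 5) (by omega) (by omega)
      (K := .add (.reg 2) (.lit 2)) (by simp [Tm.WF])
    refine ⟨κ, fun R x σ hM h => ?_⟩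
    obtain ⟨B, T⟩ := x
    dsimp only at hM h ⊢
    refine (hκ R ⟨σ, B.P.M, B.P.N, B.P.l + 2, T⟩ σ hM ⟨⟨h.bdd, h.env.ok.two_le, h.env.ok.N_le,
      h.env.ok.l_le, h.env.N, fun σ' h' => ?_, h.w⟩, rfl⟩).mono le_rfl fun σ' h' => ?_
    · simp only [Tm.ev, Tm.eval, h' 2 (by omega), h.env.l]
    · have hdvd : B.P.N ^ (B.P.l + 2) ∣ T + 1 ↔ T + 1 = B.P.N ^ (B.P.l + 2) :=
        ⟨fun hd => le_antisymm h.lt (Nat.le_of_dvd (by omega) hd), fun he => he ▸ dvd_rfl⟩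
      have hfr := h'.frame
      dsimp only at hfr
      refine ⟨⟨h.ok, h'.bdd, fun b i h5 h6 h21 h0 => ?_⟩, h.lt, h'.done, ?_, ?_, ?_⟩
      · rw [hfr b i h5 (fun hb => by have := h0 hb; omega), h.frame b i h5 h6 h21 h0]
      · rw [hfr 0 6 (by omega) (by omega), h.m]
      · exact h.rows.congr (fun i => hfr 6 i (by omega) (by omega))
          fun i => hfr 21 i (by omega) (by omega)
      · rw [h'.carry]
        exact if_congr hdvd rfl rfl

/-! ### Filling the tank -/

/-- Repeated doubling of cell `0` of the stack. -/
def doubling : Prog :=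
  .loop (stk 2) (.seq (.assign 9 (.lit 1) (stk 0)) (.seq (transfer 0 1)
    (.assign 9 (.lit 2) (.pred (stk 2)))))

/-- Provide `2 ^ e` units of fuel, where `e` is the content of register `5`. -/
def fillTank : Prog :=
  .seq (.assign 9 (.lit 0) (.lit 1)) (.seq (.assign 9 (.lit 2) (.get 0 (.lit 5)))
    (.seq doubling (.assign 10 (.lit 0) (stk 0))))

/-- A doubling of `f` takes `3 * f + 4` steps, and the times form a geometric series; the summand `3
* f` on the left makes the bound telescope. -/
theorem doubling_exec (R : ℕ → Bool) : ∀ (r f : ℕ) (s : Store), s 9 2 = r → s 9 0 = f →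
    ∃ s' t, Exec R doubling s s' t ∧ t + 3 * f ≤ 3 * (f * 2 ^ r) + 4 * r + 1 ∧ s' 9 0 = f * 2 ^ r ∧
      ∀ a, a ≠ 9 → ∀ i, s' a i = s a i := by
  intro r
  induction r with
  | zero =>
    intro f s h2 h0
    exact ⟨s, 1, .loop_false (by simpa [Expr.eval] using h2), by omega, by simpa using h0,
      fun _ _ _ => rfl⟩
  | succ r ih =>
    intro f s h2 h0
    have e1 := Exec.assign (R := R) 9 (.lit 1) (stk 0) s
    have e2 := transfer_exec R (x := 0) (y := 1) (by omega) (s 9 0) (s.write 9 1 (s 9 0))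
      (Store.write_same _ _ _ _)
    rw [Store.write_of_ne_index _ _ _ _ (by omega)] at e2
    set s₂ := ((s.write 9 1 (s 9 0)).write 9 0 (s 9 0 + s 9 0)).write 9 1 0 with hs₂
    have e3 := Exec.assign (R := R) 9 (.lit 2) (.pred (stk 2)) s₂
    obtain ⟨s', t, k1, k2, k3, k4⟩ := ih (2 * f) (s₂.write 9 2 (s₂ 9 2 - 1))
      (by simp [hs₂, Store.write_apply, h2]) (by simp [hs₂, Store.write_apply, h0]; omega)
    refine ⟨s', _, .loop_true (by simp [Expr.eval, h2]) (.seq e1 (.seq e2 e3)) k1, ?_, ?_,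
      fun a ha i => ?_⟩
    · have h3 : f * 2 ^ (r + 1) = 2 * f * 2 ^ r := by rw [pow_succ]; ring
      rw [h3, h0]
      omega
    · rw [k3, pow_succ]; ring
    · rw [k4 a ha, Store.write_of_ne_array _ _ _ _ ha, hs₂, Store.write_of_ne_array _ _ _ _ ha,
        Store.write_of_ne_array _ _ _ _ ha, Store.write_of_ne_array _ _ _ _ ha]

/-- The time `2 ^ e` is not meant to be polynomial in `M`, so this is not a `PolyRun`. The fuel is
in array `10`, to which the bound `M` for numbers in memory does not apply. -/
theorem fillTank_run (R : ℕ → Bool) (σ : Store) :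
    Run R fillTank σ (3 * 2 ^ σ 0 5 + 4 * σ 0 5 + 4)
      (fun σ' => σ' = σ.write 10 0 (2 ^ σ 0 5)) := by
  intro s hs
  have h05 : s 0 5 = σ 0 5 := hs 0 (by omega) (by omega) 5
  obtain ⟨s', t, h1, h2, h3, h4⟩ := doubling_exec R (σ 0 5) 1
    ((s.write 9 0 1).write 9 2 (σ 0 5)) (Store.write_same _ _ _ _)
    (by simp [Store.write_apply])
  have e2 := Exec.assign (R := R) 9 (.lit 2) (.get 0 (.lit 5)) (s.write 9 0 1)
  simp only [Expr.eval] at e2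
  rw [Store.write_of_ne_array _ _ _ _ (by omega), h05] at e2
  refine ⟨_, _, _, .seq (.assign _ _ _ _) (.seq e2 (.seq h1 (.assign _ _ _ _))), ?_, ?_, rfl⟩
  · simp only [Expr.eval, h3, one_mul]
    refine Agree.write (fun a h8 h9 i => ?_) _ _ _
    rw [h4 a h9, Store.write_of_ne_array _ _ _ _ h9, Store.write_of_ne_array _ _ _ _ h9]
    exact hs a h8 h9 i
  · omega

/-! ### Running the given program -/

theorem clock_run (p : Prog) : ∃ K, ∀ R σ, Run R p.clock σ (K * (σ 10 0 + 1)) (fun σ' =>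
    ClockFrame p.width σ σ' ∧ σ' 12 0 ≤ σ 12 0 + K * (σ 10 0 + 1) ∧
      ∀ r τ, Exec R p σ.high r τ → τ ≤ σ 10 0 → σ'.high = r) := by
  obtain ⟨K, hK⟩ := clock_spec p
  refine ⟨K, fun R σ s hs => ?_⟩
  obtain ⟨s', t, h1, h2, h3, h4, h5⟩ := hK R s
  have hA : ∀ {a}, a ≠ 8 → a ≠ 9 → s a = σ a := fun h8 h9 => funext (hs _ h8 h9)
  have hhigh : s.high = σ.high := funext fun a => hA (by omega) (by omega)
  rw [hA (a := 10) (by omega) (by omega)] at h2 h5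
  rw [hA (a := 12) (by omega) (by omega)] at h3
  rw [hhigh] at h5
  -- The scratch arrays of `σ` are put back into the result, so that the frame condition holds for
  -- these arrays as well.
  obtain ⟨σ', hσ, hp⟩ : ∃ σ' : Store, (∀ a, a = 8 ∨ a = 9 → σ' a = σ a) ∧
      ∀ {a}, a ≠ 8 → a ≠ 9 → σ' a = s' a :=
    ⟨fun a => if a = 8 ∨ a = 9 then σ a else s' a, fun a h => if_pos h,
      fun h8 h9 => if_neg (by omega)⟩
  refine ⟨s', σ', t, h1, fun a h8 h9 i => by rw [hp h8 h9], h2,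
    ⟨fun a ha h10 h11 h12 i => ?_, ?_, ?_, fun l hl => ?_, fun a i ha hne => ?_⟩, ?_, ?_⟩
  · by_cases h : a = 8 ∨ a = 9
    · rw [hσ a h]
    · rw [hp (by omega) (by omega), h4.low a ha h10 h11 h12, hA (by omega) (by omega)]
  · rw [hp (by omega) (by omega), ← hA (by omega) (by omega)]; exact h4.fuel
  · rw [hp (by omega) (by omega), ← hA (by omega) (by omega)]; exact h4.top
  · rw [hp (by omega) (by omega), ← hA (by omega) (by omega)]
    rw [← hA (by omega) (by omega)] at hl
    exact h4.log l hl
  · rw [hp (by omega) (by omega), ← hA (by omega) (by omega)] at hne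
    obtain ⟨g1, l, g2, g3⟩ := h4.high a i ha hne
    exact ⟨g1, l, by rwa [hp (by omega) (by omega)], by rwa [hp (by omega) (by omega)]⟩
  · rw [hp (by omega) (by omega)]; omega
  · intro r τ hr hτ
    rw [← h5 r τ hr hτ]
    funext a
    exact hp (by omega) (by omega)

theorem clearLog_run (R : ℕ → Bool) (A : ℕ) (σ : Store) :
    Run R (clearLog A) σ (σ 12 0 * (A + 3) + 1) (fun σ' => σ' 12 0 = 0 ∧
      (∀ a < 20, a ≠ 8 → a ≠ 9 → a ≠ 12 → ∀ i, σ' a i = σ a i) ∧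
      (∀ a i, 20 ≤ a → σ' a i = σ a i ∨ σ' a i = 0) ∧
      (∀ a i, 20 ≤ a → a < A + 20 → (∃ l < σ 12 0, σ 11 l = i) → σ' a i = 0)) := by
  refine Run.of_exec fun s hs => ?_
  obtain ⟨s', h1, h2, h3, h4, h5⟩ := clearLog_exec R A _ s (hs 12 (by omega) (by omega) 0)
  refine ⟨s', _, h1, le_rfl, h2, fun a ha h8 h9 h12 i => ?_, fun a i ha => ?_,
    fun a i ha hA hl => h5 a i ha hA ?_⟩
  · rw [h3 a ha h12, hs a h8 h9]
  · rw [← hs a (by omega) (by omega)]; exact h4 a i ha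
  · obtain ⟨l, hl, hi⟩ := hl
    exact ⟨l, hl, (hs 11 (by omega) (by omega) l).trans hi⟩

/-! ### Checking the answer -/

/-- Whether the answer is a cover that consists of `k` sets. -/
def acceptTm : Tm :=
  .and (.eq (.sum (.reg 6) (.test 22 (.var 0))) (.reg 3))
    (.all (.reg 4) (.ex (.reg 6) (.and (.test 22 (.var 1))
      (.test 6 (.add (.mul (.var 1) (.reg 4)) (.var 0))))))

/-- The answer is a cover that consists of `k` sets. -/
def Accepts (P : Par) (L : List ℕ) (s : Store) : Prop :=
  (blockInst P.N P.l L).IsCover ((blockInst P.N P.l L).answer s) ∧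
    ((blockInst P.N P.l L).answer s).card = P.k

open Classical in
/-- The incidence matrix in array `6`. -/
def RowCopy (P : Par) (L : List ℕ) (σ : Store) : Prop :=
  σ 0 6 = L.length ∧
    ∀ i < L.length * P.N, σ 6 i = if InRow P.N P.l L (i / P.N) (i % P.N) then 1 else 0

/-- The answer is array `2` of the given program, which is array `22` here. Its numbers are not
bounded by `M`, but only whether they vanish matters, and `test` may read them. -/
theorem acceptTm_tr {P : Par} {L : List ℕ} {σ : Store} (h : Env P σ) (hr : RowCopy P L σ) :
    acceptTm.Tr 0 (fun _ => 0) σ ↔ Accepts P L σ.high := by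
  classical
  have hcard : ∑ j ∈ Finset.range L.length, (if σ 22 j = 0 then 0 else 1) =
      ((blockInst P.N P.l L).answer σ.high).card := by
    rw [SetCoverInst.answer, Finset.card_filter, Finset.sum_range]
    refine Finset.sum_congr rfl fun j _ => ?_
    by_cases hj : σ 22 j = 0
    · exact (if_pos hj).trans (if_neg (not_not.2 hj)).symm
    · exact (if_neg hj).trans (if_pos hj).symm
  have hN : 0 < P.N := by have := h.ok.two_le; omega
  have hmem : ∀ j < L.length, ∀ x < P.N, (σ 6 (j * P.N + x) ≠ 0 ↔ InRow P.N P.l L j x) := by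
    intro j hj x hx
    rw [hr.2 _ (block_index_lt hj hx), Nat.mul_add_mod', Nat.mod_eq_of_lt hx, mul_comm,
      Nat.mul_add_div hN, Nat.div_eq_of_lt hx, add_zero]
    simp
  simp only [acceptTm, Tm.tr_and, Tm.tr_eq, Tm.tr_all, Tm.tr_ex, Tm.tr_test, Tm.eval, Tm.mul,
    hr.1, h.k, h.N, Function.update_self, Function.update_of_ne (show (0 : ℕ) ≠ 1 by omega),
    zero_add, Finset.sum_const, Finset.card_range, smul_eq_mul, hcard]
  rw [Accepts, and_comm]
  refine and_congr_left fun _ => ⟨fun hc x => ?_, fun hc x hx => ?_⟩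
  · obtain ⟨j, hj, h1, h2⟩ := hc x x.2
    exact ⟨⟨j, hj⟩, Finset.mem_filter.2 ⟨Finset.mem_univ _, h1⟩,
      mem_blockInst.2 ((hmem j hj x x.2).1 h2)⟩
  · obtain ⟨j, hj, h1⟩ := hc ⟨x, hx⟩
    exact ⟨j, j.2, (Finset.mem_filter.1 hj).2, (hmem j j.2 x hx).2 (mem_blockInst.1 h1)⟩

/-- Report success if the answer passes the check. -/
def checkAnswer : Prog := ifS acceptTm (set 2 (.lit 0) (.lit 1)) .nop

theorem checkAnswer_polyRun : PolyRun (fun x : Par × List ℕ × Store => x.1.M) checkAnswer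
    (fun x σ => Env x.1 σ ∧ RowCopy x.1 x.2.1 σ ∧ σ = x.2.2)
    (fun x σ => (Accepts x.1 x.2.1 x.2.2.high ∧ σ = x.2.2.write 2 0 1) ∨
      (¬ Accepts x.1 x.2.1 x.2.2.high ∧ σ = x.2.2)) := by
  refine PolyRun.ifS (fun x σ h => h.1.bdd) (.set (fun x σ h => h.1.1.bdd) ?_) (.nop ?_)
    (by simp [acceptTm, Tm.WF])
  · rintro ⟨P, L, σ₀⟩ σ ⟨⟨h1, h2, rfl⟩, h⟩
    exact .inl ⟨(acceptTm_tr h1 h2).1 h, rfl⟩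
  · rintro ⟨P, L, σ₀⟩ σ ⟨⟨h1, h2, rfl⟩, h⟩
    exact .inr ⟨fun hc => (Tm.ev_eq_zero _ _).1 h ((acceptTm_tr h1 h2).2 hc), rfl⟩

/-! ### Clearing the input of the given program -/

/-- Clear the cells which the input may occupy. -/
def clearInput (A : ℕ) : Prog :=
  forS 14 (.add (.mul (.reg 6) (.reg 4)) (.lit 2)) (clearAt (.get 0 (.lit 14)) A)

/-- The invariant of the loop in `clearInput`. -/
structure ClearInv (A : ℕ) (P : Par) (m : ℕ) (σ₀ : Store) (j : ℕ) (σ : Store) : Prop where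
  env : Env P σ₀
  m_eq : σ₀ 0 6 = m
  m_le : m ≤ P.N ^ (P.l + 2)
  bdd : Bdd P.M σ
  low : ∀ a < 20, a ≠ 8 → a ≠ 9 → ∀ i, (a = 0 → i ≠ 14) → σ a i = σ₀ a i
  high : ∀ a i, 20 ≤ a → σ a i = if a < A + 20 ∧ i < j then 0 else σ₀ a i

/-- Indices below `m * N + 2` comprise the matrix and the two cells for the numbers of elements and
sets. -/
theorem clearInput_polyRun (A : ℕ) : PolyRun (fun x : Par × ℕ × Store => x.1.M) (clearInput A)
    (fun x σ => Env x.1 σ ∧ σ 0 6 = x.2.1 ∧ x.2.1 ≤ x.1.N ^ (x.1.l + 2) ∧ σ = x.2.2)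
    (fun x σ => ClearInv A x.1 x.2.1 x.2.2 (x.2.1 * x.1.N + 2) σ) := by
  refine (PolyRun.for (fun x j σ => ClearInv A x.1 x.2.1 x.2.2 j σ) (fun x => x.2.1 * x.1.N + 2)
    ?_ ?_ (.of_exec (A + 1) ?_) (by simp [Tm.WF])).mono ?_ fun _ _ h => h
  · rintro ⟨P, m, σ₀⟩ j σ h
    dsimp only at h
    refine ⟨h.bdd, ?_, ?_⟩
    · simp only [Tm.ev, Tm.mul, Tm.eval, h.low 0 (by omega) (by omega) (by omega) 6 (by omega),
        h.low 0 (by omega) (by omega) (by omega) 4 (by omega), h.m_eq, h.env.N, Finset.sum_const,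
        Finset.card_range, smul_eq_mul]
    · have h1 := h.env.ok.pow_le'
      have h2 := Nat.mul_le_mul_right P.N h.m_le
      dsimp only
      omega
  · rintro ⟨P, m, σ₀⟩ j σ v hv h
    refine ⟨h.env, h.m_eq, h.m_le, h.bdd.write _ _ fun _ => hv, fun a ha h8 h9 i hi => ?_,
      fun a i ha => ?_⟩
    · rw [Store.write_apply, if_neg (fun hc => hi hc.1 hc.2), h.low a ha h8 h9 i hi]
    · rw [Store.write_of_ne_array _ _ _ _ (by omega), h.high a i ha]
  · rintro R ⟨⟨P, m, σ₀⟩, j⟩ σ s ⟨hj, h, h14⟩ hs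
    dsimp only at hj h h14 ⊢
    have hs14 : s 0 14 = j := by rw [hs 0 (by omega) (by omega), h14]
    refine ⟨_, clearAt_exec (i := j) (fun A => ?_) A, ⟨h.env, h.m_eq, h.m_le, fun a ha i => ?_,
      fun a ha h8 h9 i hi => ?_, fun a i ha => ?_⟩, ?_⟩
    · simp only [Expr.eval]
      rw [Store.clear_low _ _ _ (by omega), hs14]
    · rw [Store.clear_low _ _ _ (by omega), hs a (by omega) (by omega)]
      exact h.bdd a ha i
    · rw [Store.clear_low _ _ _ ha, hs a h8 h9, h.low a ha h8 h9 i hi]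
    · rw [Store.clear, hs a (by omega) (by omega), h.high a i ha]
      split_ifs <;> first | rfl | omega
    · rw [Store.clear_low _ _ _ (by omega), hs14]
  · rintro ⟨P, m, σ₀⟩ σ ⟨h1, h2, h3, rfl⟩
    exact ⟨h1, h2, h3, h1.bdd, fun _ _ _ _ _ _ => rfl, fun a i ha => by simp⟩

theorem set_polyRun {a : ℕ} {t u : Tm} (ht : t.WF 0) (hu : u.WF 0) :
    PolyRun (fun x : ℕ × Store => x.1) (set a t u) (fun x σ => Bdd x.1 x.2 ∧ σ = x.2)
      (fun x σ => σ = x.2.write a (t.ev x.2) (u.ev x.2)) := by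
  refine PolyRun.set ?_ ?_ ht hu
  · rintro ⟨M, σ₀⟩ σ ⟨h, rfl⟩
    exact h
  · rintro ⟨M, σ₀⟩ σ ⟨h, rfl⟩
    rfl

/-! ### The main loop -/

/-- The given program finds a cover by `k` blocks with the fuel at hand. -/
def Success (p : Prog) (R : ℕ → Bool) (P : Par) (t : ℕ) : Prop :=
  ∃ s τ, Exec R p (blockInst P.N P.l (blockCodes P.E P.N P.l P.k (dig P.N t)
      (P.N ^ (P.l + 2)))).input s τ ∧ τ ≤ 2 ^ P.e ∧
    Accepts P (blockCodes P.E P.N P.l P.k (dig P.N t) (P.N ^ (P.l + 2))) s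

/-- The invariant of the loop over the guesses. -/
structure GuessInv (p : Prog) (R : ℕ → Bool) (P : Par) (t : ℕ) (σ : Store) : Prop where
  env : Env P σ
  g : ∀ i < P.k, σ 4 i = dig P.N t i
  w : ∀ i < P.l + 2, σ 5 i = 0
  empty : ∀ a i, 20 ≤ a → σ a i = 0
  top : σ 12 0 = 0
  carry : σ 0 8 = if t = P.N ^ P.k then 1 else 0
  sound : σ 2 0 ≠ 0 → HamSeq P.E P.N
  complete : ∀ t' < t, Success p R P t' → σ 2 0 ≠ 0

/-- Present the instance for the current guess. -/
def present : Prog :=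
  .seq build (.seq (set 20 (.lit 0) (.reg 4)) (set 20 (.lit 1) (.reg 6)))

/-- Restore the state after the run of the given program, and go on to the next guess. -/
def cleanUp (A : ℕ) : Prog := .seq (clearLog A) (.seq (clearInput A) (increment 4 (.reg 3)))

/-- The memory content after the instance has been presented. -/
structure Presented (P : Par) (t : ℕ) (σ₀ σ : Store) : Prop where
  env : Env P σ
  copy : RowCopy P (blockCodes P.E P.N P.l P.k (dig P.N t) (P.N ^ (P.l + 2))) σ
  high : σ.high = (blockInst P.N P.l (blockCodes P.E P.N P.l P.k (dig P.N t)
    (P.N ^ (P.l + 2)))).input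
  w : ∀ i < P.l + 2, σ 5 i = 0
  frame : ∀ a < 20, a ≠ 5 → a ≠ 6 → ∀ i, (a = 0 → i < 6) → σ a i = σ₀ a i

theorem present_polyRun : PolyRun (fun B : Build => B.P.M) present
    (fun B σ => (B.OK ∧ ∀ a i, 20 ≤ a → B.σ₀ a i = 0) ∧ σ = B.σ₀)
    (fun B σ => Presented B.P B.g B.σ₀ σ) := by
  classical
  refine PolyRun.seq (Mid := fun B σ => (∀ a i, 20 ≤ a → B.σ₀ a i = 0) ∧
      B.Inv (B.P.N ^ (B.P.l + 2)) σ)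
    ((build_polyRun.mono (Pre' := fun B σ => (∀ a i, 20 ≤ a → B.σ₀ a i = 0) ∧
      (B.OK ∧ σ = B.σ₀)) (fun B σ h => h.2) fun _ _ h => h).pure.mono
      (fun B σ h => ⟨h.1.2, h.1.1, h.2⟩) fun _ _ h => h)
    (.seq (Mid := fun B σ => ∃ σ₁, ((∀ a i, 20 ≤ a → B.σ₀ a i = 0) ∧
      B.Inv (B.P.N ^ (B.P.l + 2)) σ₁) ∧ σ = σ₁.write 20 0 B.P.N)
      (.set (fun B σ h => h.2.bdd) ?_) (.set (fun B σ h => ?_) ?_))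
  · rintro B σ ⟨h0, h⟩
    refine ⟨σ, ⟨h0, h⟩, ?_⟩
    simp only [Tm.ev, Tm.eval, h.env.N]
  · obtain ⟨σ₁, ⟨-, h⟩, rfl⟩ := h
    exact h.bdd.write _ _ fun hh => absurd hh (by omega)
  · rintro B _ ⟨σ, ⟨h0, h⟩, rfl⟩
    have hN : 0 < B.P.N := by have := h.env.ok.two_le; omega
    simp only [Tm.ev, Tm.eval]
    rw [Store.write_of_ne_array _ _ _ _ (by omega), h.m]
    have hlow : ∀ a < 20, ∀ i, ((σ.write 20 0 B.P.N).write 20 1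
        (B.codes (B.P.N ^ (B.P.l + 2))).length) a i = σ a i := fun a ha i => by
      rw [Store.write_of_ne_array _ _ _ _ (by omega), Store.write_of_ne_array _ _ _ _ (by omega)]
    refine ⟨h.env.congr (fun a ha i => ?_) (fun i _ => hlow 0 (by omega) i)
      (fun i => hlow 3 (by omega) i), ⟨?_, fun i hi => ?_⟩, ?_, fun i hi => ?_,
      fun a ha h5 h6 i hi => ?_⟩
    · rw [hlow a (by omega)]; exact h.bdd a ha i
    · rw [hlow 0 (by omega), h.m]
    · rw [hlow 6 (by omega), h.rows.2 i hi]
    · funext a i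
      rw [blockInst_input hN]
      show ((σ.write 20 0 B.P.N).write 20 1 (B.codes (B.P.N ^ (B.P.l + 2))).length) (a + 20) i = _
      by_cases ha : a = 0
      · subst ha
        simp only [Store.write_apply, zero_add, true_and, if_true]
        by_cases hi0 : i = 0
        · simp [hi0]
        · by_cases hi1 : i = 1
          · simp [hi1]
          · simp only [hi0, hi1, if_false]
            rw [h.frame 20 i (by omega) (by omega) (by omega) (by omega), h0 20 i (by omega)]
      · rw [Store.write_of_ne_array _ _ _ _ (by omega),
          Store.write_of_ne_array _ _ _ _ (by omega), if_neg ha]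
        by_cases ha1 : a = 1
        · rw [if_pos ha1, ha1, h.rows.1]
          refine if_congr (and_iff_right_of_imp fun hr => ?_) rfl rfl
          rw [← Nat.div_add_mod' i B.P.N]
          exact block_index_lt hr.1 (Nat.mod_lt _ hN)
        · rw [if_neg ha1, h.frame (a + 20) i (by omega) (by omega) (by omega) (by omega),
            h0 _ _ (by omega)]
    -- At the overflow all digits have returned to `0`, so array `5` is ready for the next guess.
    · rw [hlow 5 (by omega), h.w i hi]
      have := dig_add_mul hN 0 1 hi
      rwa [zero_add, one_mul, dig_zero] at this
    · rw [hlow a ha, h.frame a i h5 h6 (by omega) hi]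

/-- The memory content after the answer has been checked. -/
structure Checked (p : Prog) (R : ℕ → Bool) (P : Par) (t m : ℕ) (σ : Store) : Prop where
  env : Env P σ
  g : ∀ i < P.k, σ 4 i = dig P.N t i
  w : ∀ i < P.l + 2, σ 5 i = 0
  lt : t < P.N ^ P.k
  m_eq : σ 0 6 = m
  m_le : m ≤ P.N ^ (P.l + 2)
  high : ∀ a i, 20 ≤ a → σ a i = 0 ∨ (a < p.width + 2 + 20 ∧
    (i < m * P.N + 2 ∨ ∃ l < σ 12 0, σ 11 l = i))
  sound : σ 2 0 ≠ 0 → HamSeq P.E P.N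
  complete : ∀ t' < t + 1, Success p R P t' → σ 2 0 ≠ 0

/-- Run the given program with the current guess, and check the answer. -/
def tryGuess (p : Prog) : Prog :=
  .seq present (.seq fillTank (.seq p.clock checkAnswer))

/-- Whatever the given program does, the fuel limits its time, and success is reported only after a
check that implies a Hamiltonian path. If the program would succeed within the fuel, then the
clocked run ends with the same answer, and the check accepts it. -/
theorem tryGuess_run (p : Prog) : ∃ κ, ∀ R P t σ, 2 ≤ P.M → GuessInv p R P t σ → t < P.N ^ P.k →
    Run R (tryGuess p) σ (P.M ^ κ * 2 ^ P.e) (fun σ' => (∃ m, Checked p R P t m σ') ∧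
      σ' 12 0 ≤ P.M ^ κ * 2 ^ P.e) := by
  classical
  obtain ⟨κ₁, h₁⟩ := present_polyRun
  obtain ⟨K, h₂⟩ := clock_run p
  obtain ⟨κ₃, h₃⟩ := checkAnswer_polyRun
  refine ⟨κ₁ + κ₃ + 2 * K + 13, fun R P t σ hM h ht => ?_⟩
  set L := blockCodes P.E P.N P.l P.k (dig P.N t) (P.N ^ (P.l + 2)) with hL
  have hOK : (⟨P, σ, t⟩ : Build).OK := ⟨h.env, h.g, h.w, fun i => h.empty 21 i (by omega)⟩
  have hstep : ∀ σ₁, Presented P t σ σ₁ → Run R (.seq fillTank (.seq p.clock checkAnswer)) σ₁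
      (3 * 2 ^ P.e + 4 * P.e + 4 + (K * (2 ^ P.e + 1) + P.M ^ κ₃))
      (fun σ' => (∃ m, Checked p R P t m σ') ∧ σ' 12 0 ≤ K * (2 ^ P.e + 1)) := by
    intro σ₁ g₁
    have hfill := fillTank_run R σ₁
    rw [g₁.env.e] at hfill
    refine hfill.seq fun σ₂ g₂ => ?_
    have hlow₂ : ∀ a, a ≠ 10 → ∀ i, σ₂ a i = σ₁ a i := fun a ha i => by
      rw [g₂, Store.write_of_ne_array _ _ _ _ ha]
    have hfuel : σ₂ 10 0 = 2 ^ P.e := by rw [g₂, Store.write_same]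
    have htop : σ₂ 12 0 = 0 := by
      rw [hlow₂ 12 (by omega), g₁.frame 12 (by omega) (by omega) (by omega) 0 (by omega), h.top]
    have hhigh : σ₂.high = (blockInst P.N P.l L).input := by
      rw [g₂, Store.high_write_low _ _ _ (by omega), g₁.high]
    have hclock := h₂ R σ₂
    rw [hfuel, htop, hhigh] at hclock
    refine hclock.seq fun σ₃ g₃ => ?_
    obtain ⟨fr, htop₃, hsim⟩ := g₃
    have hlow : ∀ a < 10, ∀ i, σ₃ a i = σ₁ a i := fun a ha i => by
      rw [fr.low a (by omega) (by omega) (by omega) (by omega), hlow₂ a (by omega)]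
    have henv : Env P σ₃ := g₁.env.congr (fun a ha i => by
      rw [hlow a (by omega)]; exact g₁.env.bdd a ha i) (fun i _ => hlow 0 (by omega) i)
      fun i => hlow 3 (by omega) i
    have hcopy : RowCopy P L σ₃ := ⟨by rw [hlow 0 (by omega)]; exact g₁.copy.1, fun i hi => by
      rw [hlow 6 (by omega)]; exact g₁.copy.2 i hi⟩
    have hout : σ₃ 2 0 = σ 2 0 := by
      rw [hlow 2 (by omega), g₁.frame 2 (by omega) (by omega) (by omega) 0 (by omega)]
    have hN0 : 0 < P.N := by have := henv.ok.two_le; omega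
    -- The part that is common to both outcomes of the check, which touches only array `2`.
    have main : ∀ σ', (∀ a i, a ≠ 2 → σ' a i = σ₃ a i) → Bdd P.M σ' →
        (σ' 2 0 ≠ 0 → HamSeq P.E P.N) → (∀ t' < t + 1, Success p R P t' → σ' 2 0 ≠ 0) →
        (∃ m, Checked p R P t m σ') ∧ σ' 12 0 ≤ K * (2 ^ P.e + 1) := by
      intro σ' hσ' hb hs hc
      refine ⟨⟨L.length, henv.congr hb (fun i _ => hσ' 0 i (by omega)) (fun i => hσ' 3 i (by omega)),
        fun i hi => ?_, fun i hi => ?_, ht, ?_, blockCodes_length_le _ _ _ _ _ _,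
        fun a i ha => ?_, hs, hc⟩, ?_⟩
      · rw [hσ' 4 i (by omega), hlow 4 (by omega),
          g₁.frame 4 (by omega) (by omega) (by omega) i (by omega), h.g i hi]
      · rw [hσ' 5 i (by omega), hlow 5 (by omega), g₁.w i hi]
      · rw [hσ' 0 6 (by omega), hcopy.1]
      · rw [hσ' a i (by omega), hσ' 12 0 (by omega)]
        -- A cell that the run left alone still contains the input; a changed one is in the log.
        by_cases hne : σ₃ a i = σ₂ a i
        · rw [hne]
          obtain ⟨a, rfl⟩ : ∃ b, a = b + 20 := ⟨a - 20, by omega⟩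
          change σ₂.high a i = 0 ∨ _
          rw [hhigh, blockInst_input hN0]
          by_cases h0 : a = 0
          · rw [if_pos h0]
            split_ifs
            · exact .inr ⟨by omega, .inl (by omega)⟩
            · exact .inr ⟨by omega, .inl (by omega)⟩
            · exact .inl rfl
          · rw [if_neg h0]
            by_cases h1 : a = 1
            · rw [if_pos h1]
              split_ifs with hr
              · refine .inr ⟨by omega, .inl ?_⟩
                have := block_index_lt hr.1 (Nat.mod_lt i hN0)
                rw [Nat.div_add_mod'] at this
                omega
              · exact .inl rfl
            · rw [if_neg h1]; exact .inl rfl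
        · obtain ⟨g1, l, hl, hli⟩ := fr.high a i ha hne
          exact .inr ⟨by omega, .inr ⟨l, hl, by rw [hσ' 11 l (by omega), hli]⟩⟩
      · rw [hσ' 12 0 (by omega)]
        simpa using htop₃
    refine (h₃ R (P, L, σ₃) σ₃ hM ⟨henv, hcopy, rfl⟩).mono le_rfl ?_
    rintro σ' (⟨hA, rfl⟩ | ⟨hA, rfl⟩)
    · refine main _ (fun a i ha => Store.write_of_ne_array _ _ _ _ ha)
        (henv.bdd.write _ _ fun _ => by omega) (fun _ => ?_) (fun _ _ _ => ?_)
      · have hN := henv.ok.N_eq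
        have hcov := hA.1
        simp only at hcov hN
        rw [hN]
        rw [Accepts, hL, hN] at hA
        exact hamSeq_of_blockInst_cover henv.ok.l_pos henv.ok.k_pos hA.1 hA.2
      · rw [Store.write_same]; exact one_ne_zero
    · refine main _ (fun a i ha => rfl) henv.bdd (fun hne => h.sound (hout ▸ hne))
        fun t' ht' hsucc => ?_
      rcases Nat.lt_succ_iff_lt_or_eq.1 ht' with ht' | rfl
      · rw [hout]; exact h.complete t' ht' hsucc
      · obtain ⟨s, τ, k1, k2, k3⟩ := hsucc
        rw [← hsim s τ k1 k2] at k3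
        exact absurd k3 hA
  have hpow : 1 ≤ 2 ^ P.e := Nat.one_le_two_pow
  have hbound : ∀ x, x ≤ (2 * K + 13) * (P.M ^ (κ₁ + κ₃) * 2 ^ P.e) →
      x ≤ P.M ^ (κ₁ + κ₃ + (2 * K + 13)) * 2 ^ P.e := fun x hx => by
    rw [← mul_assoc] at hx
    exact hx.trans (Nat.mul_le_mul_right _ (Tm.le_pow_succ_of_le hM _ le_rfl))
  have hX : ∀ κ' ≤ κ₁ + κ₃, P.M ^ κ' ≤ P.M ^ (κ₁ + κ₃) * 2 ^ P.e := fun κ' hκ =>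
    (Nat.pow_le_pow_right (by omega) hκ).trans (Nat.le_mul_of_pos_right _ (by omega))
  have hX1 : 1 ≤ P.M ^ (κ₁ + κ₃) := Nat.one_le_pow _ _ (by omega)
  have hY : 2 ^ P.e ≤ P.M ^ (κ₁ + κ₃) * 2 ^ P.e := Nat.le_mul_of_pos_left _ (by omega)
  have he : P.e < 2 ^ P.e := Nat.lt_two_pow_self
  have hKY : K * (2 ^ P.e + 1) ≤ 2 * K * (P.M ^ (κ₁ + κ₃) * 2 ^ P.e) := by
    calc K * (2 ^ P.e + 1) ≤ K * (2 * (P.M ^ (κ₁ + κ₃) * 2 ^ P.e)) :=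
          Nat.mul_le_mul_left _ (by omega)
      _ = _ := by ring
  have hadd : κ₁ + κ₃ + 2 * K + 13 = κ₁ + κ₃ + (2 * K + 13) := by ring
  have hdist : (2 * K + 13) * (P.M ^ (κ₁ + κ₃) * 2 ^ P.e) =
      2 * K * (P.M ^ (κ₁ + κ₃) * 2 ^ P.e) + 13 * (P.M ^ (κ₁ + κ₃) * 2 ^ P.e) := by ring
  rw [hadd]
  refine ((h₁ R ⟨P, σ, t⟩ σ hM ⟨⟨hOK, h.empty⟩, rfl⟩).seq hstep).mono (hbound _ ?_)
    fun σ' hσ' => ⟨hσ'.1, hσ'.2.trans (hbound _ ?_)⟩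
  · have h1 := hX κ₁ (by omega)
    have h3 := hX κ₃ (by omega)
    dsimp only
    omega
  · omega

/-- A cell from array `20` on can be nonzero only if it lies in the range of the input or its index
is in the log, so the two clearing steps together empty these arrays. The number of arrays is
`p.width + 2` since the input occupies arrays `20` and `21` even if the program writes to neither.
-/
theorem cleanUp_run (p : Prog) : ∃ κ, ∀ R P t m σ, 2 ≤ P.M → Checked p R P t m σ →
    Run R (cleanUp (p.width + 2)) σ (σ 12 0 * (p.width + 5) + P.M ^ κ)
      (GuessInv p R P (t + 1)) := by
  classical
  obtain ⟨κ₁, h₁⟩ := clearInput_polyRun (p.width + 2)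
  obtain ⟨κ₂, h₂⟩ := increment_polyRun (a := 4) (by omega) (by omega) (K := .reg 3)
    (by simp [Tm.WF])
  refine ⟨κ₁ + κ₂ + 3, fun R P t m σ hM h => ?_⟩
  have hstep : ∀ σ₁, (σ₁ 12 0 = 0 ∧ (∀ a < 20, a ≠ 8 → a ≠ 9 → a ≠ 12 → ∀ i, σ₁ a i = σ a i) ∧
      (∀ a i, 20 ≤ a → σ₁ a i = σ a i ∨ σ₁ a i = 0) ∧
      (∀ a i, 20 ≤ a → a < p.width + 2 + 20 → (∃ l < σ 12 0, σ 11 l = i) → σ₁ a i = 0)) →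
      Run R (.seq (clearInput (p.width + 2)) (increment 4 (.reg 3))) σ₁ (P.M ^ κ₁ + P.M ^ κ₂)
        (GuessInv p R P (t + 1)) := by
    rintro σ₁ ⟨htop, hlow, hhigh, hlog⟩
    have henv : Env P σ₁ := h.env.congr (fun a ha i => by
      rw [hlow a (by omega) (by omega) (by omega) (by omega)]; exact h.env.bdd a ha i)
      (fun i _ => hlow 0 (by omega) (by omega) (by omega) (by omega) i)
      (fun i => hlow 3 (by omega) (by omega) (by omega) (by omega) i)
    have hm : σ₁ 0 6 = m := by
      rw [hlow 0 (by omega) (by omega) (by omega) (by omega), h.m_eq]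
    refine (h₁ R (P, m, σ₁) σ₁ hM ⟨henv, hm, h.m_le, rfl⟩).seq fun σ₂ g => ?_
    dsimp only at g
    have hlow₂ : ∀ a < 20, a ≠ 8 → a ≠ 9 → a ≠ 12 → ∀ i, (a = 0 → i ≠ 14) → σ₂ a i = σ a i :=
      fun a ha h8 h9 h12 i hi => by rw [g.low a ha h8 h9 i hi, hlow a ha h8 h9 h12]
    have henv₂ : Env P σ₂ := h.env.congr g.bdd
      (fun i hi => hlow₂ 0 (by omega) (by omega) (by omega) (by omega) i (by omega))
      fun i => hlow₂ 3 (by omega) (by omega) (by omega) (by omega) i (by omega)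
    have hempty : ∀ a i, 20 ≤ a → σ₂ a i = 0 := by
      intro a i ha
      rw [g.high a i ha]
      split_ifs with hc
      · rfl
      · rcases hhigh a i ha with h1 | h1
        · rcases h.high a i ha with h2 | ⟨h2, h3 | h3⟩
          · rw [h1, h2]
          · exact absurd ⟨h2, h3⟩ hc
          · exact hlog a i ha h2 h3
        · exact h1
    have hN2 := henv.ok.two_le
    refine (h₂ R ⟨σ₂, P.M, P.N, P.k, t⟩ σ₂ hM ⟨⟨henv₂.bdd, hN2, henv.ok.N_le, henv.ok.k_le,
      henv₂.N, fun σ' h' => ?_, fun j hj => ?_⟩, rfl⟩).mono le_rfl fun σ₃ g₃ => ?_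
    · simp only [Tm.ev, Tm.eval, h' 3 (by omega), henv₂.k]
    · exact (hlow₂ 4 (by omega) (by omega) (by omega) (by omega) j (by omega)).trans (h.g j hj)
    · have hfr := g₃.frame
      dsimp only at hfr
      have hout : σ₃ 2 0 = σ 2 0 := by
        rw [hfr 2 0 (by omega) (by omega),
          hlow₂ 2 (by omega) (by omega) (by omega) (by omega) 0 (by omega)]
      have hdvd : P.N ^ P.k ∣ t + 1 ↔ t + 1 = P.N ^ P.k :=
        ⟨fun hd => le_antisymm h.lt (Nat.le_of_dvd (by omega) hd), fun he => he ▸ dvd_rfl⟩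
      refine ⟨henv₂.congr g₃.bdd (fun i hi => hfr 0 i (by omega) (by omega))
        (fun i => hfr 3 i (by omega) (by omega)), g₃.done, fun i hi => ?_, fun a i ha => ?_, ?_, ?_,
        fun hne => h.sound (hout ▸ hne), fun t' ht' hs => hout ▸ h.complete t' ht' hs⟩
      · rw [hfr 5 i (by omega) (by omega),
          hlow₂ 5 (by omega) (by omega) (by omega) (by omega) i (by omega), h.w i hi]
      · rw [hfr a i (by omega) (by omega), hempty a i ha]
      · rw [hfr 12 0 (by omega) (by omega), g.low 12 (by omega) (by omega) (by omega) 0 (by omega),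
          htop]
      · rw [g₃.carry]
        exact if_congr hdvd rfl rfl
  refine ((clearLog_run R (p.width + 2) σ).seq hstep).mono ?_ fun _ h => h
  have hp : ∀ κ'', κ'' ≤ κ₁ + κ₂ → P.M ^ κ'' ≤ P.M ^ (κ₁ + κ₂) :=
    fun κ' hκ => Nat.pow_le_pow_right (by omega) hκ
  have ha := hp κ₁ (by omega)
  have hb1 := hp κ₂ (by omega)
  have hone := hp 0 (by omega)
  rw [pow_zero] at hone
  have h3 : 3 * P.M ^ (κ₁ + κ₂) ≤ P.M ^ (κ₁ + κ₂ + 3) := Tm.le_pow_succ_of_le hM 3 le_rfl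
  have h4 : σ 12 0 * (p.width + 2 + 3) = σ 12 0 * (p.width + 5) := rfl
  omega

/-- Try all guesses. -/
def tryAll (p : Prog) : Prog :=
  .seq (set 0 (.lit 8) (.lit 0)) (whileS (.eq (.reg 8) (.lit 0))
    (.seq (tryGuess p) (cleanUp (p.width + 2))))

/-- The memory content before the first guess. -/
structure Ready (P : Par) (σ : Store) : Prop where
  env : Env P σ
  g : ∀ i < P.k, σ 4 i = 0
  w : ∀ i < P.l + 2, σ 5 i = 0
  empty : ∀ a i, 20 ≤ a → σ a i = 0
  top : σ 12 0 = 0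
  out : σ 2 0 = 0

/-- The bits `R` are fixed, and the runs for all guesses read the same ones. Independence plays no
role, because a single successful guess suffices. -/
theorem tryAll_run (p : Prog) : ∃ κ, ∀ R P σ, 2 ≤ P.M → Ready P σ →
    Run R (tryAll p) σ (P.M ^ κ * (2 ^ P.e * P.N ^ P.k)) (fun σ' =>
      (σ' 2 0 ≠ 0 → HamSeq P.E P.N) ∧ ∀ t < P.N ^ P.k, Success p R P t → σ' 2 0 ≠ 0) := by
  obtain ⟨κ₁, h₁⟩ := tryGuess_run p
  obtain ⟨κ₂, h₂⟩ := cleanUp_run p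
  obtain ⟨κ₃, h₃⟩ := (Tm.eq (.reg 8) (.lit 0)).exists_compileSpec 0 0
  obtain ⟨κ₀, h₀⟩ := set_polyRun (a := 0) (t := .lit 8) (u := .lit 0) trivial trivial
  refine ⟨κ₀ + κ₁ + κ₂ + κ₃ + (2 * (p.width + 9) + 1), fun R P σ hM h => ?_⟩
  have hN0 : 0 < P.N := by have := h.env.ok.two_le; omega
  have hinit : Run R (set 0 (.lit 8) (.lit 0)) σ (P.M ^ κ₀) (GuessInv p R P 0) := by
    refine (h₀ R (P.M, σ) σ hM ⟨h.env.bdd, rfl⟩).mono le_rfl ?_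
    rintro σ' rfl
    simp only [Tm.ev, Tm.eval]
    have hlow : ∀ a i, (a = 0 → i < 8) → σ.write 0 8 0 a i = σ a i := fun a i hi => by
      rw [Store.write_apply, if_neg (fun hc => by have := hi hc.1; omega)]
    have hne : (0 : ℕ) ≠ P.N ^ P.k := by positivity
    refine ⟨h.env.congr (h.env.bdd.write _ _ fun _ => Nat.zero_le _)
      (fun i hi => hlow 0 i (by omega)) (fun i => hlow 3 i (by omega)), fun i hi => ?_,
      fun i hi => ?_, fun a i ha => ?_, ?_, ?_, fun hc => ?_, fun t' ht' => absurd ht' (by omega)⟩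
    · rw [hlow 4 i (by omega), h.g i hi, dig_zero]
    · rw [hlow 5 i (by omega), h.w i hi]
    · rw [hlow a i (by omega), h.empty a i ha]
    · rw [hlow 12 0 (by omega), h.top]
    · rw [Store.write_same, if_neg hne]
    · rw [hlow 2 0 (by omega), h.out] at hc
      exact absurd rfl hc
  refine (hinit.seq fun σ₁ g₁ => Run.while (n := P.N ^ P.k)
    (T := P.M ^ κ₁ * 2 ^ P.e + (P.M ^ κ₁ * 2 ^ P.e * (p.width + 5) + P.M ^ κ₂)) h₃
    (by simp [Tm.WF]) hM (GuessInv p R P) (fun j σ h => h.env.bdd) (fun j hj σ hσ => ?_)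
    (fun j hj σ hσ => ?_) g₁).mono ?_
    fun σ' h' => ⟨h'.sound, h'.complete⟩
  · simp only [Tm.ev, Tm.eval, hσ.carry]
    split_ifs with h1 h2 h2
    · simp at h2
    · simp [h1]
    · simp only [ne_eq, one_ne_zero, not_false_eq_true, true_iff]; omega
    · simp at h2
  · refine (h₁ R P j σ hM hσ hj).seq fun σ₂ g₂ => ?_
    obtain ⟨⟨m, hm⟩, htop⟩ := g₂
    refine (h₂ R P j m σ₂ hM hm).mono ?_ fun _ h => h
    exact Nat.add_le_add_right (Nat.mul_le_mul_right _ htop) _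
  · set X := P.M ^ (κ₀ + κ₁ + κ₂ + κ₃) with hXdef
    have hp : ∀ κ'', κ'' ≤ κ₀ + κ₁ + κ₂ + κ₃ → P.M ^ κ'' ≤ X :=
      fun κ' hκ => Nat.pow_le_pow_right (by omega) hκ
    have hY : 1 ≤ 2 ^ P.e := Nat.one_le_two_pow
    have hn : 1 ≤ P.N ^ P.k := Nat.one_le_pow _ _ hN0
    have hX1 : P.M ^ 0 ≤ X := hp 0 (by omega)
    rw [pow_zero] at hX1
    set Y := 2 ^ P.e
    have h0 := hp κ₀ (by omega)
    have h2 := (hp κ₂ (by omega)).trans (Nat.le_mul_of_pos_right X (show 0 < Y by omega))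
    have h3 := (hp κ₃ (by omega)).trans (Nat.le_mul_of_pos_right X (show 0 < Y by omega))
    have h1 : P.M ^ κ₁ * Y ≤ X * Y := Nat.mul_le_mul_right _ (hp κ₁ (by omega))
    have hone : 1 ≤ X * Y := Nat.mul_pos (by omega) (by omega)
    have h1' := Nat.mul_le_mul_right (p.width + 5) h1
    have hT : P.M ^ κ₁ * Y + (P.M ^ κ₁ * Y * (p.width + 5) + P.M ^ κ₂) + P.M ^ κ₃ + 1 ≤
        (p.width + 9) * (X * Y) := by
      have : (p.width + 9) * (X * Y) = X * Y + (X * Y * (p.width + 5) + X * Y) + X * Y + X * Y := by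
        ring
      omega
    have h0' : P.M ^ κ₀ ≤ X * (Y * P.N ^ P.k) :=
      h0.trans (Nat.le_mul_of_pos_right X (Nat.mul_pos (by omega) (by omega)))
    calc P.M ^ κ₀ + (P.N ^ P.k + 1) * (P.M ^ κ₁ * Y + (P.M ^ κ₁ * Y * (p.width + 5) + P.M ^ κ₂) +
          P.M ^ κ₃ + 1) ≤ X * (Y * P.N ^ P.k) + (2 * P.N ^ P.k) * ((p.width + 9) * (X * Y)) :=
          Nat.add_le_add h0' (Nat.mul_le_mul (by omega) hT)
      _ = (2 * (p.width + 9) + 1) * X * (Y * P.N ^ P.k) := by ring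
      _ ≤ P.M ^ (κ₀ + κ₁ + κ₂ + κ₃ + (2 * (p.width + 9) + 1)) * (Y * P.N ^ P.k) :=
          Nat.mul_le_mul_right _ (Tm.le_pow_succ_of_le hM _ le_rfl)

/-! ### Preparation -/

theorem adj_iff_input (D : DigraphInst) {u v : ℕ} (hv : v < D.n) (hu : u < D.n) :
    D.input 1 (u * D.n + v) ≠ 0 ↔ D.adj u v := by
  classical
  have h : D.input 1 (u * D.n + v) = if ∃ x y : Fin D.n, u * D.n + v = (x : ℕ) * D.n + (y : ℕ) ∧
    D.G.Adj x y then 1 else 0 := rfl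
  have hiff : (∃ x y : Fin D.n, u * D.n + v = (x : ℕ) * D.n + (y : ℕ) ∧ D.G.Adj x y) ↔
      D.adj u v := by
    constructor
    · rintro ⟨x, y, hxy, hadj⟩
      have h1 := congrArg (· % D.n) hxy
      have h2 := congrArg (· / D.n) hxy
      simp only [Nat.mul_add_mod', Nat.mod_eq_of_lt hv, Nat.mod_eq_of_lt y.2] at h1
      simp only [mul_comm _ D.n, Nat.mul_add_div (show 0 < D.n by omega), Nat.div_eq_of_lt hv,
        Nat.div_eq_of_lt y.2, add_zero] at h2
      rw [h1, h2]
      exact (D.adj_coe x y).2 hadj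
    · rintro ⟨hu, hv, hadj⟩
      exact ⟨⟨u, hu⟩, ⟨v, hv⟩, rfl, hadj⟩
  rw [h, ← hiff]
  simp

/-- The parameters for a directed graph: the block length is `a` times the length of the nodes in
binary plus `a * b`, and the constant `c` determines the fuel. -/
def mkPar (a b c : ℕ) (M : ℕ → ℕ) (E : DigraphInst → ℕ → ℕ → Prop) (D : DigraphInst) : Par where
  l := a * (Nat.size D.n + b)
  k := D.n / (a * (Nat.size D.n + b)) + 1
  N := (D.n / (a * (Nat.size D.n + b)) + 1) * (a * (Nat.size D.n + b))
  e := (D.n / (a * (Nat.size D.n + b)) + 1) * (Nat.size D.n + b) * (a - 3) +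
    (c * ((Nat.size D.n + b) * (a * (Nat.size D.n + b) + 3)) + c)
  M := M D.n
  E := E D

/-- Compute the number of binary digits of the number of nodes plus `b`. -/
def computeSize (b : ℕ) : Prog :=
  .seq (set 0 (.lit 10) (.lit 1)) (.seq (set 0 (.lit 1) (.lit b))
    (whileS (.lt (.reg 10) (.add (.reg 0) (.lit 1)))
      (.seq (set 0 (.lit 10) (.add (.reg 10) (.reg 10)))
        (set 0 (.lit 1) (.add (.reg 1) (.lit 1))))))

/-- Compute the parameters. -/
def computePar (a b c : ℕ) : Prog :=
  .seq (computeSize b) (.seq (set 0 (.lit 2) (.mul (.lit a) (.reg 1)))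
    (.seq (set 0 (.lit 3) (.add (.sum (.reg 0)
      (.bool (.lt (.mul (.add (.var 0) (.lit 1)) (.reg 2)) (.add (.reg 0) (.lit 1))))) (.lit 1)))
    (.seq (set 0 (.lit 4) (.mul (.reg 3) (.reg 2)))
      (set 0 (.lit 5) (.add (.mul (.mul (.reg 3) (.reg 1)) (.lit (a - 3)))
        (.add (.mul (.lit c) (.mul (.reg 1) (.add (.reg 2) (.lit 3)))) (.lit c)))))))

/-- Write the adjacency matrix of the extended graph. -/
def writeMatrix (e : Tm) : Prog :=
  forS 11 (.reg 4) (forS 12 (.reg 4) (set 3 (.add (.mul (.reg 11) (.reg 4)) (.reg 12)) (.bool e)))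

/-- The size conditions for the preparation. -/
structure Fits (a b c : ℕ) (M : ℕ → ℕ) (E : DigraphInst → ℕ → ℕ → Prop) (D : DigraphInst) :
    Prop where
  ok : (mkPar a b c M E D).OK
  n_pos : 1 ≤ D.n
  n_le : 2 * D.n ≤ M D.n
  size_le : Nat.size D.n + b ≤ M D.n

/-- Only registers and scratch memory have been changed. -/
structure Prep (a b c : ℕ) (M : ℕ → ℕ) (E : DigraphInst → ℕ → ℕ → Prop) (D : DigraphInst)
    (σ : Store) : Prop where
  fits : Fits a b c M E D
  bdd : Bdd (M D.n) σ
  n : σ 0 0 = D.n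
  low : ∀ r, 0 < r → ∀ i, σ r i = D.input r i

section

variable {a b c : ℕ} {M : ℕ → ℕ} {E : DigraphInst → ℕ → ℕ → Prop}

theorem Prep.write {D : DigraphInst} {σ : Store} (h : Prep a b c M E D σ) {r v : ℕ} (hr : r ≠ 0)
    (hv : v ≤ M D.n) : Prep a b c M E D (σ.write 0 r v) where
  fits := h.fits
  bdd := h.bdd.write _ _ fun _ => hv
  n := by rw [Store.write_of_ne_index _ _ _ _ (by omega), h.n]
  low r hr i := by rw [Store.write_of_ne_array _ _ _ _ (by omega), h.low r hr i]

theorem prep_input {D : DigraphInst} (h : Fits a b c M E D) : Prep a b c M E D D.input where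
  fits := h
  bdd := by
    intro r hr i
    have := h.n_le
    have := h.n_pos
    unfold DigraphInst.input
    split_ifs <;> omega
  n := by simp [DigraphInst.input]
  low _ _ _ := rfl

/-- Register `10` runs through the powers of two up to the first one that exceeds `n`. It is at most
`2 * n`, for which `n_le` leaves room. -/
theorem computeSize_polyRun : PolyRun (fun D : DigraphInst => M D.n) (computeSize b)
    (fun D σ => Prep a b c M E D σ)
    (fun D σ => Prep a b c M E D σ ∧ σ 0 1 = Nat.size D.n + b) := by
  refine PolyRun.seq (Mid := fun D σ => Prep a b c M E D σ ∧ σ 0 10 = 1)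
    (.set (fun D σ h => h.bdd) ?_) (.seq (Mid := fun D σ => Prep a b c M E D σ ∧
      σ 0 10 = 2 ^ 0 ∧ σ 0 1 = 0 + b) (.set (fun D σ h => h.1.bdd) ?_) ?_)
  · intro D σ h
    have := h.fits.n_le
    have := h.fits.n_pos
    simp only [Tm.ev, Tm.eval]
    exact ⟨h.write (by omega) (by omega), Store.write_same _ _ _ _⟩
  · rintro D σ ⟨h, h10⟩
    have := h.fits.size_le
    simp only [Tm.ev, Tm.eval]
    refine ⟨h.write (by omega) (by omega), ?_, ?_⟩
    · rw [Store.write_of_ne_index _ _ _ _ (by omega), h10, pow_zero]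
    · rw [Store.write_same, zero_add]
  refine (PolyRun.while (M := fun D : DigraphInst => M D.n) (fun D j σ => Prep a b c M E D σ ∧
    σ 0 10 = 2 ^ j ∧ σ 0 1 = j + b) (fun D => Nat.size D.n) (fun D j σ h => h.1.bdd) ?_ ?_).mono
    (fun _ _ h => h) fun D σ h => ⟨h.1, h.2.2⟩
  · rintro D j hj σ ⟨h, h10, h1⟩
    have := h.fits.size_le
    refine ⟨by omega, ?_⟩
    rw [Tm.ev_ne_zero, Tm.tr_lt]
    simp only [Tm.eval, h10, h.n]
    rw [Nat.lt_size]
    omega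
  have hpow : ∀ (D : DigraphInst) (j : ℕ), j < Nat.size D.n → 2 ^ j ≤ D.n := fun D j hj =>
    Nat.lt_size.1 hj
  refine PolyRun.seq (Mid := fun x σ => x.2 < Nat.size x.1.n ∧ Prep a b c M E x.1 σ ∧
    σ 0 10 = 2 ^ (x.2 + 1) ∧ σ 0 1 = x.2 + b) (.set (fun x σ h => h.2.1.bdd) ?_)
    (.set (fun x σ h => h.2.1.bdd) ?_)
  · rintro ⟨D, j⟩ σ ⟨hj, h, h10, h1⟩
    dsimp only at hj h h10 h1 ⊢
    have h2 := hpow D j hj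
    have h3 := h.fits.n_le
    simp only [Tm.ev, Tm.eval, h10]
    refine ⟨hj, h.write (by omega) (by omega), ?_, ?_⟩
    · rw [Store.write_same, pow_succ]; ring
    · rw [Store.write_of_ne_index _ _ _ _ (by omega), h1]
  · rintro ⟨D, j⟩ σ ⟨hj, h, h10, h1⟩
    dsimp only at hj h h10 h1 ⊢
    have := h.fits.size_le
    simp only [Tm.ev, Tm.eval, h1]
    refine ⟨h.write (by omega) (by omega), ?_, ?_⟩
    · rw [Store.write_of_ne_index _ _ _ _ (by omega), h10]
    · rw [Store.write_same]; ring

/-- The parameters have been computed. -/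
structure PrepPar (a b c : ℕ) (M : ℕ → ℕ) (E : DigraphInst → ℕ → ℕ → Prop) (D : DigraphInst)
    (σ : Store) : Prop extends Prep a b c M E D σ where
  l : σ 0 2 = (mkPar a b c M E D).l
  k : σ 0 3 = (mkPar a b c M E D).k
  N : σ 0 4 = (mkPar a b c M E D).N
  e : σ 0 5 = (mkPar a b c M E D).e

/-- Terms have no division, so the quotient is obtained by counting the positive multiples of `l` up
to `n`. -/
theorem sum_range_le_eq_div {n l : ℕ} (hl : 0 < l) :
    ∑ j ∈ Finset.range n, (if (j + 1) * l < n + 1 then 1 else 0) = n / l := by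
  rw [← Finset.card_filter]
  have : (Finset.range n).filter (fun j => (j + 1) * l < n + 1) = Finset.range (n / l) := by
    ext j
    simp only [Finset.mem_filter, Finset.mem_range]
    rw [Nat.lt_succ_iff, ← Nat.le_div_iff_mul_le hl]
    have := Nat.div_le_self n l
    omega
  rw [this, Finset.card_range]

theorem computePar_polyRun : PolyRun (fun D : DigraphInst => M D.n) (computePar a b c)
    (fun D σ => Prep a b c M E D σ) (fun D σ => PrepPar a b c M E D σ) := by
  refine PolyRun.seq computeSize_polyRun
    (.seq (Mid := fun D σ => Prep a b c M E D σ ∧ σ 0 1 = Nat.size D.n + b ∧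
      σ 0 2 = (mkPar a b c M E D).l) (.set (fun D σ h => h.1.bdd) ?_)
    (.seq (Mid := fun D σ => Prep a b c M E D σ ∧ σ 0 1 = Nat.size D.n + b ∧
      σ 0 2 = (mkPar a b c M E D).l ∧ σ 0 3 = (mkPar a b c M E D).k)
      (.set (fun D σ h => h.1.bdd) ?_)
    (.seq (Mid := fun D σ => Prep a b c M E D σ ∧ σ 0 1 = Nat.size D.n + b ∧
      σ 0 2 = (mkPar a b c M E D).l ∧ σ 0 3 = (mkPar a b c M E D).k ∧
      σ 0 4 = (mkPar a b c M E D).N)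
      (.set (fun D σ h => h.1.bdd) ?_) (.set (fun D σ h => h.1.bdd) ?_))))
  · rintro D σ ⟨h, h1⟩
    have hv : (Tm.mul (.lit a) (.reg 1)).ev σ = (mkPar a b c M E D).l := by
      simp only [Tm.ev, Tm.mul, Tm.eval, h1, Finset.sum_const, Finset.card_range, smul_eq_mul]
      rfl
    rw [hv]
    have := h.fits.ok.l_le
    refine ⟨h.write (by simp [Tm.ev, Tm.eval]) (by change _ ≤ (mkPar a b c M E D).M; omega), ?_, ?_⟩
    · rw [Store.write_of_ne_index _ _ _ _ (by simp [Tm.ev, Tm.eval]), h1]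
    · exact Store.write_same _ _ _ _
  · rintro D σ ⟨h, h1, h2⟩
    have hv : (Tm.add (.sum (.reg 0) (.bool (.lt (.mul (.add (.var 0) (.lit 1)) (.reg 2))
        (.add (.reg 0) (.lit 1))))) (.lit 1)).ev σ = (mkPar a b c M E D).k := by
      simp only [Tm.ev, Tm.mul, Tm.eval, Tm.eval_bool, Tm.tr_lt, h2, h.n, Function.update_self,
        Finset.sum_const, Finset.card_range, smul_eq_mul]
      have := sum_range_le_eq_div (n := D.n) h.fits.ok.l_pos
      exact congrArg (· + 1) this
    rw [hv]
    have := h.fits.ok.k_le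
    refine ⟨h.write (by simp [Tm.ev, Tm.eval]) this, ?_, ?_, ?_⟩
    · rw [Store.write_of_ne_index _ _ _ _ (by simp [Tm.ev, Tm.eval]), h1]
    · rw [Store.write_of_ne_index _ _ _ _ (by simp [Tm.ev, Tm.eval]), h2]
    · exact Store.write_same _ _ _ _
  · rintro D σ ⟨h, h1, h2, h3⟩
    have hv : (Tm.mul (.reg 3) (.reg 2)).ev σ = (mkPar a b c M E D).N := by
      simp only [Tm.ev, Tm.mul, Tm.eval, h2, h3, Finset.sum_const, Finset.card_range, smul_eq_mul]
      rfl
    rw [hv]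
    have := h.fits.ok.N_le
    refine ⟨h.write (by simp [Tm.ev, Tm.eval]) this, ?_, ?_, ?_, ?_⟩
    · rw [Store.write_of_ne_index _ _ _ _ (by simp [Tm.ev, Tm.eval]), h1]
    · rw [Store.write_of_ne_index _ _ _ _ (by simp [Tm.ev, Tm.eval]), h2]
    · rw [Store.write_of_ne_index _ _ _ _ (by simp [Tm.ev, Tm.eval]), h3]
    · exact Store.write_same _ _ _ _
  · rintro D σ ⟨h, h1, h2, h3, h4⟩
    have hv : (Tm.add (.mul (.mul (.reg 3) (.reg 1)) (.lit (a - 3)))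
        (.add (.mul (.lit c) (.mul (.reg 1) (.add (.reg 2) (.lit 3)))) (.lit c))).ev σ =
        (mkPar a b c M E D).e := by
      simp only [Tm.ev, Tm.mul, Tm.eval, h1, h2, h3, Finset.sum_const, Finset.card_range,
        smul_eq_mul]
      rfl
    rw [hv]
    have := h.fits.ok.e_le
    refine ⟨h.write (by simp [Tm.ev, Tm.eval]) this, ?_, ?_, ?_, ?_⟩
    · rw [Store.write_of_ne_index _ _ _ _ (by simp [Tm.ev, Tm.eval]), h2]
    · rw [Store.write_of_ne_index _ _ _ _ (by simp [Tm.ev, Tm.eval]), h3]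
    · rw [Store.write_of_ne_index _ _ _ _ (by simp [Tm.ev, Tm.eval]), h4]
    · exact Store.write_same _ _ _ _

/-- The term describes the edges of the extended graphs. -/
def DescribesEdges (e : Tm) (E : DigraphInst → ℕ → ℕ → Prop) : Prop :=
  e.WF 0 ∧ ∀ (D : DigraphInst) (σ : Store), 1 ≤ D.n → σ 0 0 = D.n →
    (∀ i, σ 1 i = D.input 1 i) → (e.Tr 0 (fun _ => 0) σ ↔ E D (σ 0 11) (σ 0 12))

/-- The first entries of the adjacency matrix of the extended graph have been written. -/
structure MatInv (a b c : ℕ) (M : ℕ → ℕ) (E : DigraphInst → ℕ → ℕ → Prop) (D : DigraphInst)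
    (x : ℕ) (σ : Store) : Prop where
  fits : Fits a b c M E D
  bdd : Bdd (M D.n) σ
  n : σ 0 0 = D.n
  l : σ 0 2 = (mkPar a b c M E D).l
  k : σ 0 3 = (mkPar a b c M E D).k
  N : σ 0 4 = (mkPar a b c M E D).N
  e : σ 0 5 = (mkPar a b c M E D).e
  low : ∀ r, 0 < r → r ≠ 3 → ∀ i, σ r i = D.input r i
  mat : ∀ u, ∀ v < (mkPar a b c M E D).N, u * (mkPar a b c M E D).N + v < x →
    (σ 3 (u * (mkPar a b c M E D).N + v) ≠ 0 ↔ E D u v)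

theorem MatInv.write {D : DigraphInst} {x : ℕ} {σ : Store} (h : MatInv a b c M E D x σ) {r v : ℕ}
    (hr : 6 ≤ r) (hv : v ≤ M D.n) : MatInv a b c M E D x (σ.write 0 r v) where
  fits := h.fits
  bdd := h.bdd.write _ _ fun _ => hv
  n := by rw [Store.write_of_ne_index _ _ _ _ (by omega), h.n]
  l := by rw [Store.write_of_ne_index _ _ _ _ (by omega), h.l]
  k := by rw [Store.write_of_ne_index _ _ _ _ (by omega), h.k]
  N := by rw [Store.write_of_ne_index _ _ _ _ (by omega), h.N]
  e := by rw [Store.write_of_ne_index _ _ _ _ (by omega), h.e]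
  low r hr h3 i := by rw [Store.write_of_ne_array _ _ _ _ (by omega), h.low r hr h3 i]
  mat u v hv hx := by rw [Store.write_of_ne_array _ _ _ _ (by omega)]; exact h.mat u v hv hx

theorem writeMatrix_polyRun {e : Tm} (he : DescribesEdges e E) :
    PolyRun (fun D : DigraphInst => M D.n) (writeMatrix e) (fun D σ => PrepPar a b c M E D σ)
      (fun D σ => Ready (mkPar a b c M E D) σ) := by
  classical
  refine (PolyRun.for (M := fun D : DigraphInst => M D.n) (b := .reg 4) (r := 11)
    (fun D u σ => MatInv a b c M E D (u * (mkPar a b c M E D).N) σ)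
    (fun D => (mkPar a b c M E D).N) (fun D u σ h => ⟨h.bdd, h.N, h.fits.ok.N_le⟩)
    (fun D u σ v hv h => h.write (by omega) hv) ?_).mono ?_ ?_
  · refine (PolyRun.for (M := fun x : DigraphInst × ℕ => M x.1.n) (b := .reg 4) (r := 12)
      (fun x v σ => (x.2 < (mkPar a b c M E x.1).N ∧ σ 0 11 = x.2) ∧
        MatInv a b c M E x.1 (x.2 * (mkPar a b c M E x.1).N + v) σ)
      (fun x => (mkPar a b c M E x.1).N) (fun x v σ h => ⟨h.2.bdd, h.2.N, h.2.fits.ok.N_le⟩)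
      (fun x u σ v hv h => ⟨⟨h.1.1, ?_⟩, h.2.write (by omega) hv⟩) ?_).mono ?_ ?_
    · rw [Store.write_of_ne_index _ _ _ _ (by omega), h.1.2]
    · refine PolyRun.set (fun x σ h => h.2.1.2.bdd) ?_ (by simp [Tm.WF]) (by simpa using he.1)
      rintro ⟨⟨D, u⟩, v⟩ σ ⟨hv, ⟨⟨hu, h11⟩, h⟩, h12⟩
      dsimp only at hv hu h11 h h12 ⊢
      have hpos : (Tm.add (.mul (.reg 11) (.reg 4)) (.reg 12)).ev σ =
          u * (mkPar a b c M E D).N + v := by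
        simp only [Tm.ev, Tm.mul, Tm.eval, h11, h12, h.N, Finset.sum_const, Finset.card_range,
          smul_eq_mul]
      have htr := he.2 D σ h.fits.n_pos h.n (h.low 1 (by omega) (by omega))
      rw [h11, h12] at htr
      rw [hpos, Tm.ev, Tm.eval_bool]
      refine ⟨⟨⟨hu, ?_⟩, ⟨h.fits, h.bdd.write _ _ fun _ => ?_, ?_, ?_, ?_, ?_, ?_,
        fun r hr h3 i => ?_, fun u' v' hv' hx => ?_⟩⟩, ?_⟩
      · rw [Store.write_of_ne_array _ _ _ _ (by omega), h11]
      · have := h.fits.n_le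
        have := h.fits.n_pos
        split_ifs <;> omega
      · rw [Store.write_of_ne_array _ _ _ _ (by omega), h.n]
      · rw [Store.write_of_ne_array _ _ _ _ (by omega), h.l]
      · rw [Store.write_of_ne_array _ _ _ _ (by omega), h.k]
      · rw [Store.write_of_ne_array _ _ _ _ (by omega), h.N]
      · rw [Store.write_of_ne_array _ _ _ _ (by omega), h.e]
      · rw [Store.write_of_ne_array _ _ _ _ h3, h.low r hr h3]
      · by_cases hx' : u' * (mkPar a b c M E D).N + v' = u * (mkPar a b c M E D).N + v
        · have h1 := congrArg (· % (mkPar a b c M E D).N) hx'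
          have h2 := congrArg (· / (mkPar a b c M E D).N) hx'
          simp only [Nat.mul_add_mod', Nat.mod_eq_of_lt hv, Nat.mod_eq_of_lt hv'] at h1
          simp only [mul_comm _ (mkPar a b c M E D).N,
            Nat.mul_add_div (show 0 < (mkPar a b c M E D).N by omega), Nat.div_eq_of_lt hv,
            Nat.div_eq_of_lt hv', add_zero] at h2
          rw [hx', Store.write_same, h1, h2, ← htr]
          simp
        · rw [Store.write_of_ne_index _ _ _ _ hx']
          exact h.mat u' v' hv' (by omega)
      · rw [Store.write_of_ne_array _ _ _ _ (by omega), h12]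
    · rintro ⟨D, u⟩ σ ⟨hu, h, h11⟩
      exact ⟨⟨hu, h11⟩, h⟩
    · rintro ⟨D, u⟩ σ ⟨⟨hu, h11⟩, h⟩
      dsimp only at h ⊢
      rw [add_mul, one_mul]
      exact ⟨h, h11⟩
  · intro D σ h
    exact ⟨h.fits, h.bdd, h.n, h.l, h.k, h.N, h.e, fun r hr _ i => h.low r hr i,
      fun u v _ hx => absurd hx (by omega)⟩
  · intro D σ h
    have hin : ∀ r, 2 ≤ r → r ≠ 3 → ∀ i, σ r i = 0 := fun r hr h3 i => by
      rw [h.low r (by omega) h3, DigraphInst.input, if_neg (by omega), if_neg (by omega)]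
    exact ⟨⟨h.fits.ok, h.bdd, h.l, h.k, h.N, h.e,
      fun u hu v hv => h.mat u v hv (block_index_lt hu hv)⟩,
      fun i _ => hin 4 (by omega) (by omega) i, fun i _ => hin 5 (by omega) (by omega) i,
      fun r i hr => hin r (by omega) (by omega) i, hin 12 (by omega) (by omega) 0,
      hin 2 (by omega) (by omega) 0⟩

/-! ### The complete algorithm -/

/-- The algorithm for Directed Hamiltonicity that uses the program `p` for Set Cover. -/
def solver (a b c : ℕ) (e : Tm) (p : Prog) : Prog :=
  ifS (.eq (.reg 0) (.lit 0)) (set 2 (.lit 0) (.lit 1))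
    (.seq (.seq (computePar a b c) (writeMatrix e)) (tryAll p))

/-- The graph without nodes has to be treated separately: it counts as Hamiltonian in both versions,
and the padding assumes a node. -/
theorem solver_run {e : Tm} (he : DescribesEdges e E) (p : Prog) : ∃ κ, ∀ R (D : DigraphInst),
    2 ≤ M D.n → 0 < (mkPar a b c M E D).N → (1 ≤ D.n → Fits a b c M E D) →
    Run R (solver a b c e p) D.input
      (M D.n ^ κ * (2 ^ (mkPar a b c M E D).e * (mkPar a b c M E D).N ^ (mkPar a b c M E D).k))
      (fun σ => (D.n = 0 → σ 2 0 ≠ 0) ∧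
        (1 ≤ D.n → (σ 2 0 ≠ 0 → HamSeq (E D) (mkPar a b c M E D).N) ∧
          ∀ t < (mkPar a b c M E D).N ^ (mkPar a b c M E D).k,
            Success p R (mkPar a b c M E D) t → σ 2 0 ≠ 0)) := by
  obtain ⟨κ₁, h₁⟩ := tryAll_run p
  obtain ⟨κ₂, h₂⟩ : PolyRun (fun D : DigraphInst => M D.n)
      (.seq (computePar a b c) (writeMatrix e)) (fun D σ => Fits a b c M E D ∧ σ = D.input)
      (fun D σ => Ready (mkPar a b c M E D) σ) :=
    .seq (computePar_polyRun.mono (fun D σ h => h.2 ▸ prep_input h.1) fun _ _ h => h)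
      (writeMatrix_polyRun he)
  obtain ⟨κ₃, h₃⟩ := (Tm.eq (.reg 0) (.lit 0)).exists_compileSpec 0 0
  obtain ⟨κ₄, h₄⟩ := set_polyRun (a := 2) (t := .lit 0) (u := .lit 1) trivial trivial
  refine ⟨κ₁ + κ₂ + κ₃ + κ₄ + 4, fun R D hM hN hfits s hs => ?_⟩
  have hb : Bdd (M D.n) D.input := by
    rcases Nat.eq_zero_or_pos D.n with hn | hn
    · intro r hr i
      unfold DigraphInst.input
      split_ifs <;> omega
    · exact (prep_input (hfits hn)).bdd
  obtain ⟨s₁, τ₁, e1, e2, e3, e4⟩ := h₃.run (by simp [Tm.WF]) R hM hb hs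
  have hev : (Tm.eq (.reg 0) (.lit 0)).ev D.input = if D.n = 0 then 1 else 0 := by
    simp [Tm.ev, Tm.eval, DigraphInst.input]
  rw [hev] at e3
  set X := M D.n ^ (κ₁ + κ₂ + κ₃ + κ₄) with hX
  set Y := 2 ^ (mkPar a b c M E D).e * (mkPar a b c M E D).N ^ (mkPar a b c M E D).k with hY
  have hY0 : 0 < Y := by positivity
  have hp : ∀ κ', κ' ≤ κ₁ + κ₂ + κ₃ + κ₄ → M D.n ^ κ' ≤ X * Y := fun κ' hκ =>
    (Nat.pow_le_pow_right (by omega) hκ).trans (Nat.le_mul_of_pos_right _ hY0)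
  have hone := hp 0 (by omega)
  rw [pow_zero] at hone
  have hfin : 4 * (X * Y) ≤ M D.n ^ (κ₁ + κ₂ + κ₃ + κ₄ + 4) * Y := by
    rw [← mul_assoc]
    exact Nat.mul_le_mul_right _ (Tm.le_pow_succ_of_le hM 4 le_rfl)
  have k3 := hp κ₃ (by omega)
  rcases Nat.eq_zero_or_pos D.n with hn | hn
  · rw [if_pos hn] at e3
    obtain ⟨s₂, σ₂, τ₂, f1, f2, f3, rfl⟩ := h₄ R (M D.n, D.input) D.input hM ⟨hb, rfl⟩ s₁ e4
    have k4 := hp κ₄ (by omega)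
    refine ⟨s₂, _, _, .seq e1 (.branch_true (by simp [Expr.eval, e3]) f1), f2, ?_, ?_, ?_⟩
    · dsimp only at f3
      omega
    · intro _
      simp [Tm.ev, Tm.eval]
    · omega
  · rw [if_neg (by omega)] at e3
    have hrun := (h₂ R D D.input hM ⟨hfits hn, rfl⟩).seq fun σ₁ hσ₁ => h₁ R _ σ₁ hM hσ₁
    obtain ⟨s₂, σ₂, τ₂, f1, f2, f3, f4⟩ := hrun s₁ e4
    have k2 := hp κ₂ (by omega)
    have k1 : M D.n ^ κ₁ * Y ≤ X * Y :=
      Nat.mul_le_mul_right _ (Nat.pow_le_pow_right (by omega) (by omega))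
    have f3' : τ₂ ≤ M D.n ^ κ₂ + M D.n ^ κ₁ * Y := f3
    refine ⟨s₂, σ₂, _, .seq e1 (.branch_false (by simp [Expr.eval, e3]) f1), f2, ?_, ?_,
      fun _ => f4⟩
    · omega
    · omega

end

/-! ### The extended graphs and their terms -/

/-- The edges of a directed graph, extended by a path from the last node of a Hamiltonian path. -/
def pathEdges (D : DigraphInst) : ℕ → ℕ → Prop := padded D.n D.adj fun _ => True

/-- The edges of a directed graph without those into node `0`, extended by a path that starts where
they would lead. -/
def cycleEdges (D : DigraphInst) : ℕ → ℕ → Prop :=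
  padded D.n (fun u v => v ≠ 0 ∧ D.adj u v) fun u => D.adj u 0

/-- The term for `pathEdges`. -/
def pathTm : Tm :=
  .ite (.lt (.reg 11) (.reg 0))
    (.ite (.lt (.reg 12) (.reg 0)) (.test 1 (.add (.mul (.reg 11) (.reg 0)) (.reg 12)))
      (.eq (.reg 12) (.reg 0)))
    (.eq (.reg 12) (.add (.reg 11) (.lit 1)))

/-- The term for `cycleEdges`. -/
def cycleTm : Tm :=
  .ite (.lt (.reg 11) (.reg 0))
    (.ite (.lt (.reg 12) (.reg 0))
      (.and (.not (.eq (.reg 12) (.lit 0))) (.test 1 (.add (.mul (.reg 11) (.reg 0)) (.reg 12))))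
      (.and (.eq (.reg 12) (.reg 0)) (.test 1 (.add (.mul (.reg 11) (.reg 0)) (.lit 0)))))
    (.eq (.reg 12) (.add (.reg 11) (.lit 1)))

theorem describesEdges_pathTm : DescribesEdges pathTm pathEdges := by
  refine ⟨by simp [pathTm, Tm.WF], fun D σ hD h0 h1 => ?_⟩
  have hadj := fun u v (hu : u < D.n) (hv : v < D.n) => adj_iff_input D hv hu
  simp only [pathTm, Tm.tr_ite, Tm.tr_lt, Tm.tr_eq, Tm.tr_test, Tm.mul, Tm.eval, Finset.sum_const,
    Finset.card_range, smul_eq_mul, h0, h1, pathEdges, padded]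
  have := hadj (σ 0 11) (σ 0 12)
  grind

theorem describesEdges_cycleTm : DescribesEdges cycleTm cycleEdges := by
  refine ⟨by simp [cycleTm, Tm.WF], fun D σ hD h0 h1 => ?_⟩
  have hadj := fun u v (hu : u < D.n) (hv : v < D.n) => adj_iff_input D hv hu
  simp only [cycleTm, Tm.tr_ite, Tm.tr_lt, Tm.tr_eq, Tm.tr_test, Tm.tr_and, Tm.tr_not, Tm.mul,
    Tm.eval, Finset.sum_const,
    Finset.card_range, smul_eq_mul, h0, h1, cycleEdges, padded]
  have h2 := hadj (σ 0 11) (σ 0 12)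
  have h3 := hadj (σ 0 11) 0
  grind

/-! ### Choice of the parameters -/

/-- The bound for the numbers in memory. -/
def memBound (a b c n : ℕ) : ℕ := 2 ^ ((c + 8) * ((Nat.size n + b) * (a * (Nat.size n + b) + 4)))

/-- The factor `a` and the summand `b` fit together. -/
structure Scale (a b : ℕ) : Prop where
  four_le : 4 ≤ a
  pos : 0 < b
  pow_eq : 2 ^ b = 16 * a ^ 2
  le : 1 + a + a * b ≤ 2 ^ b

/-- Take for `a` the largest power of two that is at most `8 / ε`. Being a power of two, it admits
an integer `b` with `2 ^ b = 16 * a ^ 2`. -/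
theorem exists_scale {ε : ℝ} (h0 : 0 < ε) (h1 : ε ≤ 1) :
    ∃ a b, Scale a b ∧ 4 ≤ ε * a ∧ ε * a ≤ 8 := by
  have h8 : 8 ≤ 8 / ε := by rw [le_div_iff₀ h0]; linarith
  obtain ⟨α, hα1, hα2⟩ := exists_nat_pow_near (show (1 : ℝ) ≤ 8 / ε by linarith)
    (show (1 : ℝ) < 2 by norm_num)
  have hα : 2 ≤ α := by
    by_contra hα
    have : (2 : ℝ) ^ (α + 1) ≤ 2 ^ 3 := pow_le_pow_right₀ (by norm_num) (by omega)
    linarith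
  have hlt : α < 2 ^ α := Nat.lt_two_pow_self
  have h4 : 2 ^ 2 ≤ 2 ^ α := Nat.pow_le_pow_right (by norm_num) hα
  have hb : 2 ^ (2 * α + 4) = 16 * (2 ^ α) ^ 2 := by rw [pow_add, mul_comm 2 α, pow_mul]; ring
  rw [le_div_iff₀ h0] at hα1
  rw [div_lt_iff₀ h0, pow_succ] at hα2
  refine ⟨2 ^ α, 2 * α + 4, ⟨by omega, by omega, hb, ?_⟩, ?_, ?_⟩
  · rw [hb]
    generalize 2 ^ α = x at *
    nlinarith
  · push_cast; nlinarith
  · push_cast; nlinarith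

section

variable {a b c : ℕ} {E : DigraphInst → ℕ → ℕ → Prop} {D : DigraphInst}

theorem Scale.block_pos (h : Scale a b) (n : ℕ) : 0 < a * (Nat.size n + b) :=
  Nat.mul_pos (by have := h.four_le; omega) (by have := h.pos; omega)

theorem lt_div_add_one_mul (n : ℕ) {l : ℕ} (hl : 0 < l) :
    n < (n / l + 1) * l ∧ (n / l + 1) * l ≤ n + l := by
  have h1 := Nat.div_add_mod n l
  have h2 := Nat.mod_lt n hl
  have h3 : (n / l + 1) * l = l * (n / l) + l := by ring
  omega

variable {M : ℕ → ℕ}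

theorem Scale.lt_N (h : Scale a b) : D.n < (mkPar a b c M E D).N :=
  (lt_div_add_one_mul _ (h.block_pos _)).1

theorem Scale.N_le (h : Scale a b) : (mkPar a b c M E D).N ≤ D.n + (mkPar a b c M E D).l :=
  (lt_div_add_one_mul _ (h.block_pos _)).2

/-- With `s = Nat.size n`, both `n` and `s` are less than `2 ^ s`, so `n + a * (s + b) + 1` is at
most `2 ^ s * (1 + a + a * b)`; the summand `b` was chosen such that the last factor is at most `2 ^
b`. -/
theorem Scale.N_lt_pow (h : Scale a b) :
    (mkPar a b c M E D).N + 1 ≤ 2 ^ (Nat.size D.n + b) := by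
  have h1 : (mkPar a b c M E D).N ≤ D.n + a * (Nat.size D.n + b) := h.N_le
  have h2 : D.n < 2 ^ Nat.size D.n := Nat.lt_size_self _
  have h3 : Nat.size D.n < 2 ^ Nat.size D.n := Nat.lt_two_pow_self
  have h4 := h.le
  rw [pow_add]
  generalize 2 ^ Nat.size D.n = x at *
  generalize Nat.size D.n = s at *
  have h5 : x * (1 + a + a * b) ≤ x * 2 ^ b := Nat.mul_le_mul_left _ h4
  have h6 : a * s ≤ a * x := Nat.mul_le_mul_left _ h3.le
  have h7 : a * b * 1 ≤ a * b * x := Nat.mul_le_mul_left _ (by omega)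
  nlinarith

theorem l_le_N : (mkPar a b c M E D).l ≤ (mkPar a b c M E D).N :=
  Nat.le_mul_of_pos_left _ (Nat.succ_pos _)

/-- From `N < 2 ^ L` one gets `N ^ (l + 3) ≤ 2 ^ (L * (l + 3))`. The factor `c + 8` in the exponent
of `memBound` also makes room for the part of the fuel exponent `e` that involves `c`. -/
theorem Scale.fits (h : Scale a b) (hD : 1 ≤ D.n) : Fits a b c (memBound a b c) E D := by
  have hN1 := h.lt_N (c := c) (E := E) (D := D) (M := memBound a b c)
  have hN2 := h.N_lt_pow (c := c) (E := E) (D := D) (M := memBound a b c)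
  have ha := h.four_le
  have hNk : (mkPar a b c (memBound a b c) E D).N =
    (mkPar a b c (memBound a b c) E D).k * (a * (Nat.size D.n + b)) := rfl
  have he : (mkPar a b c (memBound a b c) E D).e =
    (mkPar a b c (memBound a b c) E D).k * (Nat.size D.n + b) * (a - 3) +
    (c * ((Nat.size D.n + b) * (a * (Nat.size D.n + b) + 3)) + c) := rfl
  have hl : (mkPar a b c (memBound a b c) E D).l = a * (Nat.size D.n + b) := rfl
  have hL : 1 ≤ Nat.size D.n + b := by have := h.pos; omega
  have hM : memBound a b c D.n =
    2 ^ ((c + 8) * ((Nat.size D.n + b) * (a * (Nat.size D.n + b) + 4))) := rfl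
  have hkk : (mkPar a b c (memBound a b c) E D).k ≤ (mkPar a b c (memBound a b c) E D).N := by
    rw [hNk]; exact Nat.le_mul_of_pos_right _ (h.block_pos _)
  have hkpos : 0 < (mkPar a b c (memBound a b c) E D).k := Nat.succ_pos _
  generalize hLdef : Nat.size D.n + b = L at *
  generalize hZdef : L * (a * L + 4) = Z at *
  have hZL : L * 4 ≤ Z := by rw [← hZdef]; exact Nat.mul_le_mul_left _ (by omega)
  have hZl : a * L + 4 ≤ Z := by rw [← hZdef]; exact Nat.le_mul_of_pos_left _ hL
  have hZ3 : L * (a * L + 3) + L = Z := by rw [← hZdef]; ring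
  have hpw : ∀ x, x ≤ (c + 8) * Z → 2 ^ x ≤ memBound a b c D.n := fun x hx => by
    rw [hM]; exact Nat.pow_le_pow_right (by norm_num) hx
  have hc8 : (c + 8) * Z = c * Z + 8 * Z := by ring
  have hx0 : ∀ x : ℕ, x < 2 ^ x := fun x => Nat.lt_two_pow_self
  have hNM : 2 * (mkPar a b c (memBound a b c) E D).N ≤ memBound a b c D.n := by
    have := hpw (L + 1) (by omega)
    rw [pow_succ] at this
    omega
  have hNN : 2 * (mkPar a b c (memBound a b c) E D).N ≤ 2 ^ (L + 1) := by rw [pow_succ]; omega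
  refine ⟨⟨by rw [hl]; exact hLdef ▸ h.block_pos D.n, hkpos, hl ▸ hNk, by omega,
    ?_, ?_, ?_, ?_⟩, hD, ?_, ?_⟩
  · have h1 : (mkPar a b c (memBound a b c) E D).N ^ ((mkPar a b c (memBound a b c) E D).l + 3) ≤
        2 ^ (L * (a * L + 3)) := by
      rw [hl, pow_mul]
      exact Nat.pow_le_pow_left (by omega) _
    have h2 : 2 ^ 1 ≤ 2 ^ (L * (a * L + 3)) := Nat.pow_le_pow_right (by norm_num) (by
      exact Nat.mul_pos (by omega) (by omega))
    have h3 := hpw (L * (a * L + 3) + 1) (by omega)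
    rw [pow_succ] at h3
    change _ ≤ memBound a b c D.n
    omega
  · have h1 := hpw (a * L + 4) (by omega)
    have h2 := hx0 (a * L + 4)
    change _ ≤ memBound a b c D.n
    omega
  · change _ ≤ memBound a b c D.n
    omega
  · change _ ≤ memBound a b c D.n
    have h1 : (mkPar a b c (memBound a b c) E D).k * L * (a - 3) ≤
        (mkPar a b c (memBound a b c) E D).N := by
      rw [hNk, mul_assoc, mul_comm a]
      exact Nat.mul_le_mul_left _ (Nat.mul_le_mul_left _ (by omega))
    have h2 : c * (L * (a * L + 3)) + c ≤ c * Z := by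
      rw [← hZ3, mul_add c _ L]
      exact Nat.add_le_add_left (Nat.le_mul_of_pos_right _ hL) _
    have h3 := hx0 (c * Z)
    have h4 := hpw (c * Z + 1) (by omega)
    rw [pow_succ] at h4
    omega
  · omega
  · have h1 := hpw L (by omega)
    have h2 := hx0 L
    omega

theorem two_le_memBound (h : Scale a b) (n : ℕ) : 2 ≤ memBound a b c n := by
  have hb := h.pos
  have : 2 ^ 1 ≤ memBound a b c n := Nat.pow_le_pow_right (by norm_num)
    (Nat.mul_pos (by omega) (Nat.mul_pos (by omega) (by omega)))
  omega

end

/-- Powers of `memBound` and the polynomial factor of the given algorithm contribute terms of order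
`L ^ 2` to the exponent, and `2 ^ L` is linear in the number of nodes. So an arbitrarily small
fraction of the latter absorbs them, up to a constant. -/
theorem exists_sq_le_pow (K : ℕ) {d : ℝ} (hd : 0 < d) : ∃ B : ℕ, ∀ x : ℕ,
    (K : ℝ) * x ^ 2 ≤ d * 2 ^ x + B := by
  have ht := (tendsto_pow_const_div_const_pow_of_one_lt 2 (show (1 : ℝ) < 2 by norm_num)).const_mul
    (K : ℝ)
  rw [mul_zero] at ht
  obtain ⟨S, hS⟩ := Filter.eventually_atTop.1 (ht.eventually (gt_mem_nhds hd))
  refine ⟨K * S ^ 2, fun x => ?_⟩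
  have h2 : (0 : ℝ) < 2 ^ x := by positivity
  rcases le_total S x with h | h
  · have := hS x h
    rw [← mul_div_assoc, div_lt_iff₀ h2] at this
    have : (0 : ℝ) ≤ ((K * S ^ 2 : ℕ) : ℝ) := by positivity
    linarith
  · have : K * x ^ 2 ≤ K * S ^ 2 := Nat.mul_le_mul_left _ (Nat.pow_le_pow_left h 2)
    have : (K : ℝ) * x ^ 2 ≤ ((K * S ^ 2 : ℕ) : ℝ) := by exact_mod_cast this
    have : 0 < d * 2 ^ x := by positivity
    linarith

theorem two_pow_size_le (n : ℕ) : 2 ^ Nat.size n ≤ 2 * n + 1 := by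
  rcases Nat.eq_zero_or_pos n with rfl | hn
  · simp
  · have h : Nat.size n - 1 < Nat.size n := by have := Nat.size_pos.2 hn; omega
    have h2 := Nat.lt_size.1 h
    have : 2 ^ Nat.size n = 2 ^ (Nat.size n - 1) * 2 := by rw [← pow_succ]; congr 1; omega
    omega

/-- The total running time. -/
theorem exists_time_bound {a b : ℕ} (h : Scale a b) (c κ : ℕ) : ∃ c' : ℕ, ∀ (E) (D : DigraphInst),
    ((memBound a b c D.n ^ κ * (2 ^ (mkPar a b c (memBound a b c) E D).e *
      (mkPar a b c (memBound a b c) E D).N ^ (mkPar a b c (memBound a b c) E D).k) : ℕ) : ℝ) ≤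
      c' * ((D.n + 1 : ℕ) : ℝ) ^ c' * (2 : ℝ) ^ ((1 - 1 / (a : ℝ)) * D.n) := by
  have ha := h.four_le
  have ha0 : (0 : ℝ) < a := by exact_mod_cast (by omega : 0 < a)
  -- The coefficient collects all terms of order `L ^ 2`: `κ * (c + 8)` from `memBound`, `2 * c`
  -- from the fuel and `a` from rounding `n` up to `N`. The choice of `d` ensures `d * 2 ^ L ≤ n / a
  -- + 1`.
  obtain ⟨B, hB⟩ := exists_sq_le_pow ((κ * (c + 8) + 2 * c) * (a + 4) + a)
    (d := 1 / (2 * a * 2 ^ b)) (by positivity)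
  refine ⟨2 ^ (B + 1), fun E D => ?_⟩
  have hN1 := h.N_le (c := c) (E := E) (D := D) (M := memBound a b c)
  have hN2 := h.N_lt_pow (c := c) (E := E) (D := D) (M := memBound a b c)
  have hNk : (mkPar a b c (memBound a b c) E D).N =
    (mkPar a b c (memBound a b c) E D).k * (a * (Nat.size D.n + b)) := rfl
  have he : (mkPar a b c (memBound a b c) E D).e =
    (mkPar a b c (memBound a b c) E D).k * (Nat.size D.n + b) * (a - 3) +
    (c * ((Nat.size D.n + b) * (a * (Nat.size D.n + b) + 3)) + c) := rfl
  have hl : (mkPar a b c (memBound a b c) E D).l = a * (Nat.size D.n + b) := rfl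
  have hL : 1 ≤ Nat.size D.n + b := by have := h.pos; omega
  have hM : memBound a b c D.n =
    2 ^ ((c + 8) * ((Nat.size D.n + b) * (a * (Nat.size D.n + b) + 4))) := rfl
  have hsize := two_pow_size_le D.n
  have hBx := hB (Nat.size D.n + b)
  have hpow : (2 : ℝ) ^ (Nat.size D.n + b) ≤ (2 * D.n + 1) * 2 ^ b := by
    rw [pow_add]
    exact mul_le_mul_of_nonneg_right (by exact_mod_cast hsize) (by positivity)
  generalize Nat.size D.n + b = L at *
  generalize (mkPar a b c (memBound a b c) E D).N = N at *
  generalize (mkPar a b c (memBound a b c) E D).k = k at *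
  generalize (mkPar a b c (memBound a b c) E D).e = e at *
  generalize (mkPar a b c (memBound a b c) E D).l = l at *
  generalize D.n = n at *
  -- the exponent
  have hexp : memBound a b c n ^ κ * (2 ^ e * N ^ k) ≤
      2 ^ (κ * (c + 8) * (L * (a * L + 4)) + e + L * k) := by
    have h1 : N ^ k ≤ 2 ^ (L * k) := by
      rw [pow_mul]; exact Nat.pow_le_pow_left (by omega) _
    have h2 : memBound a b c n ^ κ = 2 ^ (κ * (c + 8) * (L * (a * L + 4))) := by
      rw [hM, ← pow_mul]; congr 1; ring
    rw [h2, add_assoc, pow_add, pow_add]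
    exact Nat.mul_le_mul_left _ (Nat.mul_le_mul_left _ h1)
  have hexp' : ((κ * (c + 8) * (L * (a * L + 4)) + e + L * k : ℕ) : ℝ) ≤
      (1 - 1 / (a : ℝ)) * n + ((B + 1 : ℕ) : ℝ) := by
    have hkL : (a : ℝ) * (k * L) ≤ n + a * L := by
      have : a * (k * L) ≤ n + a * L := by
        rw [hNk, hl] at hN1
        linarith [hN1, mul_left_comm a k L]
      exact_mod_cast this
    have hL' : (1 : ℝ) ≤ L := by exact_mod_cast hL
    have hd : 1 / (2 * a * 2 ^ b) * (2 : ℝ) ^ L ≤ n / a + 1 := by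
      calc 1 / (2 * a * 2 ^ b) * (2 : ℝ) ^ L ≤ 1 / (2 * a * 2 ^ b) * ((2 * n + 1) * 2 ^ b) :=
            mul_le_mul_of_nonneg_left hpow (by positivity)
        _ = n / a + 1 / (2 * a) := by field_simp
        _ ≤ n / a + 1 := by
            have : (4 : ℝ) ≤ a := by exact_mod_cast ha
            have : 1 / (2 * (a : ℝ)) ≤ 1 := by rw [div_le_one (by positivity)]; linarith
            linarith
    rw [he]
    push_cast [Nat.cast_sub (show 3 ≤ a by omega)] at hBx ⊢
    have hc : (c : ℝ) ≤ c * L ^ 2 := le_mul_of_one_le_right (by positivity) (one_le_pow₀ hL')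
    have h1 : (L : ℝ) ≤ L ^ 2 := by nlinarith
    have h2 : (L : ℝ) * (a * L + 4) ≤ (a + 4) * L ^ 2 := by nlinarith
    have h3 : (c : ℝ) * (L * (a * L + 3)) ≤ c * ((a + 4) * L ^ 2) :=
      mul_le_mul_of_nonneg_left (by nlinarith) (by positivity)
    have h4 : (κ : ℝ) * (c + 8) * (L * (a * L + 4)) ≤ κ * (c + 8) * ((a + 4) * L ^ 2) :=
      mul_le_mul_of_nonneg_left h2 (by positivity)
    have h5 : (c : ℝ) * L ^ 2 ≤ c * ((a + 4) * L ^ 2) :=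
      mul_le_mul_of_nonneg_left (by nlinarith [sq_nonneg (L : ℝ)]) (by positivity)
    -- Fuel and guesses together contribute `k * L * (a - 2)`, which is about `(1 - 2 / a) * n`. One
    -- of the two terms `n / a` is kept to absorb the terms of order `L ^ 2`.
    have h6 : (k : ℝ) * L * (a - 3) + L * k ≤ (1 - 1 / (a : ℝ)) * n - n / a + a * L ^ 2 := by
      have h7 : (k : ℝ) * L ≤ n / a + L := by
        have : (n : ℝ) / a + L = (n + a * L) / a := by field_simp
        rw [this, le_div_iff₀ ha0]
        linarith
      have h8 : (0 : ℝ) ≤ a - 2 := by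
        have : (4 : ℝ) ≤ a := by exact_mod_cast ha
        linarith
      have h9 := mul_le_mul_of_nonneg_right h7 h8
      have h10 : ((n : ℝ) / a + L) * (a - 2) = (1 - 1 / (a : ℝ)) * n - n / a + L * (a - 2) := by
        field_simp
        ring
      have h11 : (a : ℝ) * L ≤ a * L ^ 2 := mul_le_mul_of_nonneg_left h1 ha0.le
      nlinarith
    linarith
  calc ((memBound a b c n ^ κ * (2 ^ e * N ^ k) : ℕ) : ℝ)
      ≤ ((2 ^ (κ * (c + 8) * (L * (a * L + 4)) + e + L * k) : ℕ) : ℝ) := by exact_mod_cast hexp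
    _ = (2 : ℝ) ^ (((κ * (c + 8) * (L * (a * L + 4)) + e + L * k : ℕ) : ℝ)) := by
        rw [Real.rpow_natCast]; push_cast; rfl
    _ ≤ (2 : ℝ) ^ ((1 - 1 / (a : ℝ)) * n + ((B + 1 : ℕ) : ℝ)) :=
        Real.rpow_le_rpow_of_exponent_le (by norm_num) hexp'
    _ = 2 ^ (B + 1) * 1 * (2 : ℝ) ^ ((1 - 1 / (a : ℝ)) * n) := by
        rw [Real.rpow_add (by norm_num), Real.rpow_natCast]; ring
    _ ≤ _ := by
        refine mul_le_mul_of_nonneg_right ?_ (by positivity)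
        push_cast
        refine mul_le_mul_of_nonneg_left (one_le_pow₀ ?_) (by positivity)
        have : (0 : ℝ) ≤ n := by positivity
        linarith

/-! ### The promise and the fuel for a right guess -/

section

variable {a b c : ℕ} {M : ℕ → ℕ} {E : DigraphInst → ℕ → ℕ → Prop} {D : DigraphInst} {ε : ℝ}

/-- The upper bound for the sizes of the sets. -/
noncomputable def setBound (ε : ℝ) (n : ℕ) : ℕ := ⌊128 * (1 / ε * Real.log n)⌋₊

theorem setBound_le (h0 : 0 < ε) (n : ℕ) : (setBound ε n : ℝ) ≤ 128 * (1 / ε * Real.log n) :=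
  Nat.floor_le (mul_nonneg (by norm_num)
    (mul_nonneg (by positivity) (Real.log_natCast_nonneg n)))

/-- The constant `128` is `8 * 16`: the first factor comes from `a ≤ 8 / ε`, the second from `L ≤ 16
* log N`. The latter follows from `2 ^ L ≤ N ^ 8`, which uses that `2 ^ b` is only quadratic in `a ≤
N`, and from `log 2 ≥ 1 / 2`. -/
theorem Scale.le_setBound (h : Scale a b) (h0 : 0 < ε) (ha8 : ε * a ≤ 8) (hD : 1 ≤ D.n) :
    (mkPar a b c M E D).l ≤ setBound ε (mkPar a b c M E D).N := by
  have hl : (mkPar a b c M E D).l = a * (Nat.size D.n + b) := rfl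
  have hL : 1 ≤ Nat.size D.n + b := by have := h.pos; omega
  have hlN := l_le_N (a := a) (b := b) (c := c) (M := M) (E := E) (D := D)
  have hN1 := h.lt_N (c := c) (E := E) (D := D) (M := M)
  have h2n := two_pow_size_le D.n
  generalize (mkPar a b c M E D).N = N at *
  have haN : a ≤ N := by
    rw [hl] at hlN
    exact (Nat.le_mul_of_pos_right _ hL).trans hlN
  have hpow : 2 ^ (Nat.size D.n + b) ≤ N ^ 8 := by
    have h32 : 2 ^ 5 ≤ N ^ 5 := Nat.pow_le_pow_left (by omega) 5
    have ha2 : a ^ 2 ≤ N ^ 2 := Nat.pow_le_pow_left haN 2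
    calc 2 ^ (Nat.size D.n + b) = 2 ^ Nat.size D.n * (16 * a ^ 2) := by rw [pow_add, h.pow_eq]
      _ ≤ (2 * N) * (16 * N ^ 2) := Nat.mul_le_mul (by omega) (Nat.mul_le_mul_left _ ha2)
      _ = 2 ^ 5 * N ^ 3 := by ring
      _ ≤ N ^ 5 * N ^ 3 := Nat.mul_le_mul_right _ h32
      _ = N ^ 8 := by ring
  have hlog : ((Nat.size D.n + b : ℕ) : ℝ) * Real.log 2 ≤ 8 * Real.log N := by
    rw [← Real.log_pow, show (8 : ℝ) = ((8 : ℕ) : ℝ) by norm_num, ← Real.log_pow]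
    exact Real.log_le_log (by positivity) (by exact_mod_cast hpow)
  have hlog2 : (0.5 : ℝ) ≤ Real.log 2 := by have := Real.log_two_gt_d9; linarith
  refine Nat.le_floor ?_
  rw [hl, Nat.cast_mul]
  generalize Nat.size D.n + b = L at *
  have hL16 : (L : ℝ) ≤ 16 * Real.log N := by
    have : (L : ℝ) * 0.5 ≤ L * Real.log 2 := mul_le_mul_of_nonneg_left hlog2 (by positivity)
    linarith
  have ha8' : (a : ℝ) ≤ 8 / ε := by rw [le_div_iff₀ h0]; linarith
  calc (a : ℝ) * L ≤ 8 / ε * (16 * Real.log N) :=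
        mul_le_mul ha8' hL16 (by positivity) (by positivity)
    _ = _ := by ring

/-- Here `log N ≤ L` and `ε * N = k * (ε * a) * L`, so that `4 ≤ ε * a` is more than enough. -/
theorem Scale.mul_log_le (h : Scale a b) (ha4 : 4 ≤ ε * a) :
    ((mkPar a b c M E D).k : ℝ) * Real.log (mkPar a b c M E D).N ≤
      ε * (mkPar a b c M E D).N := by
  have hN2 := h.N_lt_pow (c := c) (E := E) (D := D) (M := M)
  have hN1 := h.lt_N (c := c) (E := E) (D := D) (M := M)
  have hNk : (mkPar a b c M E D).N = (mkPar a b c M E D).k * (a * (Nat.size D.n + b)) := rfl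
  generalize Nat.size D.n + b = L at *
  have hlog : Real.log (mkPar a b c M E D).N ≤ L := by
    have h1 : Real.log (mkPar a b c M E D).N ≤ Real.log ((2 : ℝ) ^ L) :=
      Real.log_le_log (by exact_mod_cast (by omega : 0 < (mkPar a b c M E D).N))
        (by exact_mod_cast (by omega : (mkPar a b c M E D).N ≤ 2 ^ L))
    rw [Real.log_pow] at h1
    have h2 := Real.log_two_lt_d9
    nlinarith [show (0 : ℝ) ≤ L by positivity]
  have hNk' : ((mkPar a b c M E D).N : ℝ) = (mkPar a b c M E D).k * (a * L) := by
    rw [hNk]; push_cast; ring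
  calc ((mkPar a b c M E D).k : ℝ) * Real.log (mkPar a b c M E D).N
      ≤ (mkPar a b c M E D).k * (ε * a * L) := by
        refine mul_le_mul_of_nonneg_left (hlog.trans ?_) (by positivity)
        nlinarith [show (0 : ℝ) ≤ L by positivity]
    _ = _ := by rw [hNk']; ring

theorem add_add_one_le_pow {N m l : ℕ} (hm : m ≤ N ^ (l + 2)) : N + m + 1 ≤ (N + 1) ^ (l + 3) := by
  have h1 : N ^ (l + 2) ≤ (N + 1) ^ (l + 2) := Nat.pow_le_pow_left (Nat.le_succ _) _
  have h3 : (N + 1) ^ (l + 3) = N * (N + 1) ^ (l + 2) + (N + 1) ^ (l + 2) := by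
    rw [pow_succ (N + 1) (l + 2)]; ring
  have h5 : (N + 1) ^ 1 ≤ (N + 1) ^ (l + 2) := Nat.pow_le_pow_right (Nat.succ_pos _) (by omega)
  rcases Nat.eq_zero_or_pos N with rfl | hN
  · simp at hm ⊢; omega
  · have h4 : 1 * (N + 1) ^ (l + 2) ≤ N * (N + 1) ^ (l + 2) := Nat.mul_le_mul_right _ hN
    rw [pow_one] at h5
    omega

/-- The fuel suffices. -/
theorem Scale.le_fuel (h : Scale a b) (ha4 : 4 ≤ ε * a) {m τ : ℕ}
    (hm : m ≤ (mkPar a b c M E D).N ^ ((mkPar a b c M E D).l + 2))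
    (hτ : (τ : ℝ) ≤ c * (((mkPar a b c M E D).N + m + 1 : ℕ) : ℝ) ^ c *
      (2 : ℝ) ^ ((1 - ε) * (mkPar a b c M E D).N)) : τ ≤ 2 ^ (mkPar a b c M E D).e := by
  have ha := h.four_le
  have hN2 := h.N_lt_pow (c := c) (E := E) (D := D) (M := M)
  have hNk : (mkPar a b c M E D).N = (mkPar a b c M E D).k * (a * (Nat.size D.n + b)) := rfl
  have hl : (mkPar a b c M E D).l = a * (Nat.size D.n + b) := rfl
  have he : (mkPar a b c M E D).e = (mkPar a b c M E D).k * (Nat.size D.n + b) * (a - 3) +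
    (c * ((Nat.size D.n + b) * (a * (Nat.size D.n + b) + 3)) + c) := rfl
  generalize Nat.size D.n + b = L at *
  generalize (mkPar a b c M E D).N = N at *
  generalize (mkPar a b c M E D).k = k at *
  generalize (mkPar a b c M E D).l = l at *
  generalize (mkPar a b c M E D).e = e at *
  have hsize : N + m + 1 ≤ 2 ^ (L * (l + 3)) := by
    rw [pow_mul]
    exact (add_add_one_le_pow hm).trans (Nat.pow_le_pow_left hN2 _)
  -- By `N = k * a * L`, the left side is `k * L * (a - ε * a)`, which is at most `k * L * (a - 4)`.
  have hexp : (1 - ε) * N ≤ ((k * L * (a - 3) : ℕ) : ℝ) := by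
    rw [hNk]
    push_cast [Nat.cast_sub (show 3 ≤ a by omega)]
    have : (0 : ℝ) ≤ k * L := by positivity
    nlinarith
  have hc : (c : ℝ) ≤ 2 ^ c := by exact_mod_cast Nat.lt_two_pow_self.le
  have key : (τ : ℝ) ≤ (2 : ℝ) ^ e := by
    refine hτ.trans ?_
    have h1 : (((N + m + 1 : ℕ) : ℝ)) ^ c ≤ ((2 : ℝ) ^ (L * (l + 3))) ^ c :=
      pow_le_pow_left₀ (by positivity) (by exact_mod_cast hsize) _
    have h2 : (2 : ℝ) ^ ((1 - ε) * N) ≤ 2 ^ (k * L * (a - 3)) := by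
      rw [← Real.rpow_natCast]
      exact Real.rpow_le_rpow_of_exponent_le (by norm_num) hexp
    calc _ ≤ 2 ^ c * ((2 : ℝ) ^ (L * (l + 3))) ^ c * 2 ^ (k * L * (a - 3)) := by gcongr
      _ = 2 ^ e := by rw [he, ← hl, ← pow_mul, ← pow_add, ← pow_add]; congr 1; ring
  exact_mod_cast key

/-- The order of the quantifiers matters: the guess and the instance are fixed before the program
and the random bits. -/
theorem Scale.exists_good_guess (h : Scale a b) (h0 : 0 < ε) (ha4 : 4 ≤ ε * a) (ha8 : ε * a ≤ 8)
    (hD : 1 ≤ D.n) (hE : HamSeq (E D) (mkPar a b c (memBound a b c) E D).N) :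
    ∃ t < (mkPar a b c (memBound a b c) E D).N ^ (mkPar a b c (memBound a b c) E D).k,
      ∃ I ∈ restrictedDeltaSetCover (setBound ε) ε, ∀ p R,
        (∃ s τ, Exec R p I.input s τ ∧ (τ : ℝ) ≤ c * ((I.n + I.m + 1 : ℕ) : ℝ) ^ c *
          (2 : ℝ) ^ ((1 - ε) * I.n) ∧ I.IsOptimal (I.answer s)) →
        Success p R (mkPar a b c (memBound a b c) E D) t := by
  have hok := (h.fits (c := c) (E := E) hD).ok
  have hΔ := h.le_setBound (c := c) (E := E) (M := memBound a b c) h0 ha8 hD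
  have hκ := h.mul_log_le (c := c) (E := E) (D := D) (M := memBound a b c) ha4
  obtain ⟨t, ht, hg⟩ := exists_blockStarts hok.l_pos hok.k_pos hE
  have hmem := blockInst_mem hok.l_pos hok.k_pos hok.two_le hg hΔ hκ
  refine ⟨t, ht, _, hmem, ?_⟩
  rintro p R ⟨s, τ, hex, hτ, hopt⟩
  exact ⟨s, τ, hex, h.le_fuel ha4 (blockCodes_length_le _ _ _ _ _ _) hτ, hopt.1,
    blockInst_optimal hok.l_pos hok.k_pos hg hopt⟩

end

/-! ### Transfer of correctness, for both kinds of algorithms -/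

instance : IsProbabilityMeasure coinMeasure := by unfold coinMeasure; infer_instance

theorem le_coinMeasure_of_forall {S : (ℕ → Bool) → Prop} (h : ∀ R, S R) :
    (2 / 3 : ℝ≥0∞) ≤ coinMeasure {R | S R} := by
  rw [Set.eq_univ_of_forall (s := {R | S R}) h, measure_univ]
  exact ENNReal.div_le_of_le_mul (by norm_num)

/-- Negative answers are always correct on graphs without the property. For the others, either the
graph is empty, or there is an instance such that the new algorithm is correct for all bits for
which the given one solves this instance, and monotonicity of the measure finishes the proof. -/
theorem digraphProblem_solvable {kind : AlgKind} {ε : ℝ} {a b : ℕ} (h : Scale a b) (h0 : 0 < ε)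
    (ha4 : 4 ≤ ε * a) (ha8 : ε * a ≤ 8) {e : Tm} {E : DigraphInst → ℕ → ℕ → Prop}
    (he : DescribesEdges e E) {Q : DigraphInst → Prop} (hQ0 : ∀ D, D.n = 0 → Q D)
    (hQ : ∀ D N, 1 ≤ D.n → D.n < N → (Q D ↔ HamSeq (E D) N))
    (hsc : setCover.SolvableInTime kind (restrictedDeltaSetCover (setBound ε) ε) (1 - ε)) :
    (digraphProblem Q).SolvableInTime kind Set.univ (1 - 1 / (a : ℝ)) := by
  obtain ⟨p, c, hp⟩ := hsc
  obtain ⟨κ, hκ⟩ := solver_run (a := a) (b := b) (c := c) (M := memBound a b c) he p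
  obtain ⟨c', hc'⟩ := exists_time_bound h c κ
  refine ⟨solver a b c e p, c', fun D _ => ?_⟩
  have hN := (Nat.zero_le _).trans_lt (h.lt_N (c := c) (E := E) (D := D) (M := memBound a b c))
  have hrun := fun R => hκ R D (two_le_memBound h _) hN h.fits D.input (.refl _)
  -- the answers
  have hno : ¬ Q D → ∀ R s τ, Exec R (solver a b c e p) D.input s τ → (s 2 0 ≠ 0 ↔ Q D) := by
    intro hno R s τ hs
    obtain ⟨s', σ, τ', h1, h2, -, h4, h5⟩ := hrun R
    obtain ⟨rfl, rfl⟩ := hs.det h1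
    rcases Nat.eq_zero_or_pos D.n with hn | hn
    · exact absurd (hQ0 D hn) hno
    · rw [h2 2 (by omega) (by omega), hQ D _ hn h.lt_N]
      refine ⟨(h5 hn).1, fun hham => absurd ((hQ D _ hn h.lt_N).2 hham) hno⟩
  have hyes : Q D → (∀ R, ∃ s τ, Exec R (solver a b c e p) D.input s τ ∧ (s 2 0 ≠ 0 ↔ Q D)) ∨
      ∃ I ∈ restrictedDeltaSetCover (setBound ε) ε, ∀ R,
        (∃ s τ, Exec R p I.input s τ ∧ I.IsOptimal (I.answer s)) →
        ∃ s τ, Exec R (solver a b c e p) D.input s τ ∧ (s 2 0 ≠ 0 ↔ Q D) := by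
    intro hyes
    rcases Nat.eq_zero_or_pos D.n with hn | hn
    · left
      intro R
      obtain ⟨s', σ, τ', h1, h2, -, h4, h5⟩ := hrun R
      refine ⟨s', τ', h1, ?_⟩
      rw [h2 2 (by omega) (by omega)]
      exact iff_of_true (h4 hn) hyes
    · right
      obtain ⟨t, ht, I, hI, hsucc⟩ := h.exists_good_guess h0 ha4 ha8 hn ((hQ D _ hn h.lt_N).1 hyes)
      refine ⟨I, hI, fun R ⟨s, τ, hex, hopt⟩ => ?_⟩
      -- The correct answer and the time bound are promised by separate existence statements;
      -- determinism identifies the two runs.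
      obtain ⟨s₁, τ₁, hex₁, hτ₁⟩ := (hp I hI).1 R
      obtain ⟨rfl, rfl⟩ := hex.det hex₁
      obtain ⟨s', σ, τ', h1, h2, -, h4, h5⟩ := hrun R
      refine ⟨s', τ', h1, ?_⟩
      rw [h2 2 (by omega) (by omega)]
      exact iff_of_true ((h5 hn).2 t ht (hsucc p R ⟨s, τ, hex, hτ₁, hopt⟩)) hyes
  refine ⟨fun R => ?_, ?_⟩
  · obtain ⟨s', σ, τ', h1, -, h3, -⟩ := hrun R
    exact ⟨s', τ', h1, le_trans (by exact_mod_cast h3) (hc' E D)⟩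
  · by_cases hQD : Q D
    · rcases hyes hQD with hR | ⟨I, hI, hR⟩
      · cases kind with
        | deterministic => exact hR
        | randomized => exact le_coinMeasure_of_forall hR
      · have hI2 := (hp I hI).2
        cases kind with
        | deterministic => exact fun R => hR R (hI2 R)
        | randomized => exact hI2.trans (measure_mono fun R hs => hR R hs)
    · have hR : ∀ R, ∃ s τ, Exec R (solver a b c e p) D.input s τ ∧ (s 2 0 ≠ 0 ↔ Q D) := fun R => by
        obtain ⟨s', σ, τ', h1, -⟩ := hrun R
        exact ⟨s', τ', h1, hno hQD R s' τ' h1⟩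
      cases kind with
      | deterministic => exact hR
      | randomized => exact le_coinMeasure_of_forall hR

theorem Exec.one_le {R : ℕ → Bool} {p : Prog} {s s' : Store} {t : ℕ} (h : Exec R p s s' t) :
    1 ≤ t := by
  induction h <;> omega

/-- For `ε > 1`, the running time would be less than one step on some large instances. -/
theorem not_solvable_of_one_lt {kind : AlgKind} {ε : ℝ} (h1 : 1 < ε) :
    ¬ setCover.SolvableInTime kind (restrictedDeltaSetCover (setBound ε) ε) (1 - ε) := by
  rintro ⟨p, c, hp⟩
  -- The polynomial factor will be at most `2 ^ (36 * c * x ^ 2)`: one `c` for the constant in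
  -- front, and `35 * c` for the power of the size. Half of `(ε - 1) * 2 ^ x` beats this exponent up
  -- to `B`, and a large `q` takes care of `B`.
  obtain ⟨B, hB⟩ := exists_sq_le_pow (36 * c) (d := (ε - 1) / 2) (by linarith)
  obtain ⟨q₀, hq₀⟩ := exists_nat_gt (4 * (2 * B / (ε - 1)))
  obtain ⟨q, hq1, hq4⟩ : ∃ q, q₀ ≤ q ∧ 4 ≤ q := ⟨q₀ + 4, by omega, by omega⟩
  have hq : 4 * (2 * B / (ε - 1)) < q := hq₀.trans_le (by exact_mod_cast hq1)
  have hq4' : (4 : ℝ) ≤ q := by exact_mod_cast hq4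
  -- For `N = 2 ^ x * q` this makes `log N` of order `ε * q`, as required on both sides: sets of
  -- size `q` are small enough, and so are covers by `2 ^ x` sets.
  obtain ⟨x, hx⟩ : ∃ x, x = ⌊ε * q / 2⌋₊ := ⟨_, rfl⟩
  have hx1 : (x : ℝ) ≤ ε * q / 2 := hx ▸ Nat.floor_le (by positivity)
  have hx2 : ε * q / 4 ≤ x := by
    have := hx ▸ Nat.lt_floor_add_one (ε * q / 2)
    nlinarith
  have hqx : q ≤ 4 * x := by
    have : (q : ℝ) ≤ 4 * x := by nlinarith
    exact_mod_cast this
  have hpos : 0 < 2 ^ x := by positivity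
  have hlogN : Real.log ((2 ^ x * q : ℕ) : ℝ) = x * Real.log 2 + Real.log q := by
    push_cast
    rw [Real.log_mul (by positivity) (by positivity), Real.log_pow]
  have hl2 := Real.log_two_gt_d9
  have hl2' := Real.log_two_lt_d9
  have hlogq : Real.log q ≤ q / 2 := by
    have h2 := Real.log_le_sub_one_of_pos (show (0 : ℝ) < q / 2 by positivity)
    rw [Real.log_div (by positivity) (by norm_num)] at h2
    linarith
  have hlogq0 : 0 ≤ Real.log q := Real.log_natCast_nonneg q
  have hΔ : q ≤ setBound ε (2 ^ x * q) := by
    refine Nat.le_floor ?_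
    rw [hlogN]
    have h2 : ε * q ≤ 128 * (x * Real.log 2 + Real.log q) := by nlinarith
    calc (q : ℝ) = ε * q * (1 / ε) := by field_simp
      _ ≤ 128 * (x * Real.log 2 + Real.log q) * (1 / ε) :=
        mul_le_mul_of_nonneg_right h2 (by positivity)
      _ = _ := by ring
  have hκ : ((2 ^ x : ℕ) : ℝ) * Real.log ((2 ^ x * q : ℕ) : ℝ) ≤ ε * ((2 ^ x * q : ℕ) : ℝ) := by
    rw [hlogN]
    have h2 : x * Real.log 2 + Real.log q ≤ ε * q := by nlinarith
    calc _ ≤ ((2 ^ x : ℕ) : ℝ) * (ε * q) := mul_le_mul_of_nonneg_left h2 (by positivity)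
      _ = _ := by push_cast; ring
  -- In the complete relation, the natural order is a Hamiltonian path, so the instance for its
  -- block starts satisfies the promise.
  obtain ⟨t, -, hg⟩ := exists_blockStarts (E := fun _ _ => True) (l := q) (k := 2 ^ x)
    (by omega) hpos ⟨id, fun i hi => hi, fun i _ j _ h => h, fun _ _ => trivial⟩
  have hmem := blockInst_mem (by omega) hpos
    (show 2 ≤ 2 ^ x * q from le_trans (by omega) (Nat.le_mul_of_pos_left q hpos)) hg hΔ hκ
  obtain ⟨s, τ, hex, hτ⟩ := (hp _ hmem).1 fun _ => false
  have hm := blockCodes_length_le (fun _ _ => True) (2 ^ x * q) q (2 ^ x) (dig (2 ^ x * q) t)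
    ((2 ^ x * q) ^ (q + 2))
  have hsize := add_add_one_le_pow hm
  generalize (blockCodes (fun _ _ => True) (2 ^ x * q) q (2 ^ x) (dig (2 ^ x * q) t)
    ((2 ^ x * q) ^ (q + 2))) = L at *
  have hτ' : (τ : ℝ) ≤ c * ((2 ^ x * q + L.length + 1 : ℕ) : ℝ) ^ c *
    (2 : ℝ) ^ ((1 - ε) * ((2 ^ x * q : ℕ) : ℝ)) := hτ
  -- The exponent is `5 * x * (q + 3)`, where `q ≤ 4 * x` and `1 ≤ x`.
  have hsize' : 2 ^ x * q + L.length + 1 ≤ 2 ^ (35 * x ^ 2) := by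
    refine hsize.trans ?_
    have hq2 : q < 2 ^ q := Nat.lt_two_pow_self
    have h2 : 2 ^ x * q + 1 ≤ 2 ^ (5 * x) := by
      calc 2 ^ x * q + 1 ≤ 2 ^ x * (q + 1) := by rw [mul_add]; omega
        _ ≤ 2 ^ x * 2 ^ q := Nat.mul_le_mul_left _ hq2
        _ = 2 ^ (x + q) := by rw [pow_add]
        _ ≤ 2 ^ (5 * x) := Nat.pow_le_pow_right (by norm_num) (by omega)
    refine (Nat.pow_le_pow_left h2 _).trans ?_
    rw [← pow_mul]
    exact Nat.pow_le_pow_right (by norm_num) (by nlinarith)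
  have hx1' : (1 : ℝ) ≤ x := by
    have : 1 ≤ x := by omega
    exact_mod_cast this
  have hc : (c : ℝ) ≤ 2 ^ (c * x ^ 2) := by
    have h2 : c < 2 ^ c := Nat.lt_two_pow_self
    have h3 : 2 ^ c ≤ 2 ^ (c * x ^ 2) := Nat.pow_le_pow_right (by norm_num)
      (Nat.le_mul_of_pos_right _ (pow_pos (by omega) _))
    exact_mod_cast h2.le.trans h3
  have hexp : (1 - ε) * ((2 ^ x * q : ℕ) : ℝ) ≤ (1 - ε) * 2 ^ x := by
    push_cast
    exact mul_le_mul_of_nonpos_left (le_mul_of_one_le_right (by positivity) (by linarith))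
      (by linarith)
  have hneg : ((36 * c * x ^ 2 : ℕ) : ℝ) + (1 - ε) * 2 ^ x < 0 := by
    have h2 := hB x
    have h3 : (x : ℝ) < 2 ^ x := by exact_mod_cast Nat.lt_two_pow_self
    have h4 : (q : ℝ) ≤ 4 * x := by exact_mod_cast hqx
    have h5 : 2 * B / (ε - 1) < (2 : ℝ) ^ x := by linarith
    rw [div_lt_iff₀ (by linarith)] at h5
    push_cast at h2 ⊢
    linarith
  have hlt : (τ : ℝ) < 1 := by
    calc (τ : ℝ) ≤ _ := hτ'
      _ ≤ 2 ^ (c * x ^ 2) * ((2 : ℝ) ^ (35 * x ^ 2)) ^ c * (2 : ℝ) ^ ((1 - ε) * 2 ^ x) := by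
        gcongr
        · exact_mod_cast hsize'
        · norm_num
      _ = (2 : ℝ) ^ (((36 * c * x ^ 2 : ℕ) : ℝ) + (1 - ε) * 2 ^ x) := by
        rw [Real.rpow_add (by norm_num), Real.rpow_natCast, ← pow_mul, ← pow_add]
        congr 2
        ring
      _ < 1 := Real.rpow_lt_one_of_one_lt_of_neg (by norm_num) hneg
  have h1τ : (1 : ℝ) ≤ τ := by exact_mod_cast hex.one_le
  linarith

end RAM

theorem theorem2 :
    ∃ C K : ℝ, 0 < C ∧ 0 < K ∧ ∀ ε : ℝ, 0 < ε → ∃ δ : ℝ, 0 < δ ∧ ∀ kind : AlgKind,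
      (∀ Δ : ℕ → ℕ, (∀ n : ℕ, (Δ n : ℝ) ≤ C * (1 / ε * Real.log (n : ℝ))) →
        setCover.SolvableInTime kind (restrictedDeltaSetCover Δ (K * ε)) (1 - ε)) →
      directedHamCycle.SolvableInTime kind Set.univ (1 - δ) ∧
      directedHamPath.SolvableInTime kind Set.univ (1 - δ) := by
  -- The constant `128` is the one in `setBound`, and `1` is the factor of `ε` in
  -- `Scale.mul_log_le`.
  refine ⟨128, 1, by norm_num, by norm_num, fun ε h0 => ?_⟩
  rcases le_or_gt ε 1 with h1 | h1
  · obtain ⟨a, b, h, ha4, ha8⟩ := RAM.exists_scale h0 h1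
    have ha : (0 : ℝ) < a := by
      have := h.four_le
      exact_mod_cast (by omega : 0 < a)
    refine ⟨1 / a, by positivity, fun kind hsc => ?_⟩
    have hsc := hsc (RAM.setBound ε) (RAM.setBound_le h0)
    rw [one_mul] at hsc
    exact ⟨RAM.digraphProblem_solvable h h0 ha4 ha8 RAM.describesEdges_cycleTm
        (fun D hD => ⟨1, fun i => absurd i.2 (by omega)⟩)
        (fun D N hD hN => D.hasHamiltonianCycle_iff hD hN) hsc,
      RAM.digraphProblem_solvable h h0 ha4 ha8 RAM.describesEdges_pathTm
        (fun D hD => ⟨1, fun i hi => absurd hi (by omega)⟩)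
        (fun D N hD hN => D.hasHamiltonianPath_iff hD hN) hsc⟩
  -- The hypothesis on Set Cover is contradictory in this case, so any positive `δ` would do.
  · refine ⟨1, one_pos, fun kind hsc => absurd ?_ (RAM.not_solvable_of_one_lt (kind := kind) h1)⟩
    have hsc := hsc (RAM.setBound ε) (RAM.setBound_le h0)
    rwa [one_mul] at hsc
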